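/- **Maxwell equations for vanishing free current and charge density.** Consider the system $$\nabla\cdot D=0,\quad \nabla\cdot B=0,\quad \nabla\times E+\frac{\partial B}{\partial t}=0,\quad \nabla\times H-\frac{\partial D}{\partial t}=0$$ in the twelve unknown functions $E_i,H_i,D_i,B_i$ ($i=1,2,3$) of $x,y,z,t$. Write $(p_1,\dots,p_{12})=(E_1,E_2,E_3,H_1,H_2,H_3,D_1,D_2,D_3,B_1,B_2,B_3)$ and let $G(\partial_x,\partial_y,\partial_z,\partial_t)$ be the set of the eight left-hand sides $$\partial_xp_7+\partial_yp_8+\partial_zp_9,\quad \partial_xp_{10}+\partial_yp_{11}+\partial_zp_{12},\quad \partial_yp_3-\partial_zp_2+\partial_tp_{10},\quad \partial_zp_1-\partial_xp_3+\partial_tp_{11},\quad \partial_xp_2-\partial_yp_1+\partial_tp_{12},$$ $$\partial_yp_6-\partial_zp_5-\partial_tp_7,\quad \partial_zp_4-\partial_xp_6-\partial_tp_8,\quad \partial_xp_5-\partial_yp_4-\partial_tp_9 .$$ *Conventions.* For a linear system with coefficients in a differential field $K$ with basic set $\Delta$ of commuting derivations (respectively an inversive difference field $K$ with basic set $\Delta$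 of commuting automorphisms), let $\Theta$ be the set of power products of elements of $\Delta$ with exponents in $\mathbb N$ (respectively in $\mathbb Z$), with $\operatorname{ord}$ the sum of the absolute values of the exponents. Let $P$ be the $\Delta$-ideal (respectively, the ideal stable under the automorphisms and their inverses) generated by the left-hand sides in the polynomial ring $K[\theta y_j\mid\theta\in\Theta,\ 1\le j\le 12]$, and let $\eta_j$ be the class of $y_j$ modulo $P$. A polynomial $\phi\in\mathbb Q[r]$ is the differential (respectively difference) dimension polynomial of the system if $P$ is prime and $\phi(r)=\operatorname{trdeg}_KK(\theta\eta_j\mid \operatorname{ord}\theta\le r,\ 1\le j\le 12)$ for all sufficiently large $r\in\mathbb N$. Similarly, for the module $M=F/N$, where $F$ is the free module with free generators $p_1,\dots,p_{12}$ over the ring of operators $\sum_\theta a_\theta\theta$ and $N$ is the submodule generated by the left-hand sides, $\phi$ is the dimension polynomial of $M$ if $\phi(r)=\dim_K\operatorname{span}_K\{\theta \bar p_j\mid\operatorname{ord}\theta\le r\}$ for all sufficiently large $r$, $\bar p_j$ being the class of $p_j$. Gröbner bases of submodules of free modules over operators in $\delta_1,\dots,\delta_n$ (exponents in $\mathbb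 N$) are taken with respect to the order that compares the terms $\delta_1^{k_1}\cdots\delta_n^{k_n}p_j$ by comparing the tuples $(k_1+\dots+k_n,\,j,\,k_1,\dots,k_n)$ lexicographically; a Gröbner basis of $N$ is a finite set of nonzero elements of $N$ modulo which every nonzero element of $N$ is reducible to $0$. 1. *Differential equations.* Let $K$ be a differential field with commuting derivations $\delta_x,\delta_y,\delta_z,\delta_t$. Then $G(\delta_x,\delta_y,\delta_z,\delta_t)$ is a Gröbner basis of the submodule it generates, and the differential dimension polynomial of the system, as well as that of the associated module, is $$\tfrac14r^4+\tfrac{19}{6}r^3+\tfrac{55}{4}r^2+\tfrac{137}{6}r+12 .$$ 2. *Forward difference scheme.* Let $K$ be an inversive difference field of characteristic $0$ with commuting automorphisms $\delta_x,\delta_y,\delta_z,\delta_t$. The difference dimension polynomial of the system $G(\delta_x-1,\delta_y-1,\delta_z-1,\delta_t-1)$, as well as that of the associated module, is $$4r^4+18r^3+35r^2+31r+12 .$$ Moreover, regard $K$ as a difference field with the endomorphisms $\alpha_i=\delta_i$, $\beta_i=\delta_i^{-1}$ ($i\in\{x,y,z,t\}$), ordered as $\alpha_x,\alpha_y,\alpha_z,\alpha_t,\beta_x,\beta_y,\beta_z,\beta_t$.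 Then the submodule of the free $K[\alpha_x,\dots,\beta_t]$-module on $p_1,\dots,p_{12}$ generated by $G(\alpha_x-1,\alpha_y-1,\alpha_z-1,\alpha_t-1)\cup\{\alpha_i\beta_ip_j-p_j\}$ has the following Gröbner basis, which has exactly $80$ elements: the $48$ elements $\alpha_i\beta_ip_j-p_j$ ($i\in\{x,y,z,t\}$, $1\le j\le12$) and the $32$ elements - $\beta_x \beta_y \beta_z p_{12}+\beta_x \beta_y \beta_z p_{11}-\beta_x \beta_y p_{12}+\beta_x \beta_y \beta_z p_{10}-\beta_x \beta_z p_{11}-\beta_y \beta_z p_{10}$ - $\beta_y \beta_z p_{12}-\alpha_x \beta_y \beta_z p_{10}+\beta_y \beta_z p_{11}-\beta_y p_{12}+\beta_y \beta_z p_{10}-\beta_z p_{11}$ - $\beta_x \beta_y \beta_z p_{9}+\beta_x \beta_y \beta_z p_{8}-\beta_x \beta_y p_{9}+\beta_x \beta_y \beta_z p_{7}-\beta_x \beta_z p_{8}-\beta_y \beta_z p_{7}$ - $\beta_y \beta_z p_{9}-\alpha_x \beta_y \beta_z p_{7}+\beta_y \beta_z p_{8}-\beta_y p_{9}+\beta_y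 \beta_z p_{7}-\beta_z p_{8}$ - $\beta_y \beta_z \beta_t p_{7}-\beta_y \beta_z \beta_t p_{6}-\beta_y \beta_z p_{7}+\beta_y \beta_z \beta_t p_{5}+\beta_z \beta_t p_{6}-\beta_y \beta_t p_{5}$ - $-\beta_y \beta_t p_{7}+\alpha_z \beta_y \beta_t p_{5}+\beta_y \beta_t p_{6}+\beta_y p_{7}-\beta_y \beta_t p_{5}-\beta_t p_{6}$ - $-\beta_x \beta_z \beta_t p_{8}+\beta_x \beta_z p_{8}-\beta_x \beta_z \beta_t p_{6}+\beta_z \beta_t p_{6}+\beta_x \beta_z \beta_t p_{4}-\beta_x \beta_t p_{4}$ - $\beta_x \beta_t p_{8}-\beta_x p_{8}+\beta_x \beta_t p_{6}+\alpha_z \beta_x \beta_t p_{4}-\beta_t p_{6}-\beta_x \beta_t p_{4}$ - $\beta_x \beta_y \beta_t p_{9}-\beta_x \beta_y p_{9}-\beta_x \beta_y \beta_t p_{5}+\beta_x \beta_y \beta_t p_{4}+\beta_y \beta_t p_{5}-\beta_x \beta_t p_{4}$ - $\beta_x \beta_t p_{9}-\beta_x p_{9}-\alpha_y \beta_x \beta_t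 p_{4}-\beta_x \beta_t p_{5}+\beta_x \beta_t p_{4}+\beta_t p_{5}$ - $-\beta_y \beta_z \beta_t p_{10}+\beta_y \beta_z p_{10}-\beta_y \beta_z \beta_t p_{3}+\beta_y \beta_z \beta_t p_{2}+\beta_z \beta_t p_{3}-\beta_y \beta_t p_{2}$ - $\beta_y \beta_t p_{10}-\beta_y p_{10}+\alpha_z \beta_y \beta_t p_{2}+\beta_y \beta_t p_{3}-\beta_y \beta_t p_{2}-\beta_t p_{3}$ - $\beta_x \beta_z \beta_t p_{11}-\beta_x \beta_z p_{11}-\beta_x \beta_z \beta_t p_{3}+\beta_z \beta_t p_{3}+\beta_x \beta_z \beta_t p_{1}-\beta_x \beta_t p_{1}$ - $-\beta_x \beta_t p_{11}+\beta_x p_{11}+\beta_x \beta_t p_{3}+\alpha_z \beta_x \beta_t p_{1}-\beta_t p_{3}-\beta_x \beta_t p_{1}$ - $-\beta_x \beta_y \beta_t p_{12}+\beta_x \beta_y p_{12}-\beta_x \beta_y \beta_t p_{2}+\beta_x \beta_y \beta_t p_{1}+\beta_y \beta_t p_{2}-\beta_x \beta_t p_{1}$ - $-\beta_x \beta_t p_{12}+\beta_x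 p_{12}-\alpha_y \beta_x \beta_t p_{1}-\beta_x \beta_t p_{2}+\beta_x \beta_t p_{1}+\beta_t p_{2}$ - $-\beta_t p_{9}+p_{9}-\alpha_x \beta_t p_{5}+\alpha_y \beta_t p_{4}+\beta_t p_{5}-\beta_t p_{4}$ - $-\beta_t p_{8}+\alpha_x \beta_t p_{6}+p_{8}-\beta_t p_{6}-\alpha_z \beta_t p_{4}+\beta_t p_{4}$ - $-\alpha_y \beta_t p_{6}-\beta_t p_{7}+\alpha_z \beta_t p_{5}+\beta_t p_{6}+p_{7}-\beta_t p_{5}$ - $-\beta_t p_{12}+p_{12}+\alpha_x \beta_t p_{2}-\alpha_y \beta_t p_{1}-\beta_t p_{2}+\beta_t p_{1}$ - $-\beta_t p_{11}+p_{11}-\alpha_x \beta_t p_{3}+\beta_t p_{3}+\alpha_z \beta_t p_{1}-\beta_t p_{1}$ - $-\beta_t p_{10}+p_{10}+\alpha_y \beta_t p_{3}-\alpha_z \beta_t p_{2}-\beta_t p_{3}+\beta_t p_{2}$ - $\alpha_y \beta_z p_{11}-\beta_z p_{12}+\alpha_x \beta_z p_{10}-\beta_z p_{11}+p_{12}-\beta_z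 p_{10}$ - $\alpha_y \beta_z p_{8}-\beta_z p_{9}+\alpha_x \beta_z p_{7}-\beta_z p_{8}+p_{9}-\beta_z p_{7}$ - $-\alpha_t p_{9}+p_{9}+\alpha_x p_{5}-\alpha_y p_{4}-p_{5}+p_{4}$ - $-\alpha_t p_{8}+p_{8}-\alpha_x p_{6}+p_{6}+\alpha_z p_{4}-p_{4}$ - $-\alpha_t p_{7}+\alpha_y p_{6}+p_{7}-\alpha_z p_{5}-p_{6}+p_{5}$ - $\alpha_t p_{12}-p_{12}+\alpha_x p_{2}-\alpha_y p_{1}-p_{2}+p_{1}$ - $\alpha_t p_{11}-p_{11}-\alpha_x p_{3}+p_{3}+\alpha_z p_{1}-p_{1}$ - $\alpha_t p_{10}-p_{10}+\alpha_y p_{3}-\alpha_z p_{2}-p_{3}+p_{2}$ - $\alpha_z p_{12}+\alpha_y p_{11}-p_{12}+\alpha_x p_{10}-p_{11}-p_{10}$ - $\alpha_z p_{9}+\alpha_y p_{8}-p_{9}+\alpha_x p_{7}-p_{8}-p_{7}$ 3. *Symmetric difference scheme.* With $K$ as in 2, the difference dimension polynomial of the system $G\big(\tfrac12(\delta_x-\delta_x^{-1}),\tfrac12(\delta_y-\delta_y^{-1}),\tfrac12(\delta_z-\delta_z^{-1}),\tfrac12(\delta_t-\delta_t^{-1})\big)$,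 as well as that of the associated module, is $$4r^4+\tfrac{56}{3}r^3+36r^2+\tfrac{64}{3}r+22 .$$ 4. *Comparison.* For all sufficiently large $r$ the value of the polynomial of the forward scheme is less than that of the symmetric scheme, that is, the forward scheme has the higher strength. -/

import Mathlib

noncomputable section

namespace EinsteinStrength

/-! ### Differential and difference modules, submodules and ideals -/

/-- The free module with `q` free generators over the ring of differential or difference operators
`∑ a_θ θ` (`a_θ ∈ K`), where `θ` runs through the power products of the basic operators. These are
indexed by their exponents: `T` is `Fin n → ℕ` for `n` basic operators, and `Fin n → ℤ` if the
operators are automorphisms whose inverses are also admitted. The terms `θ e_j`, that is the pairs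
`(j, θ)`, form a `K`-basis. -/
abbrev FreeMod (K : Type*) [Field K] (q : ℕ) (T : Type*) : Type _ := (Fin q × T) →₀ K

/-- The free generators. -/
def gen (K : Type*) [Field K] {q : ℕ} (T : Type*) [AddCommMonoid T] (j : Fin q) : FreeMod K q T :=
  Finsupp.single (j, 0) 1

/-- The map `∑ a_{j,θ} θ e_j ↦ ∑ f(a_{j,θ}) (sθ) e_j` (exponents are written additively). -/
def semiShift {K : Type*} [Field K] {q : ℕ} {T : Type*} [AddCommMonoid T] (f : K →+ K) (s : T) :
    AddMonoid.End (FreeMod K q T) :=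
  (Finsupp.mapDomain.addMonoidHom (fun v : Fin q × T => (v.1, s + v.2))).comp
    (Finsupp.mapRange.addMonoidHom f)

/-- Action of the `i`-th derivation on the free differential module:
`δ (a θ e) = δ(a) θ e + a (δθ) e`. -/
def derOp {K : Type*} [Field K] {q n : ℕ} (d : Fin n → Derivation ℤ K K) (i : Fin n) :
    AddMonoid.End (FreeMod K q (Fin n → ℕ)) :=
  semiShift (d i : K →+ K) 0 + semiShift (AddMonoidHom.id K) (Pi.single i 1)

/-- Action of the `i`-th endomorphism on the free difference module:
`δ (a θ e) = δ(a) (δθ) e`. -/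
def endOp {K : Type*} [Field K] {q n : ℕ} (τ : Fin n → K →+* K) (i : Fin n) :
    AddMonoid.End (FreeMod K q (Fin n → ℕ)) :=
  semiShift (τ i : K →+ K) (Pi.single i 1)

/-- Action of the `i`-th automorphism on the free inversive difference module:
`δ (a γ e) = δ(a) (δγ) e`, for `γ` in the free abelian group on the automorphisms. -/
def autOp {K : Type*} [Field K] {q n : ℕ} (σ : Fin n → K ≃+* K) (i : Fin n) :
    AddMonoid.End (FreeMod K q (Fin n → ℤ)) :=
  semiShift ((σ i : K →+* K) : K →+ K) (Pi.single i 1)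

/-- Action of the inverse of the `i`-th automorphism: `δ⁻¹ (a γ e) = δ⁻¹(a) (δ⁻¹γ) e`. -/
def autInvOp {K : Type*} [Field K] {q n : ℕ} (σ : Fin n → K ≃+* K) (i : Fin n) :
    AddMonoid.End (FreeMod K q (Fin n → ℤ)) :=
  semiShift (((σ i).symm : K →+* K) : K →+ K) (Pi.single i (-1))

/-- The smallest `R`-submodule that contains `S` and is stable under the operators `D i`. On the free
modules above this is the submodule over the ring of operators generated by `S`; on a differential
(or difference) ring `F = R` it is the differential (or difference) ideal generated by `S`. -/
def stableSpan (R : Type*) {F ι : Type*} [Semiring R] [AddCommMonoid F] [Module R F]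
    (D : ι → AddMonoid.End F) (S : Set F) : Submodule R F :=
  sInf {N | S ⊆ N ∧ ∀ i, ∀ x ∈ N, D i x ∈ N}

/-! ### Algebras of differential and inversive difference polynomials

The polynomial ring `MvPolynomial (Fin q × T) K` has the indeterminates `θ y_j = X (j, θ)`. -/

/-- The indeterminate `y_j`. -/
def indet (K : Type*) [Field K] {q : ℕ} (T : Type*) [AddCommMonoid T] (j : Fin q) :
    MvPolynomial (Fin q × T) K :=
  MvPolynomial.X (j, 0)

/-- Application of an additive map to all coefficients of a polynomial. -/
def mapCoeff {K V : Type*} [Field K] (f : K →+ K) : AddMonoid.End (MvPolynomial V K) :=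
  (AddMonoidAlgebra.coeffAddEquiv.symm.toAddMonoidHom.comp
    (Finsupp.mapRange.addMonoidHom f)).comp AddMonoidAlgebra.coeffAddEquiv.toAddMonoidHom

/-- The `i`-th derivation of the ring of differential polynomials: it extends the derivation of `K`
and maps `θ y_j` to `(δθ) y_j`. -/
def derPoly {K : Type*} [Field K] {q n : ℕ} (d : Fin n → Derivation ℤ K K) (i : Fin n) :
    AddMonoid.End (MvPolynomial (Fin q × (Fin n → ℕ)) K) :=
  let shiftDer : Derivation K (MvPolynomial (Fin q × (Fin n → ℕ)) K)
      (MvPolynomial (Fin q × (Fin n → ℕ)) K) :=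
    MvPolynomial.mkDerivation K fun v => MvPolynomial.X (v.1, Pi.single i 1 + v.2)
  let shiftHom : AddMonoid.End (MvPolynomial (Fin q × (Fin n → ℕ)) K) :=
    shiftDer.toLinearMap.toAddMonoidHom
  mapCoeff (d i : K →+ K) + shiftHom

/-- The ring endomorphism of the ring of inversive difference polynomials that extends `f : K → K`
and maps `γ y_j` to `(sγ) y_j`. -/
def semiShiftPoly {K : Type*} [Field K] {q : ℕ} {T : Type*} [AddCommMonoid T] (f : K →+* K) (s : T) :
    MvPolynomial (Fin q × T) K →+* MvPolynomial (Fin q × T) K :=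
  MvPolynomial.eval₂Hom (MvPolynomial.C.comp f) fun v => MvPolynomial.X (v.1, s + v.2)

/-- The `i`-th automorphism of the ring of inversive difference polynomials. -/
def autPoly {K : Type*} [Field K] {q n : ℕ} (σ : Fin n → K ≃+* K) (i : Fin n) :
    AddMonoid.End (MvPolynomial (Fin q × (Fin n → ℤ)) K) :=
  (semiShiftPoly (σ i : K →+* K) (Pi.single i 1)).toAddMonoidHom

/-- Its inverse. -/
def autInvPoly {K : Type*} [Field K] {q n : ℕ} (σ : Fin n → K ≃+* K) (i : Fin n) :
    AddMonoid.End (MvPolynomial (Fin q × (Fin n → ℤ)) K) :=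
  (semiShiftPoly ((σ i).symm : K →+* K) (Pi.single i (-1))).toAddMonoidHom

/-! The operators above obey the required rules. -/

theorem semiShift_single {K : Type*} [Field K] {q : ℕ} {T : Type*} [AddCommMonoid T] (f : K →+ K)
    (s : T) (j : Fin q) (t : T) (a : K) :
    semiShift f s (Finsupp.single (j, t) a) = Finsupp.single (j, s + t) (f a) := by
  show Finsupp.mapDomain _ (Finsupp.mapRange f (map_zero f) (Finsupp.single (j, t) a)) = _
  rw [Finsupp.mapRange_single, Finsupp.mapDomain_single]

theorem derOp_single {K : Type*} [Field K] {q n : ℕ} (d : Fin n → Derivation ℤ K K) (i : Fin n)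
    (j : Fin q) (θ : Fin n → ℕ) (a : K) :
    derOp d i (Finsupp.single (j, θ) a) =
      Finsupp.single (j, θ) (d i a) + Finsupp.single (j, Pi.single i 1 + θ) a := by
  have h : derOp d i (Finsupp.single (j, θ) a) =
      semiShift (d i : K →+ K) 0 (Finsupp.single (j, θ) a) +
        semiShift (AddMonoidHom.id K) (Pi.single i 1) (Finsupp.single (j, θ) a) := rfl
  rw [h, semiShift_single, semiShift_single, zero_add]
  rfl

theorem derOp_smul {K : Type*} [Field K] {q n : ℕ} (d : Fin n → Derivation ℤ K K) (i : Fin n)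
    (a : K) (x : FreeMod K q (Fin n → ℕ)) :
    derOp d i (a • x) = d i a • x + a • derOp d i x := by
  induction x using Finsupp.induction_linear with
  | zero => simp
  | add x y hx hy =>
    rw [smul_add, map_add, map_add, hx, hy, smul_add, smul_add]
    abel
  | single v b =>
    obtain ⟨j, t⟩ := v
    simp only [Finsupp.smul_single, smul_eq_mul, derOp_single, smul_add, Derivation.leibniz,
      Finsupp.single_add, mul_comm b]
    abel

theorem semiShift_smul {K : Type*} [Field K] {q : ℕ} {T : Type*} [AddCommMonoid T] (f : K →+* K)
    (s : T) (a : K) (x : FreeMod K q T) :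
    semiShift (f : K →+ K) s (a • x) = f a • semiShift (f : K →+ K) s x := by
  induction x using Finsupp.induction_linear with
  | zero => simp
  | add x y hx hy => rw [smul_add, map_add, map_add, hx, hy, smul_add]
  | single v b =>
    obtain ⟨j, t⟩ := v
    rw [Finsupp.smul_single, semiShift_single, semiShift_single, Finsupp.smul_single]
    simp

theorem mapCoeff_monomial {K V : Type*} [Field K] (f : K →+ K) (s : V →₀ ℕ) (a : K) :
    mapCoeff f (MvPolynomial.monomial s a) = MvPolynomial.monomial s (f a) := by
  show AddMonoidAlgebra.ofCoeff (Finsupp.mapRange f (map_zero f) (Finsupp.single s a)) = _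
  rw [Finsupp.mapRange_single]
  rfl

theorem mapCoeff_mul {K V : Type*} [Field K] (d : Derivation ℤ K K) (x y : MvPolynomial V K) :
    mapCoeff (d : K →+ K) (x * y) =
      x * mapCoeff (d : K →+ K) y + mapCoeff (d : K →+ K) x * y := by
  classical
  have hm : ∀ (s : V →₀ ℕ) (a : K), mapCoeff (d : K →+ K) (MvPolynomial.monomial s a) =
      MvPolynomial.monomial s (d a) := fun s a => mapCoeff_monomial _ s a
  induction x using MvPolynomial.induction_on' with
  | monomial s a =>
    induction y using MvPolynomial.induction_on' with
    | monomial t b =>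
      simp only [MvPolynomial.monomial_mul, hm, Derivation.leibniz, smul_eq_mul, ← map_add,
        mul_comm (d a) b]
    | add p q hp hq =>
      rw [mul_add, map_add, map_add, hp, hq]
      ring
  | add p q hp hq =>
    rw [add_mul, map_add, map_add, hp, hq]
    ring

theorem derPoly_apply {K : Type*} [Field K] {q n : ℕ} (d : Fin n → Derivation ℤ K K) (i : Fin n)
    (x : MvPolynomial (Fin q × (Fin n → ℕ)) K) :
    derPoly d i x = mapCoeff (d i : K →+ K) x +
      MvPolynomial.mkDerivation K (fun v : Fin q × (Fin n → ℕ) =>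
        (MvPolynomial.X (v.1, Pi.single i 1 + v.2) : MvPolynomial (Fin q × (Fin n → ℕ)) K)) x :=
  rfl

theorem derPoly_mul {K : Type*} [Field K] {q n : ℕ} (d : Fin n → Derivation ℤ K K) (i : Fin n)
    (x y : MvPolynomial (Fin q × (Fin n → ℕ)) K) :
    derPoly d i (x * y) = x * derPoly d i y + derPoly d i x * y := by
  rw [derPoly_apply, derPoly_apply, derPoly_apply, mapCoeff_mul]
  simp
  ring

theorem derPoly_C {K : Type*} [Field K] {q n : ℕ} (d : Fin n → Derivation ℤ K K) (i : Fin n) (a : K) :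
    derPoly d i (MvPolynomial.C a : MvPolynomial (Fin q × (Fin n → ℕ)) K) =
      MvPolynomial.C (d i a) := by
  have h : mapCoeff (d i : K →+ K) (MvPolynomial.C a : MvPolynomial (Fin q × (Fin n → ℕ)) K) =
      MvPolynomial.C (d i a) := mapCoeff_monomial _ 0 a
  rw [derPoly_apply, h]
  simp

theorem derPoly_X {K : Type*} [Field K] {q n : ℕ} (d : Fin n → Derivation ℤ K K) (i : Fin n)
    (j : Fin q) (θ : Fin n → ℕ) :
    derPoly d i (MvPolynomial.X (j, θ) : MvPolynomial (Fin q × (Fin n → ℕ)) K) =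
      MvPolynomial.X (j, Pi.single i 1 + θ) := by
  have h : mapCoeff (d i : K →+ K)
      (MvPolynomial.X (j, θ) : MvPolynomial (Fin q × (Fin n → ℕ)) K) = 0 := by
    rw [MvPolynomial.X, mapCoeff_monomial]
    simp
  rw [derPoly_apply, h]
  simp

theorem autOp_autInvOp {K : Type*} [Field K] {q n : ℕ} (σ : Fin n → K ≃+* K) (i : Fin n)
    (x : FreeMod K q (Fin n → ℤ)) : autOp σ i (autInvOp σ i x) = x := by
  induction x using Finsupp.induction_linear with
  | zero => simp
  | add x y hx hy => rw [map_add, map_add, hx, hy]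
  | single v a =>
    obtain ⟨j, t⟩ := v
    rw [autOp, autInvOp, semiShift_single, semiShift_single, ← add_assoc, ← Pi.single_add]
    simp

/-! ### Dimension polynomials -/

/-- Order of a power product with exponents in `ℕ`. -/
def ordNat {n : ℕ} (k : Fin n → ℕ) : ℕ := ∑ i, k i

/-- Order of a power product with exponents in `ℤ`. -/
def ordInt {n : ℕ} (k : Fin n → ℤ) : ℕ := ∑ i, (k i).natAbs

/-- `φ` is the dimension polynomial of the module `M = F / N` (`F` free, `N` a submodule) with
respect to the filtration given by the images `m_j` of the free generators: for all large `r`,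
`φ(r)` is the `K`-dimension of the span `M_r` of all `θ m_j` with `ord θ ≤ r`. -/
def IsModuleDimPoly {K : Type*} [Field K] {q : ℕ} {T : Type*} (ord : T → ℕ)
    (N : Submodule K (FreeMod K q T)) (φ : Polynomial ℚ) : Prop :=
  ∀ᶠ r : ℕ in Filter.atTop, ∃ m : ℕ,
    Module.rank K (Submodule.span K
      {x : FreeMod K q T ⧸ N | ∃ j θ, ord θ ≤ r ∧ x = N.mkQ (Finsupp.single (j, θ) 1)}) = m ∧
    (m : ℚ) = φ.eval (r : ℚ)

/-- `φ` is the dimension polynomial of the system of algebraic differential (or difference)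
equations whose left-hand sides generate the differential (or difference) ideal `P`: the ideal `P` is
prime and, with `η_j` the class of `y_j` modulo `P`, for all large `r` the transcendence degree
over `K` of `K[θ η_j | ord θ ≤ r]` (equivalently, of its field of fractions) is `φ(r)`. -/
def IsSystemDimPoly {K : Type*} [Field K] {q : ℕ} {T : Type*} (ord : T → ℕ)
    (P : Ideal (MvPolynomial (Fin q × T) K)) (φ : Polynomial ℚ) : Prop :=
  P.IsPrime ∧
  ∀ᶠ r : ℕ in Filter.atTop, ∃ m : ℕ,
    Algebra.trdeg K (Algebra.adjoin K
      {x : MvPolynomial (Fin q × T) K ⧸ P |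
        ∃ j θ, ord θ ≤ r ∧ x = Ideal.Quotient.mk P (MvPolynomial.X (j, θ))}) = m ∧
    (m : ℚ) = φ.eval (r : ℚ)

/-! ### Gröbner bases -/

/-- Sort key of the term order: total order first, then the index of the generator, then the
exponents lexicographically. -/
def termKey {q n : ℕ} (v : Fin q × (Fin n → ℕ)) : ℕ ×ₗ (Fin q ×ₗ Lex (Fin n → ℕ)) :=
  toLex (∑ i, v.2 i, toLex (v.1, toLex v.2))

/-- `v` is the leading term of `f`, that is the largest term with a nonzero coefficient. -/
def IsLeadingTerm {K : Type*} [Field K] {q n : ℕ} (f : FreeMod K q (Fin n → ℕ))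
    (v : Fin q × (Fin n → ℕ)) : Prop :=
  v ∈ f.support ∧ ∀ w ∈ f.support, termKey w ≤ termKey v

/-- The operator `δ₁^{k₁} ⋯ δₙ^{kₙ}`. -/
def powProd {F : Type*} [AddCommMonoid F] {n : ℕ} (D : Fin n → AddMonoid.End F) (k : Fin n → ℕ) :
    AddMonoid.End F :=
  (List.ofFn fun i => D i ^ k i).prod

/-- One reduction step `f ⟶ h` modulo `g`: for a power product `μ` such that `f` and `μ g` have the
same leading term, `h` arises from `f` by cancelling this term with a multiple of `μ g`. -/
def ReducesOnce {K : Type*} [Field K] {q n : ℕ}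
    (D : Fin n → AddMonoid.End (FreeMod K q (Fin n → ℕ))) (g f h : FreeMod K q (Fin n → ℕ)) : Prop :=
  ∃ (μ : Fin n → ℕ) (v : Fin q × (Fin n → ℕ)),
    IsLeadingTerm f v ∧ IsLeadingTerm (powProd D μ g) v ∧
    h = f - (f v / powProd D μ g v) • powProd D μ g

/-- `G` is a Gröbner basis of `N`: a finite set of nonzero elements of `N` such that every nonzero
element of `N` is reducible to `0` modulo `G`. -/
def IsGroebnerBasis {K : Type*} [Field K] {q n : ℕ}
    (D : Fin n → AddMonoid.End (FreeMod K q (Fin n → ℕ))) (G : Set (FreeMod K q (Fin n → ℕ)))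
    (N : Submodule K (FreeMod K q (Fin n → ℕ))) : Prop :=
  G.Finite ∧ (∀ g ∈ G, g ∈ N ∧ g ≠ 0) ∧
  ∀ f ∈ N, f ≠ 0 → Relation.ReflTransGen (fun a b => ∃ g ∈ G, ReducesOnce D g a b) f 0

/-! ### Maxwell's equations without free charges and currents -/

/-- Divergence with respect to operators `D 0, D 1, D 2` in the directions `x, y, z`. -/
def div {F : Type*} [AddCommGroup F] (D : Fin 4 → AddMonoid.End F) (u : Fin 3 → F) : F :=
  D 0 (u 0) + D 1 (u 1) + D 2 (u 2)

/-- Curl with respect to operators `D 0, D 1, D 2` in the directions `x, y, z`. -/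
def curl {F : Type*} [AddCommGroup F] (D : Fin 4 → AddMonoid.End F) (u : Fin 3 → F) : Fin 3 → F :=
  ![D 1 (u 2) - D 2 (u 1), D 2 (u 0) - D 0 (u 2), D 0 (u 1) - D 1 (u 0)]

/-- The left-hand sides of `div D = 0`, `div B = 0`, `curl E + ∂B/∂t = 0`, `curl H - ∂D/∂t = 0`,
where `∂/∂x, ∂/∂y, ∂/∂z, ∂/∂t` are replaced by `D 0, D 1, D 2, D 3`, and the twelve elements `p`
are, in this order, the components of the fields `E`, `H`, `D`, `B`. -/
def maxwell {F : Type*} [AddCommGroup F] (D : Fin 4 → AddMonoid.End F) (p : Fin 12 → F) : Set F :=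
  let E : Fin 3 → F := ![p 0, p 1, p 2]
  let H : Fin 3 → F := ![p 3, p 4, p 5]
  let Di : Fin 3 → F := ![p 6, p 7, p 8]
  let B : Fin 3 → F := ![p 9, p 10, p 11]
  {div D Di, div D B} ∪ Set.range (fun k => curl D E k + D 3 (B k)) ∪
    Set.range (fun k => curl D H k - D 3 (Di k))

/-- Forward difference operators `δ_i - 1`, where `A i` is the action of `δ_i`. -/
def forward {F : Type*} [AddCommGroup F] (A : Fin 4 → AddMonoid.End F) (i : Fin 4) :
    AddMonoid.End F :=
  A i - 1

/-- Symmetric difference operators `(δ_i - δ_i⁻¹) / 2`, where `A i` and `A' i` are the actions of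
`δ_i` and `δ_i⁻¹`. -/
def symmetric (K : Type*) {F : Type*} [Field K] [AddCommGroup F] [Module K F]
    (A A' : Fin 4 → AddMonoid.End F) (i : Fin 4) : AddMonoid.End F :=
  (DistribSMul.toAddMonoidHom F (1 / 2 : K)).comp (A i - A' i)

/-- The endomorphisms `α_i = δ_i` (`i < 4`) and `β_i = δ_i⁻¹` (listed after the `α_i`) by which an
inversive difference field with four automorphisms becomes a difference field with eight
endomorphisms. -/
def alphaBeta {K : Type*} [Field K] (σ : Fin 4 → K ≃+* K) : Fin (4 + 4) → K →+* K :=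
  Fin.append (fun i => (σ i : K →+* K)) (fun i => ((σ i).symm : K →+* K))

/-- Action of `α_i` on the free difference module. -/
def alphaOp {K : Type*} [Field K] {q : ℕ} (σ : Fin 4 → K ≃+* K) (i : Fin 4) :
    AddMonoid.End (FreeMod K q (Fin (4 + 4) → ℕ)) :=
  endOp (alphaBeta σ) (Fin.castAdd 4 i)

/-- Action of `β_i` on the free difference module. -/
def betaOp {K : Type*} [Field K] {q : ℕ} (σ : Fin 4 → K ≃+* K) (i : Fin 4) :
    AddMonoid.End (FreeMod K q (Fin (4 + 4) → ℕ)) :=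
  endOp (alphaBeta σ) (Fin.natAdd 4 i)

/-- The elements `α_i β_i p_j - p_j`. -/
def inverseRelations {F : Type*} [AddCommGroup F] (α β : Fin 4 → AddMonoid.End F)
    (p : Fin 12 → F) : Set F :=
  {x | ∃ i j, x = α i (β i (p j)) - p j}

/-- The explicit 80-element Gröbner basis for the forward difference scheme. -/
def forwardBasis {F : Type*} [AddCommGroup F] (α β : Fin 4 → AddMonoid.End F) (p : Fin 12 → F) :
    Set F :=
  let αx := α 0
  let αy := α 1
  let αz := α 2
  let αt := α 3
  let βx := β 0
  let βy := β 1
  let βz := β 2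
  let βt := β 3
  let p1 := p 0
  let p2 := p 1
  let p3 := p 2
  let p4 := p 3
  let p5 := p 4
  let p6 := p 5
  let p7 := p 6
  let p8 := p 7
  let p9 := p 8
  let p10 := p 9
  let p11 := p 10
  let p12 := p 11
  {βx (βy (βz p12)) + βx (βy (βz p11)) - βx (βy p12) + βx (βy (βz p10)) - βx (βz p11) -
        βy (βz p10),
      βy (βz p12) - αx (βy (βz p10)) + βy (βz p11) - βy p12 + βy (βz p10) - βz p11,
      βx (βy (βz p9)) + βx (βy (βz p8)) - βx (βy p9) + βx (βy (βz p7)) - βx (βz p8) - βy (βz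
        p7),
      βy (βz p9) - αx (βy (βz p7)) + βy (βz p8) - βy p9 + βy (βz p7) - βz p8,
      βy (βz (βt p7)) - βy (βz (βt p6)) - βy (βz p7) + βy (βz (βt p5)) + βz (βt p6) - βy (βt
        p5),
      -(βy (βt p7)) + αz (βy (βt p5)) + βy (βt p6) + βy p7 - βy (βt p5) - βt p6,
      -(βx (βz (βt p8))) + βx (βz p8) - βx (βz (βt p6)) + βz (βt p6) + βx (βz (βt p4)) - βx
        (βt p4),
      βx (βt p8) - βx p8 + βx (βt p6) + αz (βx (βt p4)) - βt p6 - βx (βt p4),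
      βx (βy (βt p9)) - βx (βy p9) - βx (βy (βt p5)) + βx (βy (βt p4)) + βy (βt p5) - βx (βt
        p4),
      βx (βt p9) - βx p9 - αy (βx (βt p4)) - βx (βt p5) + βx (βt p4) + βt p5,
      -(βy (βz (βt p10))) + βy (βz p10) - βy (βz (βt p3)) + βy (βz (βt p2)) + βz (βt p3) -
        βy (βt p2),
      βy (βt p10) - βy p10 + αz (βy (βt p2)) + βy (βt p3) - βy (βt p2) - βt p3,
      βx (βz (βt p11)) - βx (βz p11) - βx (βz (βt p3)) + βz (βt p3) + βx (βz (βt p1)) - βx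
        (βt p1),
      -(βx (βt p11)) + βx p11 + βx (βt p3) + αz (βx (βt p1)) - βt p3 - βx (βt p1),
      -(βx (βy (βt p12))) + βx (βy p12) - βx (βy (βt p2)) + βx (βy (βt p1)) + βy (βt p2) -
        βx (βt p1),
      -(βx (βt p12)) + βx p12 - αy (βx (βt p1)) - βx (βt p2) + βx (βt p1) + βt p2,
      -(βt p9) + p9 - αx (βt p5) + αy (βt p4) + βt p5 - βt p4,
      -(βt p8) + αx (βt p6) + p8 - βt p6 - αz (βt p4) + βt p4,
      -(αy (βt p6)) - βt p7 + αz (βt p5) + βt p6 + p7 - βt p5,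
      -(βt p12) + p12 + αx (βt p2) - αy (βt p1) - βt p2 + βt p1,
      -(βt p11) + p11 - αx (βt p3) + βt p3 + αz (βt p1) - βt p1,
      -(βt p10) + p10 + αy (βt p3) - αz (βt p2) - βt p3 + βt p2,
      αy (βz p11) - βz p12 + αx (βz p10) - βz p11 + p12 - βz p10,
      αy (βz p8) - βz p9 + αx (βz p7) - βz p8 + p9 - βz p7,
      -(αt p9) + p9 + αx p5 - αy p4 - p5 + p4,
      -(αt p8) + p8 - αx p6 + p6 + αz p4 - p4,
      -(αt p7) + αy p6 + p7 - αz p5 - p6 + p5,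
      αt p12 - p12 + αx p2 - αy p1 - p2 + p1,
      αt p11 - p11 - αx p3 + p3 + αz p1 - p1,
      αt p10 - p10 + αy p3 - αz p2 - p3 + p2,
      αz p12 + αy p11 - p12 + αx p10 - p11 - p10,
      αz p9 + αy p8 - p9 + αx p7 - p8 - p7} ∪
    inverseRelations α β p

/-! ### The three dimension polynomials -/

/-- `r⁴/4 + 19r³/6 + 55r²/4 + 137r/6 + 12`. -/
def differentialPoly : Polynomial ℚ :=
  let r : Polynomial ℚ := Polynomial.X
  Polynomial.C (1 / 4) * r ^ 4 + Polynomial.C (19 / 6) * r ^ 3 + Polynomial.C (55 / 4) * r ^ 2 +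
    Polynomial.C (137 / 6) * r + 12

/-- `4r⁴ + 18r³ + 35r² + 31r + 12`. -/
def forwardPoly : Polynomial ℚ :=
  let r : Polynomial ℚ := Polynomial.X
  4 * r ^ 4 + 18 * r ^ 3 + 35 * r ^ 2 + 31 * r + 12

/-- `4r⁴ + 56r³/3 + 36r² + 64r/3 + 22`. -/
def symmetricPoly : Polynomial ℚ :=
  let r : Polynomial ℚ := Polynomial.X
  4 * r ^ 4 + Polynomial.C (56 / 3) * r ^ 3 + 36 * r ^ 2 + Polynomial.C (64 / 3) * r + 22

end EinsteinStrength

end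

namespace EinsteinStrength

/-! All dimension polynomials rest on one notion, `IsStandard`: a set `S` of terms that are
independent modulo the submodule `N` and to which every term can be reduced modulo `N` without
raising its order. The terms of `S` of order at most `r` then form a basis of the `r`-th piece of
the module. Substituting normal forms for indeterminates is an endomorphism of the polynomial ring
whose kernel is the ideal generated by the linear forms in `N`. Hence this ideal is prime, and the
transcendence degree is the same number of terms. By `stableSpan_linForm` it is the differential or
difference ideal of the system, so one count serves both the system and the module.

Independence comes from compatibility conditions. The equations split into the blocks (E, B) and (H,
-D). For an element of `N`, regard its coefficients at E and B as functions e, b on the lattice of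
exponents. For the generators, b is a gradient plus the time derivative of a vector potential and e
is minus the curl of that potential, so div e = 0 and ∂e/∂t + curl b = 0 for the corresponding
lattice operators. These conditions have integer coefficients and are translation invariant. They
therefore survive every operator, however it acts on the coefficient field, and hold on all of `N`
(submodule `cycles`). It remains to see that a finitely supported solution whose support consists of
standard terms is zero (`IsCycle.eq_zero_differential`, `IsCycle.eq_zero_forward`,
`IsCycle.eq_zero_symmetric`). Where all other fields in an equation vanish, the remaining one
vanishes outright or is constant under a step or double step along an axis, and finite support makes
it zero; this enlarges the region of vanishing until nothing is left.

Spanning comes from rewriting. For the differential equations and the forward scheme the rules have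
leading coefficients ±1, and the term order is well-founded (`single_mem_sup_irreducible`). Together
with independence this also yields the Gröbner property without S-polynomials
(`isGroebnerBasis_range`): if the leading term of an element of `N` were irreducible, reducing the
other terms would give a nonzero element of `N` with irreducible terms only. For the forward scheme,
terms in α and β are compared with Laurent terms; the kernel of this passage lies in the submodule
generated by the relations α_i β_i p_j - p_j, so membership of the 32 explicit elements is a
comparison of lists of Laurent terms. For the symmetric scheme the equations are used directly to
move the exponents of t and z by two towards 0 and 1 (`single_mem_of_maxwell_subset`).

For the count, each exponent is classified as 0, 1, at least 2, or negative, and each standard set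
is a union of class patterns. A pattern contributes a binomial coefficient in `r`, so for `r ≥ 4`
the count is a polynomial of degree at most 4, determined by five values. -/

/-- The linear map that sends the basis vector `v` to the indeterminate `X v`. -/
noncomputable def linForm (K V : Type*) [Field K] : (V →₀ K) →ₗ[K] MvPolynomial V K :=
  Finsupp.linearCombination K MvPolynomial.X

theorem linForm_single {K V : Type*} [Field K] (v : V) (a : K) :
    linForm K V (Finsupp.single v a) = MvPolynomial.C a * MvPolynomial.X v := by
  rw [linForm, Finsupp.linearCombination_single, MvPolynomial.smul_eq_C_mul]

/-! ### Standard terms: dimension, primality and transcendence degree. -/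

section StandardTerms

variable {K V : Type*} [Field K] {N : Submodule K (V →₀ K)} {S : Set V} {o : V → ℕ}

/-- The terms in `S` are standard for `N`: they are independent modulo `N`, and modulo `N` every term
is a combination of terms in `S` of no larger order. -/
structure IsStandard (N : Submodule K (V →₀ K)) (S : Set V) (o : V → ℕ) : Prop where
  indep : ∀ f ∈ N, (∀ v, f v ≠ 0 → v ∈ S) → f = 0
  span : ∀ w, Finsupp.single w 1 ∈ N ⊔ Finsupp.supported K K {v | v ∈ S ∧ o v ≤ o w}

namespace IsStandard

theorem exists_normalForm (h : IsStandard N S o) (w : V) :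
    ∃ g ∈ Finsupp.supported K K {v | v ∈ S ∧ o v ≤ o w}, Finsupp.single w 1 - g ∈ N := by
  obtain ⟨n, hn, g, hg, hng⟩ := Submodule.mem_sup.1 (h.span w)
  exact ⟨g, hg, by rw [← hng, add_sub_cancel_right]; exact hn⟩

/-- The normal form of a term. -/
noncomputable def nf (h : IsStandard N S o) (w : V) : V →₀ K := (h.exists_normalForm w).choose

theorem nf_mem (h : IsStandard N S o) (w : V) :
    h.nf w ∈ Finsupp.supported K K {v | v ∈ S ∧ o v ≤ o w} :=
  (h.exists_normalForm w).choose_spec.1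

theorem sub_nf_mem (h : IsStandard N S o) (w : V) : Finsupp.single w 1 - h.nf w ∈ N :=
  (h.exists_normalForm w).choose_spec.2

theorem eq_zero_of_mem (h : IsStandard N S o) {f : V →₀ K} (hf : f ∈ N)
    (hs : f ∈ Finsupp.supported K K S) : f = 0 :=
  h.indep f hf fun _ hv => (Finsupp.mem_supported K f).1 hs (Finsupp.mem_support_iff.2 hv)

theorem nf_mem_supported (h : IsStandard N S o) (w : V) : h.nf w ∈ Finsupp.supported K K S :=
  Finsupp.supported_mono (fun _ hv => hv.1) (h.nf_mem w)

theorem nf_of_mem (h : IsStandard N S o) {s : V} (hs : s ∈ S) : h.nf s = Finsupp.single s 1 := by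
  have := h.eq_zero_of_mem (h.sub_nf_mem s)
    (Submodule.sub_mem _ (Finsupp.single_mem_supported K 1 hs) (h.nf_mem_supported s))
  exact (sub_eq_zero.1 this).symm

/-- The normal form of an element. -/
noncomputable def proj (h : IsStandard N S o) : (V →₀ K) →ₗ[K] (V →₀ K) :=
  Finsupp.linearCombination K h.nf

theorem proj_single (h : IsStandard N S o) (v : V) (a : K) :
    h.proj (Finsupp.single v a) = a • h.nf v := Finsupp.linearCombination_single _ _ _

theorem sub_proj_mem (h : IsStandard N S o) (x : V →₀ K) : x - h.proj x ∈ N := by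
  induction x using Finsupp.induction_linear with
  | zero => simp
  | add x y hx hy =>
    rw [map_add, add_sub_add_comm]
    exact N.add_mem hx hy
  | single v a =>
    rw [proj_single, ← mul_one a, ← smul_eq_mul, ← Finsupp.smul_single, smul_eq_mul, mul_one,
      ← smul_sub]
    exact N.smul_mem _ (h.sub_nf_mem v)

theorem proj_mem (h : IsStandard N S o) (x : V →₀ K) : h.proj x ∈ Finsupp.supported K K S := by
  induction x using Finsupp.induction_linear with
  | zero => simp
  | add x y hx hy => rw [map_add]; exact Submodule.add_mem _ hx hy
  | single v a => rw [proj_single]; exact Submodule.smul_mem _ _ (h.nf_mem_supported v)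

theorem proj_eq_zero (h : IsStandard N S o) {x : V →₀ K} (hx : x ∈ N) : h.proj x = 0 := by
  refine h.eq_zero_of_mem ?_ (h.proj_mem x)
  have := N.sub_mem hx (h.sub_proj_mem x)
  rwa [sub_sub_cancel] at this

theorem rank_span (h : IsStandard N S o) (r : ℕ) (hfin : {v | v ∈ S ∧ o v ≤ r}.Finite) :
    Module.rank K (Submodule.span K
      {x : (V →₀ K) ⧸ N | ∃ w, o w ≤ r ∧ x = N.mkQ (Finsupp.single w 1)}) =
      ({v | v ∈ S ∧ o v ≤ r}.ncard : ℕ) := by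
  set A := {v | v ∈ S ∧ o v ≤ r} with hA
  set b : A → (V →₀ K) ⧸ N := fun s => N.mkQ (Finsupp.single s.1 1) with hb
  have hli : LinearIndependent K b := by
    rw [linearIndependent_iff]
    intro l hl
    classical
    have h1 : Finsupp.linearCombination K b l =
        N.mkQ (Finsupp.mapDomain Subtype.val l) := by
      rw [Finsupp.linearCombination_apply, Finsupp.mapDomain, map_finsuppSum]
      refine Finsupp.sum_congr fun s _ => ?_
      rw [hb, ← map_smul, Finsupp.smul_single, smul_eq_mul, mul_one]
    rw [h1, Submodule.mkQ_apply, Submodule.Quotient.mk_eq_zero] at hl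
    have h2 := h.eq_zero_of_mem hl ((Finsupp.mem_supported _ _).2 fun v hv => by
      have := Finsupp.mapDomain_support hv
      obtain ⟨s, -, rfl⟩ := Finset.mem_image.1 this
      exact s.2.1)
    exact Finsupp.mapDomain_injective Subtype.val_injective (by rw [h2, Finsupp.mapDomain_zero])
  have hspan : Submodule.span K
      {x : (V →₀ K) ⧸ N | ∃ w, o w ≤ r ∧ x = N.mkQ (Finsupp.single w 1)} =
      Submodule.span K (Set.range b) := by
    refine le_antisymm (Submodule.span_le.2 ?_) (Submodule.span_mono ?_)
    · rintro x ⟨w, hw, rfl⟩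
      have h1 : N.mkQ (Finsupp.single w 1) = N.mkQ (h.nf w) :=
        (Submodule.Quotient.eq N).2 (h.sub_nf_mem w)
      rw [h1]
      have h2 : h.nf w ∈ Submodule.span K ((fun i => Finsupp.single i (1 : K)) '' A) := by
        rw [← Finsupp.supported_eq_span_single]
        exact Finsupp.supported_mono (fun v (hv : v ∈ S ∧ o v ≤ o w) => (⟨hv.1, hv.2.trans hw⟩ : v ∈ A))
          (h.nf_mem w)
      have h3 := Submodule.mem_map_of_mem (f := N.mkQ) h2
      rw [Submodule.map_span, ← Set.image_comp] at h3
      refine Submodule.span_mono ?_ h3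
      rintro _ ⟨s, hs, rfl⟩
      exact ⟨⟨s, hs⟩, rfl⟩
    · rintro _ ⟨s, rfl⟩
      exact ⟨s.1, s.2.2, rfl⟩
  have h1 := Cardinal.mk_range_eq_of_injective hli.injective
  rw [← Set.cast_ncard hfin, Cardinal.lift_natCast] at h1
  rw [hspan, _root_.rank_span hli]
  exact Cardinal.lift_injective (h1.trans (Cardinal.lift_natCast _).symm)

/-- Substitution of normal forms. -/
noncomputable def subst (h : IsStandard N S o) : MvPolynomial V K →ₐ[K] MvPolynomial V K :=
  MvPolynomial.aeval fun v => linForm K V (h.nf v)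

theorem subst_linForm (h : IsStandard N S o) (x : V →₀ K) :
    h.subst (linForm K V x) = linForm K V (h.proj x) := by
  induction x using Finsupp.induction_linear with
  | zero => simp
  | add x y hx hy => simp only [map_add, hx, hy]
  | single v a =>
    rw [linForm_single, proj_single, map_smul, map_mul, subst, MvPolynomial.aeval_X,
      MvPolynomial.algHom_C, MvPolynomial.smul_eq_C_mul]
    rfl

theorem mk_subst (h : IsStandard N S o) (f : MvPolynomial V K) :
    Ideal.Quotient.mk (Ideal.span (linForm K V '' N)) (h.subst f) =
      Ideal.Quotient.mk (Ideal.span (linForm K V '' N)) f := by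
  set P := Ideal.span (linForm K V '' N)
  have : (Ideal.Quotient.mkₐ K P).comp h.subst = Ideal.Quotient.mkₐ K P := by
    refine MvPolynomial.algHom_ext fun v => ?_
    rw [AlgHom.comp_apply, subst, MvPolynomial.aeval_X]
    refine (Ideal.Quotient.eq.2 ?_).symm
    have h1 : (MvPolynomial.X v : MvPolynomial V K) = linForm K V (Finsupp.single v 1) := by
      rw [linForm_single, MvPolynomial.C_1, one_mul]
    rw [h1, ← map_sub]
    exact Ideal.subset_span ⟨_, h.sub_nf_mem v, rfl⟩
  exact DFunLike.congr_fun this f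

/-- By `mk_subst` the substitution changes a polynomial only by an element of the ideal, so whatever
it kills lies in the ideal. Conversely, linear forms in `N` have normal form zero. Primality follows
because the target of the substitution is a domain. -/
theorem ker_subst (h : IsStandard N S o) :
    RingHom.ker h.subst = Ideal.span (linForm K V '' N) := by
  refine le_antisymm (fun f hf => ?_) (Ideal.span_le.2 ?_)
  · rw [← Ideal.Quotient.eq_zero_iff_mem, ← h.mk_subst, RingHom.mem_ker.1 hf, map_zero]
  · rintro _ ⟨n, hn, rfl⟩
    rw [SetLike.mem_coe, RingHom.mem_ker, subst_linForm, h.proj_eq_zero hn, map_zero]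

theorem isPrime (h : IsStandard N S o) : (Ideal.span (linForm K V '' N)).IsPrime := by
  rw [← h.ker_subst]
  exact RingHom.ker_isPrime _

theorem trdeg_adjoin (h : IsStandard N S o) (r : ℕ) (hfin : {v | v ∈ S ∧ o v ≤ r}.Finite) :
    Algebra.trdeg K (Algebra.adjoin K
      {x : MvPolynomial V K ⧸ Ideal.span (linForm K V '' N) |
        ∃ w, o w ≤ r ∧ x = Ideal.Quotient.mk _ (MvPolynomial.X w)}) =
      ({v | v ∈ S ∧ o v ≤ r}.ncard : ℕ) := by
  set A := {v | v ∈ S ∧ o v ≤ r} with hA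
  set P := Ideal.span (linForm K V '' N)
  set b : A → MvPolynomial V K ⧸ P := fun s => Ideal.Quotient.mkₐ K P (MvPolynomial.X s.1) with hb
  have hai : AlgebraicIndependent K b := by
    rw [algebraicIndependent_iff]
    intro p hp
    have h1 : MvPolynomial.aeval b p =
        Ideal.Quotient.mkₐ K P (MvPolynomial.rename Subtype.val p) := by
      rw [← AlgHom.comp_apply]
      congr 1
      exact MvPolynomial.algHom_ext fun s => by simp [hb]
    -- A standard term is its own normal form, so the substitution fixes every polynomial in
    -- standard indeterminates. A relation between their classes lies in the kernel and is therefore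
    -- trivial.
    have h2 : h.subst (MvPolynomial.rename Subtype.val p) = MvPolynomial.rename Subtype.val p := by
      rw [← AlgHom.comp_apply]
      congr 1
      refine MvPolynomial.algHom_ext fun s => ?_
      rw [AlgHom.comp_apply, MvPolynomial.rename_X, subst, MvPolynomial.aeval_X,
        h.nf_of_mem s.2.1, linForm_single, MvPolynomial.C_1, one_mul]
    have h3 : MvPolynomial.rename Subtype.val p ∈ P := by
      rw [← Ideal.Quotient.eq_zero_iff_mem, ← hp, h1]
      rfl
    rw [show P = _ from h.ker_subst.symm, RingHom.mem_ker, h2] at h3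
    exact MvPolynomial.rename_injective _ Subtype.val_injective (by rw [h3, map_zero])
  have hadj : Algebra.adjoin K
      {x : MvPolynomial V K ⧸ P | ∃ w, o w ≤ r ∧ x = Ideal.Quotient.mk _ (MvPolynomial.X w)} =
      Algebra.adjoin K (Set.range b) := by
    refine le_antisymm (Algebra.adjoin_le ?_) (Algebra.adjoin_mono ?_)
    · rintro x ⟨w, hw, rfl⟩
      have h1 := h.mk_subst (MvPolynomial.X w)
      rw [subst, MvPolynomial.aeval_X] at h1
      rw [← h1]
      have h2 : h.nf w ∈ Submodule.span K ((fun i => Finsupp.single i (1 : K)) '' A) := by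
        rw [← Finsupp.supported_eq_span_single]
        exact Finsupp.supported_mono (fun v (hv : v ∈ S ∧ o v ≤ o w) => (⟨hv.1, hv.2.trans hw⟩ : v ∈ A))
          (h.nf_mem w)
      have h3 := Submodule.mem_map_of_mem
        (f := (Ideal.Quotient.mkₐ K P).toLinearMap ∘ₗ linForm K V) h2
      rw [Submodule.map_span, ← Set.image_comp] at h3
      refine Algebra.span_le_adjoin K _ (Submodule.span_mono ?_ h3)
      rintro _ ⟨s, hs, rfl⟩
      refine ⟨⟨s, hs⟩, ?_⟩
      simp [hb, linForm_single]
    · rintro _ ⟨s, rfl⟩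
      exact ⟨s.1, s.2.2, rfl⟩
  rw [hadj]
  have h1 := hai.aevalEquiv.lift_trdeg_eq
  rw [MvPolynomial.trdeg_of_isDomain, ← Set.cast_ncard hfin] at h1
  simpa using h1.symm

end IsStandard

end StandardTerms

theorem isModuleDimPoly_of_isStandard {K T : Type*} [Field K] {q : ℕ} {ord : T → ℕ}
    {N : Submodule K (FreeMod K q T)} {S : Set (Fin q × T)} {φ : Polynomial ℚ}
    (h : IsStandard N S fun v => ord v.2)
    (hφ : ∀ᶠ r : ℕ in Filter.atTop, {v | v ∈ S ∧ ord v.2 ≤ r}.Finite ∧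
      ({v | v ∈ S ∧ ord v.2 ≤ r}.ncard : ℚ) = φ.eval (r : ℚ)) :
    IsModuleDimPoly ord N φ := by
  filter_upwards [hφ] with r hr
  refine ⟨_, ?_, hr.2⟩
  rw [← h.rank_span r hr.1]
  have : {x : FreeMod K q T ⧸ N | ∃ j θ, ord θ ≤ r ∧ x = N.mkQ (Finsupp.single (j, θ) 1)} =
      {x | ∃ w : Fin q × T, ord w.2 ≤ r ∧ x = N.mkQ (Finsupp.single w 1)} := by
    simp only [Prod.exists]
  rw [this]

theorem isSystemDimPoly_of_isStandard {K T : Type*} [Field K] {q : ℕ} {ord : T → ℕ}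
    {N : Submodule K (FreeMod K q T)} {S : Set (Fin q × T)} {φ : Polynomial ℚ}
    (h : IsStandard N S fun v => ord v.2)
    (hφ : ∀ᶠ r : ℕ in Filter.atTop, {v | v ∈ S ∧ ord v.2 ≤ r}.Finite ∧
      ({v | v ∈ S ∧ ord v.2 ≤ r}.ncard : ℚ) = φ.eval (r : ℚ)) :
    IsSystemDimPoly ord (Ideal.span (linForm K (Fin q × T) '' N)) φ := by
  refine ⟨h.isPrime, ?_⟩
  filter_upwards [hφ] with r hr
  refine ⟨_, ?_, hr.2⟩
  rw [← h.trdeg_adjoin r hr.1]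
  set P := Ideal.span (linForm K (Fin q × T) '' N)
  have : {x : MvPolynomial (Fin q × T) K ⧸ P |
      ∃ j θ, ord θ ≤ r ∧ x = Ideal.Quotient.mk P (MvPolynomial.X (j, θ))} =
      {x | ∃ w : Fin q × T, ord w.2 ≤ r ∧ x = Ideal.Quotient.mk P (MvPolynomial.X w)} := by
    simp only [Prod.exists]
  rw [this]

/-! ### From stable ideals to stable submodules. -/

section StableSpan

variable {R F ι : Type*} [Semiring R] [AddCommMonoid F] [Module R F] {D : ι → AddMonoid.End F}
  {G : Set F}

theorem subset_stableSpan : G ⊆ stableSpan R D G :=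
  fun _ hx => Submodule.mem_sInf.2 fun _ hN => hN.1 hx

theorem stableSpan_stable (i : ι) {x : F} (hx : x ∈ stableSpan R D G) :
    D i x ∈ stableSpan R D G :=
  Submodule.mem_sInf.2 fun N hN => hN.2 i x (Submodule.mem_sInf.1 hx N hN)

theorem stableSpan_le {N : Submodule R F} (hG : G ⊆ N) (hN : ∀ i, ∀ x ∈ N, D i x ∈ N) :
    stableSpan R D G ≤ N :=
  sInf_le ⟨hG, hN⟩

end StableSpan

/-- The ideal generated, under the operators `D'`, by linear forms is generated by the linear forms in
the corresponding submodule of the free module. -/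
theorem stableSpan_linForm {K V ι : Type*} [Field K] {D : ι → AddMonoid.End (V →₀ K)}
    {D' : ι → AddMonoid.End (MvPolynomial V K)} (G : Set (V →₀ K))
    (hD : ∀ i x, D' i (linForm K V x) = linForm K V (D i x))
    (hmul : ∀ i a x, D' i (a * x) ∈ Ideal.span {x, D' i x}) :
    stableSpan (MvPolynomial V K) D' (linForm K V '' G) =
      Ideal.span (linForm K V '' stableSpan K D G) := by
  refine le_antisymm (stableSpan_le ?_ ?_) (Ideal.span_le.2 ?_)
  · exact (Set.image_mono subset_stableSpan).trans Ideal.subset_span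
  · intro i x hx
    induction hx using Submodule.span_induction with
    | mem x hx =>
      obtain ⟨n, hn, rfl⟩ := hx
      rw [hD]
      exact Ideal.subset_span ⟨_, stableSpan_stable i hn, rfl⟩
    | zero => rw [map_zero]; exact Submodule.zero_mem _
    | add x y _ _ hx hy => rw [map_add]; exact Submodule.add_mem _ hx hy
    -- The hypothesis `hmul` covers the Leibniz rule of a derivation and the multiplicativity of an
    -- automorphism at once.
    | smul a x hx hDx =>
      refine (Ideal.span_le.2 ?_) (hmul i a x)
      rintro y (rfl | rfl)
      exacts [hx, hDx]
  · have : stableSpan K D G ≤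
        ((stableSpan (MvPolynomial V K) D' (linForm K V '' G)).restrictScalars K).comap
          (linForm K V) := by
      refine stableSpan_le (fun g hg => ?_) fun i x hx => ?_
      · exact subset_stableSpan (R := MvPolynomial V K) ⟨g, hg, rfl⟩
      · have := stableSpan_stable (R := MvPolynomial V K) i hx
        rwa [hD] at this
    rintro _ ⟨n, hn, rfl⟩
    exact this hn

theorem derPoly_linForm {K : Type*} [Field K] {q n : ℕ} (d : Fin n → Derivation ℤ K K) (i : Fin n)
    (x : FreeMod K q (Fin n → ℕ)) :
    derPoly d i (linForm K _ x) = linForm K _ (derOp d i x) := by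
  induction x using Finsupp.induction_linear with
  | zero => simp
  | add x y hx hy => simp only [map_add, hx, hy]
  | single v a =>
    obtain ⟨j, t⟩ := v
    rw [derOp_single, map_add, linForm_single, linForm_single, linForm_single, derPoly_mul,
      derPoly_C, derPoly_X, add_comm]

theorem semiShiftPoly_linForm {K T : Type*} [Field K] {q : ℕ} [AddCommMonoid T] (f : K →+* K)
    (s : T) (x : FreeMod K q T) :
    semiShiftPoly f s (linForm K _ x) = linForm K _ (semiShift (f : K →+ K) s x) := by
  induction x using Finsupp.induction_linear with
  | zero => simp
  | add x y hx hy => simp only [map_add, hx, hy]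
  | single v a =>
    obtain ⟨j, t⟩ := v
    rw [semiShift_single, linForm_single, linForm_single]
    simp [semiShiftPoly]

theorem stableSpan_derPoly {K : Type*} [Field K] {q n : ℕ} (d : Fin n → Derivation ℤ K K)
    (G : Set (FreeMod K q (Fin n → ℕ))) :
    stableSpan _ (derPoly d) (linForm K _ '' G) =
      Ideal.span (linForm K _ '' stableSpan K (derOp d) G) := by
  refine stableSpan_linForm G (derPoly_linForm d) fun i a x => ?_
  rw [derPoly_mul]
  exact Ideal.add_mem _ (Ideal.mul_mem_left _ _ (Ideal.subset_span (by simp)))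
    (Ideal.mul_mem_left _ _ (Ideal.subset_span (by simp)))

theorem stableSpan_autPoly {K : Type*} [Field K] {q n : ℕ} (σ : Fin n → K ≃+* K)
    (G : Set (FreeMod K q (Fin n → ℤ))) :
    stableSpan _ (Sum.elim (autPoly σ) (autInvPoly σ)) (linForm K _ '' G) =
      Ideal.span (linForm K _ '' stableSpan K (Sum.elim (autOp σ) (autInvOp σ)) G) := by
  refine stableSpan_linForm G ?_ ?_
  · rintro (i | i) x <;> exact semiShiftPoly_linForm _ _ x
  · rintro (i | i) a x
    · exact (map_mul (semiShiftPoly (σ i : K →+* K) (Pi.single i 1)) a x).symm ▸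
        Ideal.mul_mem_left _ _ (Ideal.subset_span (Or.inr rfl))
    · exact (map_mul (semiShiftPoly ((σ i).symm : K →+* K) (Pi.single i (-1))) a x).symm ▸
        Ideal.mul_mem_left _ _ (Ideal.subset_span (Or.inr rfl))

/-- The eight expressions are built additively from the elements `D i (p j)`, so compatibility on
these suffices. This carries the equations through every change of setting: to linear forms, to
Laurent or integer exponents, to translates, and to the equations without the factor 1/2. -/
theorem image_maxwell {F F' : Type*} [AddCommGroup F] [AddCommGroup F'] (Φ : F →+ F')
    {D : Fin 4 → AddMonoid.End F} {D' : Fin 4 → AddMonoid.End F'} {p : Fin 12 → F}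
    {p' : Fin 12 → F'} (h : ∀ i j, Φ (D i (p j)) = D' i (p' j)) :
    Φ '' maxwell D p = maxwell D' p' := by
  simp only [maxwell, Set.image_union, ← Set.range_comp, Set.image_insert_eq, Set.image_singleton]
  congr 1
  · congr 1
    · simp [div, h]
    · congr 1
      funext k
      fin_cases k <;> simp [curl, h]
  · congr 1
    funext k
    fin_cases k <;> simp [curl, h]

theorem forall_mem_maxwell {F : Type*} [AddCommGroup F] {D : Fin 4 → AddMonoid.End F}
    {p : Fin 12 → F} {Q : F → Prop} :
    (∀ x ∈ maxwell D p, Q x) ↔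
      Q (D 0 (p 6) + D 1 (p 7) + D 2 (p 8)) ∧ Q (D 0 (p 9) + D 1 (p 10) + D 2 (p 11)) ∧
      Q (D 1 (p 2) - D 2 (p 1) + D 3 (p 9)) ∧ Q (D 2 (p 0) - D 0 (p 2) + D 3 (p 10)) ∧
      Q (D 0 (p 1) - D 1 (p 0) + D 3 (p 11)) ∧ Q (D 1 (p 5) - D 2 (p 4) - D 3 (p 6)) ∧
      Q (D 2 (p 3) - D 0 (p 5) - D 3 (p 7)) ∧ Q (D 0 (p 4) - D 1 (p 3) - D 3 (p 8)) := by
  simp only [maxwell, Set.mem_union, or_imp, forall_and, Set.forall_mem_range, Set.mem_insert_iff,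
    Set.mem_singleton_iff, forall_eq, Fin.forall_fin_succ, IsEmpty.forall_iff, and_true, and_assoc]
  rfl

/-! ### Counting terms by the classes of their exponents. -/

/-- The class of an integer: `0`, `1`, at least `2`, or negative. -/
def cell (k : ℤ) : Fin 4 := if k = 0 then 0 else if k = 1 then 1 else if 0 < k then 2 else 3

/-- The number of coordinates of class `1` or `2`. -/
def cellOffset {n : ℕ} (p : Fin n → Fin 4) : ℕ := ∑ i, if p i = 1 ∨ p i = 2 then 1 else 0

/-- The number of coordinates of class `2` or `3`. -/
def cellDim {n : ℕ} (p : Fin n → Fin 4) : ℕ := ∑ i, if p i = 2 ∨ p i = 3 then 1 else 0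

theorem cell_eq_zero {k : ℤ} : cell k = 0 ↔ k = 0 := by
  unfold cell; split_ifs <;> simp <;> omega

theorem cell_eq_one {k : ℤ} : cell k = 1 ↔ k = 1 := by
  unfold cell; split_ifs <;> simp <;> omega

theorem cell_eq_two {k : ℤ} : cell k = 2 ↔ 2 ≤ k := by
  unfold cell; split_ifs <;> simp <;> omega

theorem cell_eq_three {k : ℤ} : cell k = 3 ↔ k < 0 := by
  unfold cell; split_ifs <;> simp <;> omega

theorem cellOffset_le_ordInt {n : ℕ} (k : Fin n → ℤ) : cellOffset (fun i => cell (k i)) ≤ ordInt k := by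
  refine Finset.sum_le_sum fun i _ => ?_
  simp only [cell_eq_one, cell_eq_two]
  split_ifs <;> omega

theorem sum_range_choose_sub (r m : ℕ) :
    ∑ a ∈ Finset.range r, (r - 1 - a).choose m = r.choose (m + 1) := by
  rw [Finset.sum_range_reflect (fun a => a.choose m) r]
  induction r with
  | zero => simp
  | succ r ih => rw [Finset.sum_range_succ, ih, Nat.choose_succ_succ, add_comm]

theorem ordInt_succ {n : ℕ} (k : Fin (n + 1) → ℤ) :
    ordInt k = (k 0).natAbs + ordInt (Fin.tail k) := Fin.sum_univ_succ _

/-- Once the offset is subtracted, an exponent 0 or 1 contributes nothing to the order, while `a +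
2` and `-a - 1` with `a ≥ 0` both contribute `a + 1`. So tuples of `cellDim p` positive integers
with sum at most `r` are counted, besides the choice of signs fixed by `p`. The induction splits off
the first coordinate and sums binomial coefficients by the hockey-stick identity
`sum_range_choose_sub`. -/
theorem exists_finset_cell {n : ℕ} (p : Fin n → Fin 4) (r : ℕ) :
    ∃ A : Finset (Fin n → ℤ),
      (∀ k, k ∈ A ↔ (∀ i, cell (k i) = p i) ∧ ordInt k ≤ r + cellOffset p) ∧
      A.card = r.choose (cellDim p) := by
  induction n generalizing r with
  | zero => exact ⟨Finset.univ, fun k => iff_of_true (Finset.mem_univ k)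
      ⟨fun i => i.elim0, by simp [ordInt]⟩, by simp [cellDim]⟩
  | succ n ih =>
    choose A hA hc using ih (Fin.tail p)
    have hoff : cellOffset p = (if p 0 = 1 ∨ p 0 = 2 then 1 else 0) + cellOffset (Fin.tail p) :=
      Fin.sum_univ_succ _
    have hdim : cellDim p = (if p 0 = 2 ∨ p 0 = 3 then 1 else 0) + cellDim (Fin.tail p) :=
      Fin.sum_univ_succ _
    have hall : ∀ k : Fin (n + 1) → ℤ, (∀ i, cell (k i) = p i) ↔
        cell (k 0) = p 0 ∧ ∀ i, cell (Fin.tail k i) = Fin.tail p i := fun k => Fin.forall_fin_succ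
    have hle : ∀ k : Fin (n + 1) → ℤ, (∀ i, cell (Fin.tail k i) = Fin.tail p i) →
        cellOffset (Fin.tail p) ≤ ordInt (Fin.tail k) := fun k hk => by
      rw [← funext hk]
      exact cellOffset_le_ordInt _
    have hpoint : ∀ c : ℤ, ((A r).image (Fin.cons (α := fun _ => ℤ) c)).card =
        r.choose (cellDim (Fin.tail p)) := fun c => by
      rw [Finset.card_image_of_injective _ (Fin.cons_right_injective _), hc]
    have hmem : ∀ (c : ℤ) (s : ℕ) (k : Fin (n + 1) → ℤ),
        k ∈ (A s).image (Fin.cons (α := fun _ => ℤ) c) ↔ k 0 = c ∧ Fin.tail k ∈ A s := by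
      intro c s k
      rw [Finset.mem_image]
      constructor
      · rintro ⟨t, ht, rfl⟩
        exact ⟨Fin.cons_zero _ _, by rwa [Fin.tail_cons]⟩
      · rintro ⟨rfl, ht⟩
        exact ⟨_, ht, Fin.cons_self_tail k⟩
    -- A first coordinate on a ray uses up `a + 1` of the bound and leaves `r - 1 - a` for the
    -- others.
    have hray : ∀ g : ℕ → ℤ, Function.Injective g →
        ((Finset.range r).biUnion fun a =>
          (A (r - 1 - a)).image (Fin.cons (α := fun _ => ℤ) (g a))).card =
        r.choose (cellDim (Fin.tail p) + 1) := fun g hg => by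
      rw [Finset.card_biUnion, ← sum_range_choose_sub]
      · refine Finset.sum_congr rfl fun a _ => ?_
        rw [Finset.card_image_of_injective _ (Fin.cons_right_injective _), hc]
      · intro a _ b _ hab
        rw [Function.onFun, Finset.disjoint_left]
        intro k hka hkb
        exact hab (hg (((hmem _ _ _).1 hka).1.symm.trans ((hmem _ _ _).1 hkb).1))
    generalize hp0 : p 0 = p0 at *
    fin_cases p0
    · refine ⟨_, fun k => ?_, (hpoint 0).trans (by simp [hdim])⟩
      rw [hmem, hA, hall, ordInt_succ, hoff]
      simp only [Fin.zero_eta, cell_eq_zero, and_assoc]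
      refine and_congr_right fun h0 => and_congr_right fun _ => ?_
      simp [h0]
    · refine ⟨_, fun k => ?_, (hpoint 1).trans (by simp [hdim])⟩
      rw [hmem, hA, hall, ordInt_succ, hoff]
      simp only [Fin.mk_one, cell_eq_one, and_assoc]
      refine and_congr_right fun h0 => and_congr_right fun _ => ?_
      simp [h0]
      omega
    · refine ⟨_, fun k => ?_, (hray (fun a => a + 2) fun a b h => by simpa using h).trans
        (by simp [hdim, add_comm])⟩
      rw [Finset.mem_biUnion, hall, ordInt_succ, hoff]
      simp only [Fin.reduceFinMk, cell_eq_two, and_assoc, hmem, hA, Finset.mem_range]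
      constructor
      · rintro ⟨a, ha, h0, h1, h2⟩
        refine ⟨by omega, h1, ?_⟩
        simp [h0]
        omega
      · rintro ⟨h0, h1, h2⟩
        have := hle k h1
        simp at h2
        exact ⟨(k 0).toNat - 2, by omega, by omega, h1, by omega⟩
    · refine ⟨_, fun k => ?_, (hray (fun a => -a - 1) fun a b h => by simpa using h).trans
        (by simp [hdim, add_comm])⟩
      rw [Finset.mem_biUnion, hall, ordInt_succ, hoff]
      simp only [Fin.reduceFinMk, cell_eq_three, and_assoc, hmem, hA, Finset.mem_range]
      constructor
      · rintro ⟨a, ha, h0, h1, h2⟩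
        refine ⟨by omega, h1, ?_⟩
        simp [h0]
        omega
      · rintro ⟨h0, h1, h2⟩
        have := hle k h1
        simp at h2
        exact ⟨(-k 0).toNat - 1, by omega, by omega, h1, by omega⟩

theorem cellOffset_le {n : ℕ} (p : Fin n → Fin 4) : cellOffset p ≤ n := by
  refine (Finset.sum_le_sum (g := fun _ => 1) fun i _ => ?_).trans (by simp)
  split_ifs <;> simp

theorem ncard_cells {q n : ℕ} (C : Fin q → (Fin n → Fin 4) → Bool) (r : ℕ) (hr : n ≤ r) :
    {v : Fin q × (Fin n → ℤ) | C v.1 (fun i => cell (v.2 i)) ∧ ordInt v.2 ≤ r}.Finite ∧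
    {v : Fin q × (Fin n → ℤ) | C v.1 (fun i => cell (v.2 i)) ∧ ordInt v.2 ≤ r}.ncard =
      ∑ j, ∑ p, if C j p then (r - cellOffset p).choose (cellDim p) else 0 := by
  choose A hA hc using fun p : Fin n → Fin 4 => exists_finset_cell p (r - cellOffset p)
  have hset : {v : Fin q × (Fin n → ℤ) | C v.1 (fun i => cell (v.2 i)) ∧ ordInt v.2 ≤ r} =
      ((Finset.univ.filter fun w : Fin q × (Fin n → Fin 4) => C w.1 w.2).biUnion fun w =>
        (A w.2).image (Prod.mk w.1) : Finset (Fin q × (Fin n → ℤ))) := by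
    ext ⟨j, k⟩
    simp only [Set.mem_ofPred_eq, Finset.coe_biUnion, Set.mem_iUnion, Finset.coe_image,
      Set.mem_image, Finset.mem_coe, Finset.mem_filter, Finset.mem_univ, true_and, Prod.mk.injEq,
      Prod.exists, hA]
    constructor
    · rintro ⟨h1, h2⟩
      refine ⟨j, _, h1, k, ⟨fun i => rfl, ?_⟩, rfl, rfl⟩
      have := cellOffset_le fun i => cell (k i)
      omega
    · rintro ⟨_, p, h1, _, ⟨h2, h3⟩, rfl, rfl⟩
      have := cellOffset_le p
      rw [show (fun i => cell _) = p from funext h2]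
      exact ⟨h1, by omega⟩
  rw [hset, Set.ncard_coe_finset, Finset.card_biUnion]
  · refine ⟨Finset.finite_toSet _, ?_⟩
    rw [Finset.sum_filter, Fintype.sum_prod_type]
    refine Finset.sum_congr rfl fun j _ => Finset.sum_congr rfl fun p _ => ?_
    rw [Finset.card_image_of_injective _ (Prod.mk_right_injective j), hc]
  · rintro ⟨j, p⟩ _ ⟨j', p'⟩ _ hne
    rw [Function.onFun, Finset.disjoint_left]
    rintro _ hx hx'
    obtain ⟨k, hk, rfl⟩ := Finset.mem_image.1 hx
    obtain ⟨k', hk', h⟩ := Finset.mem_image.1 hx'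
    obtain ⟨rfl, rfl⟩ := Prod.mk.inj h
    exact hne (by rw [← funext ((hA p _).1 hk).1, ← funext ((hA p' _).1 hk').1])

theorem sum_pi_fin_succ {α : Type*} [Fintype α] {n : ℕ} (g : (Fin (n + 1) → α) → ℕ) :
    ∑ p, g p = ∑ a, ∑ p : Fin n → α, g (Matrix.vecCons a p) := by
  rw [← (Fin.consEquiv fun _ => α).sum_comp, Fintype.sum_prod_type]
  rfl

theorem sum_pi_fin_four {α : Type*} [Fintype α] (g : (Fin 4 → α) → ℕ) :
    ∑ p, g p = ∑ a, ∑ b, ∑ c, ∑ d, g ![a, b, c, d] := by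
  simp only [sum_pi_fin_succ, Fintype.sum_unique]
  simp only [Matrix.empty_eq]

/-- The fifth difference of a polynomial of degree at most 4 vanishes; the terms are distributed
over both sides to avoid subtraction in `ℕ`. -/
theorem choose_fifth_difference (n : ℕ) {m : ℕ} (hm : m ≤ 4) :
    (n + 5).choose m + 10 * (n + 3).choose m + 5 * (n + 1).choose m =
      5 * (n + 4).choose m + 10 * (n + 2).choose m + n.choose m := by
  interval_cases m <;> simp [Nat.choose_succ_succ] <;> ring

/-- The number of terms of order at most `s + 4` whose classes satisfy `C`. -/
def cellCount (C : Fin 12 → (Fin 4 → Fin 4) → Bool) (s : ℕ) : ℕ :=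
  ∑ j, ∑ a, ∑ b, ∑ c, ∑ d, if C j ![a, b, c, d] then
    (s + (4 - cellOffset ![a, b, c, d])).choose (cellDim ![a, b, c, d]) else 0

theorem cellDim_le {n : ℕ} (p : Fin n → Fin 4) : cellDim p ≤ n := by
  refine (Finset.sum_le_sum (g := fun _ => 1) fun i _ => ?_).trans (by simp)
  split_ifs <;> simp

theorem cellCount_fifth_difference (C : Fin 12 → (Fin 4 → Fin 4) → Bool) (s : ℕ) :
    cellCount C (s + 5) + 10 * cellCount C (s + 3) + 5 * cellCount C (s + 1) =
      5 * cellCount C (s + 4) + 10 * cellCount C (s + 2) + cellCount C s := by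
  simp only [cellCount, Finset.mul_sum, ← Finset.sum_add_distrib]
  refine Finset.sum_congr rfl fun j _ => Finset.sum_congr rfl fun a _ =>
    Finset.sum_congr rfl fun b _ => Finset.sum_congr rfl fun c _ => Finset.sum_congr rfl fun d _ => ?_
  split_ifs
  · have := choose_fifth_difference (s + (4 - cellOffset ![a, b, c, d]))
      (cellDim_le ![a, b, c, d])
    simpa only [add_right_comm] using this
  · rfl

/-- Both sides obey the same recurrence of order five, so agreement at five arguments propagates.
The shift by 4 reflects that at most four exponents have offset 1: for `r = s + 4` the difference `r
- cellOffset p` is not truncated. -/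
theorem cellCount_eq_eval (C : Fin 12 → (Fin 4 → Fin 4) → Bool) (φ : Polynomial ℚ)
    (hφ : ∀ x : ℚ, φ.eval (x + 5) + 10 * φ.eval (x + 3) + 5 * φ.eval (x + 1) =
      5 * φ.eval (x + 4) + 10 * φ.eval (x + 2) + φ.eval x)
    (h : ∀ s < 5, (cellCount C s : ℚ) = φ.eval ((s : ℚ) + 4)) (s : ℕ) :
    (cellCount C s : ℚ) = φ.eval ((s : ℚ) + 4) := by
  induction s using Nat.strong_induction_on with
  | _ s ih =>
    by_cases hs : s < 5
    · exact h s hs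
    · obtain ⟨s, rfl⟩ := Nat.exists_eq_add_of_le' (not_lt.1 hs)
      have h0 := ih s (by omega)
      have h1 := ih (s + 1) (by omega)
      have h2 := ih (s + 2) (by omega)
      have h3 := ih (s + 3) (by omega)
      have h4 := ih (s + 4) (by omega)
      have hc : ((cellCount C (s + 5) + 10 * cellCount C (s + 3) + 5 * cellCount C (s + 1) : ℕ) : ℚ) =
          ((5 * cellCount C (s + 4) + 10 * cellCount C (s + 2) + cellCount C s : ℕ) : ℚ) := by
        rw [cellCount_fifth_difference]
      have hx := hφ (s + 4)
      push_cast at hc h1 h2 h3 h4 ⊢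
      rw [h0, h1, h2, h3, h4] at hc
      simp only [add_right_comm _ (4 : ℚ)] at hx
      linarith

/-- The set of terms whose classes satisfy `C`. -/
def cellSet (C : Fin 12 → (Fin 4 → Fin 4) → Bool) : Set (Fin 12 × (Fin 4 → ℤ)) :=
  {v | C v.1 fun i => cell (v.2 i)}

theorem ncard_cellSet (C : Fin 12 → (Fin 4 → Fin 4) → Bool) (φ : Polynomial ℚ)
    (hφ : ∀ x : ℚ, φ.eval (x + 5) + 10 * φ.eval (x + 3) + 5 * φ.eval (x + 1) =
      5 * φ.eval (x + 4) + 10 * φ.eval (x + 2) + φ.eval x)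
    (h : ∀ s < 5, (cellCount C s : ℚ) = φ.eval ((s : ℚ) + 4)) :
    ∀ᶠ r : ℕ in Filter.atTop, {v | v ∈ cellSet C ∧ ordInt v.2 ≤ r}.Finite ∧
      ({v | v ∈ cellSet C ∧ ordInt v.2 ≤ r}.ncard : ℚ) = φ.eval (r : ℚ) := by
  filter_upwards [Filter.eventually_ge_atTop 4] with r hr
  obtain ⟨s, rfl⟩ := Nat.exists_eq_add_of_le' hr
  refine ⟨(ncard_cells C _ hr).1, ?_⟩
  have h1 := cellCount_eq_eval C φ hφ h s
  push_cast
  rw [← h1, Nat.cast_inj]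
  refine (ncard_cells C _ hr).2.trans (Finset.sum_congr rfl fun j _ => ?_)
  rw [sum_pi_fin_four]
  refine Finset.sum_congr rfl fun a _ => Finset.sum_congr rfl fun b _ =>
    Finset.sum_congr rfl fun c _ => Finset.sum_congr rfl fun d _ => ?_
  rw [Nat.add_sub_assoc (cellOffset_le _)]

/-- Classes of the standard terms of the differential system. -/
def differentialStd (j : Fin 12) (p : Fin 4 → Fin 4) : Bool :=
  p 0 != 3 && (p 1 != 3) && (p 2 != 3) && (p 3 != 3) && (j < 6 || p 3 == 0) &&
    ((j != 8 && j != 11) || p 2 == 0)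

/-- Classes of the standard terms of the forward difference scheme. -/
def forwardStd (j : Fin 12) (p : Fin 4 → Fin 4) : Bool :=
  let n i := p i == 3
  let u i := p i == 1 || p i == 2
  if j = 0 ∨ j = 3 then !(n 0 && u 2 && n 3) && !(n 0 && u 1 && n 3)
  else if j = 1 ∨ j = 4 then !(n 1 && u 2 && n 3) && !(u 0 && n 3)
  else if j = 2 ∨ j = 5 then !(u 0 && n 3) && !(u 1 && n 3)
  else if j = 6 ∨ j = 9 then !u 3 && !(n 1 && n 2 && n 3) && !(u 0 && n 1 && n 2)
  else if j = 7 ∨ j = 10 then !u 3 && !(n 0 && n 2 && n 3) && !(u 1 && n 2)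
  else !u 3 && !u 2 && !(n 0 && n 1 && n 2) && !(n 0 && n 1 && n 3)

/-- Classes of the standard terms of the symmetric difference scheme. -/
def symmetricStd (j : Fin 12) (p : Fin 4 → Fin 4) : Bool :=
  (j < 6 || p 3 == 0 || p 3 == 1) && ((j != 8 && j != 11) || p 2 == 0 || p 2 == 1)

/-- These numbers, like those in the next two theorems, are the values of the asserted polynomial at
`r = 4, …, 8`. -/
theorem cellCount_differentialStd : ∀ s < 5,
    cellCount differentialStd s = [590, 1022, 1652, 2532, 3720].getD s 0 := by
  decide +kernel

theorem cellCount_forwardStd : ∀ s < 5,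
    cellCount forwardStd s = [2872, 5792, 10530, 17722, 28100].getD s 0 := by
  decide +kernel

theorem cellCount_symmetricStd : ∀ s < 5,
    cellCount symmetricStd s = [2902, 5862, 10662, 17942, 28438].getD s 0 := by
  decide +kernel

theorem ncard_differentialStd :
    ∀ᶠ r : ℕ in Filter.atTop, {v | v ∈ cellSet differentialStd ∧ ordInt v.2 ≤ r}.Finite ∧
      ({v | v ∈ cellSet differentialStd ∧ ordInt v.2 ≤ r}.ncard : ℚ) =
        differentialPoly.eval (r : ℚ) := by
  refine ncard_cellSet _ _ (fun x => ?_) fun s hs => ?_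
  · simp [differentialPoly]; ring
  · rw [cellCount_differentialStd s hs]
    interval_cases s <;> norm_num [differentialPoly]

theorem ncard_forwardStd :
    ∀ᶠ r : ℕ in Filter.atTop, {v | v ∈ cellSet forwardStd ∧ ordInt v.2 ≤ r}.Finite ∧
      ({v | v ∈ cellSet forwardStd ∧ ordInt v.2 ≤ r}.ncard : ℚ) = forwardPoly.eval (r : ℚ) := by
  refine ncard_cellSet _ _ (fun x => ?_) fun s hs => ?_
  · simp [forwardPoly]; ring
  · rw [cellCount_forwardStd s hs]
    interval_cases s <;> norm_num [forwardPoly]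

theorem ncard_symmetricStd :
    ∀ᶠ r : ℕ in Filter.atTop, {v | v ∈ cellSet symmetricStd ∧ ordInt v.2 ≤ r}.Finite ∧
      ({v | v ∈ cellSet symmetricStd ∧ ordInt v.2 ≤ r}.ncard : ℚ) =
        symmetricPoly.eval (r : ℚ) := by
  refine ncard_cellSet _ _ (fun x => ?_) fun s hs => ?_
  · simp [symmetricPoly]; ring
  · rw [cellCount_symmetricStd s hs]
    interval_cases s <;> norm_num [symmetricPoly]

/-! ### Finitely supported cycles on standard terms vanish. -/

section Propagation

variable {K : Type*} [Field K]

/-- The equation at `k₀` already links `k₀ - 1` to `k₀`, so the vanishing far out is carried back to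
`k₀ - 1`, one place below the range of the equations. The induction runs over the distance to `M +
1`. -/
theorem eq_zero_of_eventually_constant {g : ℤ → K} {M k₀ : ℤ} (hM : ∀ k, M < k → g k = 0)
    (h : ∀ k, k₀ ≤ k → g (k - 1) = g k) {k : ℤ} (hk : k₀ - 1 ≤ k) : g k = 0 := by
  obtain ⟨n, hn⟩ := Int.eq_ofNat_of_zero_le (a := max (M + 1) k - k) (by omega)
  induction n generalizing k with
  | zero => exact hM k (by omega)
  | succ n ih =>
    have h1 := h (k + 1) (by omega)
    rw [add_sub_cancel_right] at h1
    rw [h1]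
    by_cases hkM : M < k + 1
    · exact hM _ hkM
    · exact ih (by omega) (by omega)

theorem eq_zero_of_eventually_constant' {g : ℤ → K} {M k₀ : ℤ} (hM : ∀ k, k < -M → g k = 0)
    (h : ∀ k, k ≤ k₀ → g (k - 1) = g k) {k : ℤ} (hk : k ≤ k₀) : g k = 0 := by
  have := eq_zero_of_eventually_constant (g := fun k => g (-k)) (M := M) (k₀ := 1 - k₀) (k := -k)
    (fun l hl => hM _ (by omega))
    (fun l hl => by
      have := h (1 - l) (by omega)
      rw [show 1 - l - 1 = -l by ring] at this
      show g (-(l - 1)) = g (-l)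
      rw [this]
      congr 1
      ring) (by omega)
  simpa using this

/-- The equation at `k` links `k - 1` and `k + 1`. The omitted ones, at 0 and 1, are exactly those
that join a place `≤ 0` to a place `≥ 1`. From a place `≤ 0` one can therefore step down by two, and
from a place `≥ 1` step up by two, until the support is left. -/
theorem eq_zero_of_eventually_two_periodic {g : ℤ → K} {M : ℤ} (hM : ∀ k, M < k → g k = 0)
    (hM' : ∀ k, k < -M → g k = 0) (h : ∀ k, k ≠ 0 → k ≠ 1 → g (k - 1) = g (k + 1)) (k : ℤ) :
    g k = 0 := by
  have hs : (k ≤ 0 ∨ 1 ≤ k) := by omega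
  obtain ⟨n, hn⟩ := Int.eq_ofNat_of_zero_le (a := max (M + 1) |k| - |k|) (by omega)
  induction n using Nat.strong_induction_on generalizing k with
  | _ n ih =>
    by_cases hkM : M < |k|
    · rcases hs with hs | hs
      · exact hM' k (by rw [abs_of_nonpos hs] at hkM; omega)
      · exact hM k (by rw [abs_of_pos (by omega)] at hkM; omega)
    · rcases hs with hs | hs
      · have h1 := h (k - 1) (by omega) (by omega)
        rw [sub_add_cancel] at h1
        rw [← h1]
        rw [abs_of_nonpos hs] at *
        have h2 : |k - 1 - 1| = 2 - k := by rw [abs_of_nonpos (by omega)]; ring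
        by_cases hM2 : M < 2 - k
        · exact hM' _ (by omega)
        · exact ih (n - 2) (by omega) (k - 1 - 1) (Or.inl (by omega)) (by rw [h2]; omega)
      · have h1 := h (k + 1) (by omega) (by omega)
        rw [add_sub_cancel_right] at h1
        rw [h1]
        rw [abs_of_pos (show 0 < k by omega)] at *
        have h2 : |k + 1 + 1| = k + 2 := by rw [abs_of_nonneg (by omega)]; ring
        by_cases hM2 : M < k + 2
        · exact hM _ (by omega)
        · exact ih (n - 2) (by omega) (k + 1 + 1) (Or.inr (by omega)) (by rw [h2]; omega)

/-- The function vanishes outside the box of half-width `M`. -/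
def VanishesOutside (M : ℤ) (u : ℤ → ℤ → ℤ → ℤ → K) : Prop :=
  ∀ x y z t, (M < |x| ∨ M < |y| ∨ M < |z| ∨ M < |t|) → u x y z t = 0

/-- The equations `div e = 0` and `∂e/∂t + curl b = 0`, where the partial derivatives are replaced by
the operators `u ↦ A u(k - 1) + B u(k) + C u(k + 1)`. -/
structure IsCycle (A B C : ℤ) (e₁ e₂ e₃ b₁ b₂ b₃ : ℤ → ℤ → ℤ → ℤ → K) : Prop where
  div : ∀ x y z t,
    (A • e₁ (x - 1) y z t + B • e₁ x y z t + C • e₁ (x + 1) y z t) +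
    (A • e₂ x (y - 1) z t + B • e₂ x y z t + C • e₂ x (y + 1) z t) +
    (A • e₃ x y (z - 1) t + B • e₃ x y z t + C • e₃ x y (z + 1) t) = 0
  curl₁ : ∀ x y z t,
    (A • e₁ x y z (t - 1) + B • e₁ x y z t + C • e₁ x y z (t + 1)) +
    (A • b₃ x (y - 1) z t + B • b₃ x y z t + C • b₃ x (y + 1) z t) -
    (A • b₂ x y (z - 1) t + B • b₂ x y z t + C • b₂ x y (z + 1) t) = 0
  curl₂ : ∀ x y z t,
    (A • e₂ x y z (t - 1) + B • e₂ x y z t + C • e₂ x y z (t + 1)) +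
    (A • b₁ x y (z - 1) t + B • b₁ x y z t + C • b₁ x y (z + 1) t) -
    (A • b₃ (x - 1) y z t + B • b₃ x y z t + C • b₃ (x + 1) y z t) = 0
  curl₃ : ∀ x y z t,
    (A • e₃ x y z (t - 1) + B • e₃ x y z t + C • e₃ x y z (t + 1)) +
    (A • b₂ (x - 1) y z t + B • b₂ x y z t + C • b₂ (x + 1) y z t) -
    (A • b₁ x (y - 1) z t + B • b₁ x y z t + C • b₁ x (y + 1) z t) = 0

variable {e₁ e₂ e₃ b₁ b₂ b₃ : ℤ → ℤ → ℤ → ℤ → K} {M : ℤ}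

theorem VanishesOutside.x_lt {u : ℤ → ℤ → ℤ → ℤ → K} (h : VanishesOutside M u) (x y z t : ℤ)
    (hx : M < x ∨ x < -M) : u x y z t = 0 := h _ _ _ _ (Or.inl (lt_abs.2 (by omega)))

theorem VanishesOutside.y_lt {u : ℤ → ℤ → ℤ → ℤ → K} (h : VanishesOutside M u) (x y z t : ℤ)
    (hx : M < y ∨ y < -M) : u x y z t = 0 :=
  h _ _ _ _ (Or.inr (Or.inl (lt_abs.2 (by omega))))

theorem VanishesOutside.z_lt {u : ℤ → ℤ → ℤ → ℤ → K} (h : VanishesOutside M u) (x y z t : ℤ)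
    (hx : M < z ∨ z < -M) : u x y z t = 0 :=
  h _ _ _ _ (Or.inr (Or.inr (Or.inl (lt_abs.2 (by omega)))))

theorem VanishesOutside.t_lt {u : ℤ → ℤ → ℤ → ℤ → K} (h : VanishesOutside M u) (x y z t : ℤ)
    (hx : M < t ∨ t < -M) : u x y z t = 0 :=
  h _ _ _ _ (Or.inr (Or.inr (Or.inr (lt_abs.2 (by omega)))))

/-- Since b lives at `t = 0`, the evolution equations at time `t + 1` kill e at every `t ≥ 0`. What
remains is curl b = 0. As `b₃` lives at `z = 0`, this kills `b₁` and `b₂`, and then `b₃`. The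
divergence equation is not needed. -/
theorem IsCycle.eq_zero_differential (h : IsCycle 1 0 0 e₁ e₂ e₃ b₁ b₂ b₃)
    (he₁ : ∀ x y z t, t < 0 → e₁ x y z t = 0) (he₂ : ∀ x y z t, t < 0 → e₂ x y z t = 0)
    (he₃ : ∀ x y z t, t < 0 → e₃ x y z t = 0) (hb₁ : ∀ x y z t, t ≠ 0 ∨ z < 0 → b₁ x y z t = 0)
    (hb₂ : ∀ x y z t, t ≠ 0 ∨ z < 0 → b₂ x y z t = 0)
    (hb₃ : ∀ x y z t, t ≠ 0 ∨ z ≠ 0 → b₃ x y z t = 0) :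
    e₁ = 0 ∧ e₂ = 0 ∧ e₃ = 0 ∧ b₁ = 0 ∧ b₂ = 0 ∧ b₃ = 0 := by
  obtain ⟨-, h1, h2, h3⟩ := h
  simp only [one_smul, zero_smul, add_zero] at h1 h2 h3
  have E1 : ∀ x y z t, e₁ x y z t = 0 := fun x y z t => by
    by_cases ht : t < 0
    · exact he₁ _ _ _ _ ht
    · simpa [hb₂ x y (z - 1) (t + 1) (Or.inl (by omega)),
        hb₃ x (y - 1) z (t + 1) (Or.inl (by omega))] using h1 x y z (t + 1)
  have E2 : ∀ x y z t, e₂ x y z t = 0 := fun x y z t => by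
    by_cases ht : t < 0
    · exact he₂ _ _ _ _ ht
    · simpa [hb₁ x y (z - 1) (t + 1) (Or.inl (by omega)),
        hb₃ (x - 1) y z (t + 1) (Or.inl (by omega))] using h2 x y z (t + 1)
  have E3 : ∀ x y z t, e₃ x y z t = 0 := fun x y z t => by
    by_cases ht : t < 0
    · exact he₃ _ _ _ _ ht
    · simpa [hb₁ x (y - 1) z (t + 1) (Or.inl (by omega)),
        hb₂ (x - 1) y z (t + 1) (Or.inl (by omega))] using h3 x y z (t + 1)
  simp only [E1, E2, E3, zero_add] at h1 h2 h3
  have B2 : ∀ x y z t, b₂ x y z t = 0 := fun x y z t => by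
    by_cases hz : z < 0
    · exact hb₂ _ _ _ _ (Or.inr hz)
    · simpa [hb₃ x (y - 1) (z + 1) t (Or.inr (by omega))] using h1 x y (z + 1) t
  have B1 : ∀ x y z t, b₁ x y z t = 0 := fun x y z t => by
    by_cases hz : z < 0
    · exact hb₁ _ _ _ _ (Or.inr hz)
    · simpa [hb₃ (x - 1) y (z + 1) t (Or.inr (by omega))] using h2 x y (z + 1) t
  have B3 : ∀ x y z t, b₃ x y z t = 0 := fun x y z t => by
    simpa [B2] using h1 x (y + 1) z t
  refine ⟨?_, ?_, ?_, ?_, ?_, ?_⟩ <;> (funext x y z t; simp [*])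

/-- The elimination runs as in the differential case: e along t, then `b₁` and `b₂` along z, then
`b₃` along y. Now b may live at two times and `b₃` at two heights, 0 and 1; the equations at these
places are exactly the ones that the two-periodic argument can spare. -/
theorem IsCycle.eq_zero_symmetric (h : IsCycle 1 0 (-1) e₁ e₂ e₃ b₁ b₂ b₃)
    (hM : ∀ u ∈ [e₁, e₂, e₃, b₁, b₂, b₃], VanishesOutside M u)
    (hb₁ : ∀ x y z t, t ≠ 0 → t ≠ 1 → b₁ x y z t = 0)
    (hb₂ : ∀ x y z t, t ≠ 0 → t ≠ 1 → b₂ x y z t = 0)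
    (hb₃ : ∀ x y z t, t ≠ 0 → t ≠ 1 → b₃ x y z t = 0)
    (hb₃' : ∀ x y z t, z ≠ 0 → z ≠ 1 → b₃ x y z t = 0) :
    e₁ = 0 ∧ e₂ = 0 ∧ e₃ = 0 ∧ b₁ = 0 ∧ b₂ = 0 ∧ b₃ = 0 := by
  obtain ⟨-, h1, h2, h3⟩ := h
  simp only [one_smul, zero_smul, add_zero, neg_smul, ← sub_eq_add_neg] at h1 h2 h3
  simp only [List.forall_mem_cons, List.not_mem_nil, IsEmpty.forall_iff, implies_true,
    and_true] at hM
  obtain ⟨m1, m2, m3, n1, n2, n3⟩ := hM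
  have E1 : ∀ x y z t, e₁ x y z t = 0 := fun x y z t =>
    eq_zero_of_eventually_two_periodic (g := fun t => e₁ x y z t)
      (fun k hk => m1.t_lt _ _ _ _ (Or.inl hk)) (fun k hk => m1.t_lt _ _ _ _ (Or.inr hk))
      (fun k hk0 hk1 => by
        have := h1 x y z k
        simp only [hb₂ _ _ _ k hk0 hk1, hb₃ _ _ _ k hk0 hk1] at this
        linear_combination this) t
  have E2 : ∀ x y z t, e₂ x y z t = 0 := fun x y z t =>
    eq_zero_of_eventually_two_periodic (g := fun t => e₂ x y z t)
      (fun k hk => m2.t_lt _ _ _ _ (Or.inl hk)) (fun k hk => m2.t_lt _ _ _ _ (Or.inr hk))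
      (fun k hk0 hk1 => by
        have := h2 x y z k
        simp only [hb₁ _ _ _ k hk0 hk1, hb₃ _ _ _ k hk0 hk1] at this
        linear_combination this) t
  have E3 : ∀ x y z t, e₃ x y z t = 0 := fun x y z t =>
    eq_zero_of_eventually_two_periodic (g := fun t => e₃ x y z t)
      (fun k hk => m3.t_lt _ _ _ _ (Or.inl hk)) (fun k hk => m3.t_lt _ _ _ _ (Or.inr hk))
      (fun k hk0 hk1 => by
        have := h3 x y z k
        simp only [hb₁ _ _ _ k hk0 hk1, hb₂ _ _ _ k hk0 hk1] at this
        linear_combination this) t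
  simp only [E1, E2, E3, sub_self, zero_add] at h1 h2 h3
  have B2 : ∀ x y z t, b₂ x y z t = 0 := fun x y z t =>
    eq_zero_of_eventually_two_periodic (g := fun z => b₂ x y z t)
      (fun k hk => n2.z_lt _ _ _ _ (Or.inl hk)) (fun k hk => n2.z_lt _ _ _ _ (Or.inr hk))
      (fun k hk0 hk1 => by
        have := h1 x y k t
        simp only [hb₃' _ _ k _ hk0 hk1] at this
        linear_combination -this) z
  have B1 : ∀ x y z t, b₁ x y z t = 0 := fun x y z t =>
    eq_zero_of_eventually_two_periodic (g := fun z => b₁ x y z t)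
      (fun k hk => n1.z_lt _ _ _ _ (Or.inl hk)) (fun k hk => n1.z_lt _ _ _ _ (Or.inr hk))
      (fun k hk0 hk1 => by
        have := h2 x y k t
        simp only [hb₃' _ _ k _ hk0 hk1] at this
        linear_combination this) z
  have B3 : ∀ x y z t, b₃ x y z t = 0 := fun x y z t =>
    eq_zero_of_eventually_two_periodic (g := fun y => b₃ x y z t)
      (fun k hk => n3.y_lt _ _ _ _ (Or.inl hk)) (fun k hk => n3.y_lt _ _ _ _ (Or.inr hk))
      (fun k hk0 hk1 => by
        have := h1 x k z t
        simp only [B2] at this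
        linear_combination this) y
  refine ⟨?_, ?_, ?_, ?_, ?_, ?_⟩ <;> (funext x y z t; simp [*])

/-- The six support conditions exclude the regions of terms divisible by leading terms of the
explicit basis. At negative times b is no longer excluded outright, so the evolution equations alone
do not suffice: the divergence and the curl are used in turn to push e and b into negative octants.
Each step uses an equation where only one field survives, which is then constant along an axis. The
equation at place 1 links places 0 and 1, so vanishing is gained from 0 on. -/
theorem IsCycle.eq_zero_forward (h : IsCycle 1 (-1) 0 e₁ e₂ e₃ b₁ b₂ b₃)
    (hM : ∀ u ∈ [e₁, e₂, e₃, b₁, b₂, b₃], VanishesOutside M u)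
    (s1 : ∀ x y z t, ¬(¬(x < 0 ∧ 0 < z ∧ t < 0) ∧ ¬(x < 0 ∧ 0 < y ∧ t < 0)) → e₁ x y z t = 0)
    (s2 : ∀ x y z t, ¬(¬(y < 0 ∧ 0 < z ∧ t < 0) ∧ ¬(0 < x ∧ t < 0)) → e₂ x y z t = 0)
    (s3 : ∀ x y z t, ¬(¬(0 < x ∧ t < 0) ∧ ¬(0 < y ∧ t < 0)) → e₃ x y z t = 0)
    (r1 : ∀ x y z t, ¬(t ≤ 0 ∧ ¬(y < 0 ∧ z < 0 ∧ t < 0) ∧ ¬(0 < x ∧ y < 0 ∧ z < 0)) →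
      b₁ x y z t = 0)
    (r2 : ∀ x y z t, ¬(t ≤ 0 ∧ ¬(x < 0 ∧ z < 0 ∧ t < 0) ∧ ¬(0 < y ∧ z < 0)) → b₂ x y z t = 0)
    (r3 : ∀ x y z t, ¬(t ≤ 0 ∧ z ≤ 0 ∧ ¬(x < 0 ∧ y < 0 ∧ z < 0) ∧ ¬(x < 0 ∧ y < 0 ∧ t < 0)) →
      b₃ x y z t = 0) :
    e₁ = 0 ∧ e₂ = 0 ∧ e₃ = 0 ∧ b₁ = 0 ∧ b₂ = 0 ∧ b₃ = 0 := by
  obtain ⟨h0, h1, h2, h3⟩ := h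
  simp only [one_smul, zero_smul, add_zero, neg_smul, ← sub_eq_add_neg] at h0 h1 h2 h3
  simp only [List.forall_mem_cons, List.not_mem_nil, IsEmpty.forall_iff, implies_true,
    and_true] at hM
  obtain ⟨m1, m2, m3, n1, n2, n3⟩ := hM
  -- the components of `e` vanish for nonnegative times
  have P1 : ∀ x y z t, 0 ≤ t → e₁ x y z t = 0 := fun x y z t ht =>
    eq_zero_of_eventually_constant (g := fun t => e₁ x y z t) (k₀ := 1)
      (fun k hk => m1.t_lt _ _ _ _ (Or.inl hk)) (fun k hk => by
        have := h1 x y z k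
        simp (disch := omega) only [r2, r3] at this
        linear_combination this) (by omega)
  have P2 : ∀ x y z t, 0 ≤ t → e₂ x y z t = 0 := fun x y z t ht =>
    eq_zero_of_eventually_constant (g := fun t => e₂ x y z t) (k₀ := 1)
      (fun k hk => m2.t_lt _ _ _ _ (Or.inl hk)) (fun k hk => by
        have := h2 x y z k
        simp (disch := omega) only [r1, r3] at this
        linear_combination this) (by omega)
  have P3 : ∀ x y z t, 0 ≤ t → e₃ x y z t = 0 := fun x y z t ht =>
    eq_zero_of_eventually_constant (g := fun t => e₃ x y z t) (k₀ := 1)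
      (fun k hk => m3.t_lt _ _ _ _ (Or.inl hk)) (fun k hk => by
        have := h3 x y z k
        simp (disch := omega) only [r1, r2] at this
        linear_combination this) (by omega)
  -- the divergence confines `e` to the negative octant
  have Q1 : ∀ x y z t, 0 ≤ x → e₁ x y z t = 0 := fun x y z t hx => by
    by_cases ht : 0 ≤ t
    · exact P1 _ _ _ _ ht
    refine eq_zero_of_eventually_constant (g := fun x => e₁ x y z t) (k₀ := 1)
      (fun k hk => m1.x_lt _ _ _ _ (Or.inl hk)) (fun k hk => ?_) (by omega)
    have := h0 k y z t
    simp (disch := omega) only [s2, s3] at this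
    linear_combination this
  have Q1' : ∀ x y z t, 0 < y ∨ 0 < z → e₁ x y z t = 0 := fun x y z t hx => by
    by_cases h : 0 ≤ t ∨ 0 ≤ x
    · exact h.elim (P1 _ _ _ _) (Q1 _ _ _ _)
    · exact s1 _ _ _ _ (by omega)
  have Q2 : ∀ x y z t, 0 ≤ y → e₂ x y z t = 0 := fun x y z t hx => by
    by_cases ht : 0 ≤ t
    · exact P2 _ _ _ _ ht
    refine eq_zero_of_eventually_constant (g := fun y => e₂ x y z t) (k₀ := 1)
      (fun k hk => m2.y_lt _ _ _ _ (Or.inl hk)) (fun k hk => ?_) (by omega)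
    have := h0 x k z t
    simp (disch := omega) only [Q1', s3] at this
    linear_combination this
  have Q2' : ∀ x y z t, 0 < x ∨ 0 < z → e₂ x y z t = 0 := fun x y z t hx => by
    by_cases h : 0 ≤ t ∨ 0 ≤ y
    · exact h.elim (P2 _ _ _ _) (Q2 _ _ _ _)
    · exact s2 _ _ _ _ (by omega)
  have Q3 : ∀ x y z t, 0 ≤ z → e₃ x y z t = 0 := fun x y z t hx => by
    by_cases ht : 0 ≤ t
    · exact P3 _ _ _ _ ht
    refine eq_zero_of_eventually_constant (g := fun z => e₃ x y z t) (k₀ := 1)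
      (fun k hk => m3.z_lt _ _ _ _ (Or.inl hk)) (fun k hk => ?_) (by omega)
    have := h0 x y k t
    simp (disch := omega) only [Q1', Q2'] at this
    linear_combination this
  have Q3' : ∀ x y z t, 0 < x ∨ 0 < y → e₃ x y z t = 0 := fun x y z t hx => by
    by_cases h : 0 ≤ t
    · exact P3 _ _ _ _ h
    · exact s3 _ _ _ _ (by omega)
  -- then `b` is confined to the negative octant
  have R2 : ∀ x y z t, 0 ≤ z → b₂ x y z t = 0 := fun x y z t hz =>
    eq_zero_of_eventually_constant (g := fun z => b₂ x y z t) (k₀ := 1)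
      (fun k hk => n2.z_lt _ _ _ _ (Or.inl hk)) (fun k hk => by
        have := h1 x y k t
        simp (disch := omega) only [Q1', r3] at this
        linear_combination -this) (by omega)
  have R1 : ∀ x y z t, 0 ≤ z → b₁ x y z t = 0 := fun x y z t hz =>
    eq_zero_of_eventually_constant (g := fun z => b₁ x y z t) (k₀ := 1)
      (fun k hk => n1.z_lt _ _ _ _ (Or.inl hk)) (fun k hk => by
        have := h2 x y k t
        simp (disch := omega) only [Q2', r3] at this
        linear_combination this) (by omega)
  have R2' : ∀ x y z t, 0 < y → b₂ x y z t = 0 := fun x y z t hy => by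
    by_cases hz : 0 ≤ z
    · exact R2 _ _ _ _ hz
    · exact r2 _ _ _ _ (by omega)
  have T3 : ∀ x y z t, 0 ≤ y → b₃ x y z t = 0 := fun x y z t hz =>
    eq_zero_of_eventually_constant (g := fun y => b₃ x y z t) (k₀ := 1)
      (fun k hk => n3.y_lt _ _ _ _ (Or.inl hk)) (fun k hk => by
        have := h1 x k z t
        simp (disch := omega) only [Q1', R2'] at this
        linear_combination this) (by omega)
  have T1 : ∀ x y z t, 0 ≤ y → b₁ x y z t = 0 := fun x y z t hz =>
    eq_zero_of_eventually_constant (g := fun y => b₁ x y z t) (k₀ := 1)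
      (fun k hk => n1.y_lt _ _ _ _ (Or.inl hk)) (fun k hk => by
        have := h3 x k z t
        simp (disch := omega) only [Q3', R2'] at this
        linear_combination -this) (by omega)
  have T1' : ∀ x y z t, 0 < x ∨ t ≠ 0 → b₁ x y z t = 0 := fun x y z t hx => by
    by_cases h : 0 ≤ z ∨ 0 ≤ y
    · exact h.elim (R1 _ _ _ _) (T1 _ _ _ _)
    · exact r1 _ _ _ _ (by omega)
  have U3 : ∀ x y z t, 0 ≤ x → b₃ x y z t = 0 := fun x y z t hz =>
    eq_zero_of_eventually_constant (g := fun x => b₃ x y z t) (k₀ := 1)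
      (fun k hk => n3.x_lt _ _ _ _ (Or.inl hk)) (fun k hk => by
        have := h2 k y z t
        simp (disch := omega) only [Q2', T1'] at this
        linear_combination -this) (by omega)
  have U2 : ∀ x y z t, 0 ≤ x → b₂ x y z t = 0 := fun x y z t hz =>
    eq_zero_of_eventually_constant (g := fun x => b₂ x y z t) (k₀ := 1)
      (fun k hk => n2.x_lt _ _ _ _ (Or.inl hk)) (fun k hk => by
        have := h3 k y z t
        simp (disch := omega) only [Q3', T1'] at this
        linear_combination this) (by omega)
  have U2' : ∀ x y z t, t ≠ 0 → b₂ x y z t = 0 := fun x y z t hx => by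
    by_cases h : 0 ≤ z ∨ 0 ≤ x
    · exact h.elim (R2 _ _ _ _) (U2 _ _ _ _)
    · exact r2 _ _ _ _ (by omega)
  have U3' : ∀ x y z t, t ≠ 0 ∨ z ≠ 0 → b₃ x y z t = 0 := fun x y z t hx => by
    by_cases h : 0 ≤ y ∨ 0 ≤ x
    · exact h.elim (T3 _ _ _ _) (U3 _ _ _ _)
    · exact r3 _ _ _ _ (by omega)
  -- hence `e` is constant in time
  have E1 : ∀ x y z t, e₁ x y z t = 0 := fun x y z t => by
    by_cases ht : 0 ≤ t
    · exact P1 _ _ _ _ ht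
    refine eq_zero_of_eventually_constant' (g := fun t => e₁ x y z t) (k₀ := -1)
      (fun k hk => m1.t_lt _ _ _ _ (Or.inr hk)) (fun k hk => ?_) (by omega)
    have := h1 x y z k
    simp (disch := omega) only [U2', U3'] at this
    linear_combination this
  have E2 : ∀ x y z t, e₂ x y z t = 0 := fun x y z t => by
    by_cases ht : 0 ≤ t
    · exact P2 _ _ _ _ ht
    refine eq_zero_of_eventually_constant' (g := fun t => e₂ x y z t) (k₀ := -1)
      (fun k hk => m2.t_lt _ _ _ _ (Or.inr hk)) (fun k hk => ?_) (by omega)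
    have := h2 x y z k
    simp (disch := omega) only [T1', U3'] at this
    linear_combination this
  have E3 : ∀ x y z t, e₃ x y z t = 0 := fun x y z t => by
    by_cases ht : 0 ≤ t
    · exact P3 _ _ _ _ ht
    refine eq_zero_of_eventually_constant' (g := fun t => e₃ x y z t) (k₀ := -1)
      (fun k hk => m3.t_lt _ _ _ _ (Or.inr hk)) (fun k hk => ?_) (by omega)
    have := h3 x y z k
    simp (disch := omega) only [U2', T1'] at this
    linear_combination this
  -- Now b is curl-free, as in the differential case. Since `b₃` survives only at `t = 0`, `z = 0`,
  -- the components `b₁` and `b₂` are constant in z below 0.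
  simp only [E1, E2, sub_self, zero_add] at h1 h2
  have B2 : ∀ x y z t, b₂ x y z t = 0 := fun x y z t => by
    by_cases hz : 0 ≤ z
    · exact R2 _ _ _ _ hz
    refine eq_zero_of_eventually_constant' (g := fun z => b₂ x y z t) (k₀ := -1)
      (fun k hk => n2.z_lt _ _ _ _ (Or.inr hk)) (fun k hk => ?_) (by omega)
    have := h1 x y k t
    simp (disch := omega) only [U3'] at this
    linear_combination -this
  have B1 : ∀ x y z t, b₁ x y z t = 0 := fun x y z t => by
    by_cases hz : 0 ≤ z
    · exact R1 _ _ _ _ hz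
    refine eq_zero_of_eventually_constant' (g := fun z => b₁ x y z t) (k₀ := -1)
      (fun k hk => n1.z_lt _ _ _ _ (Or.inr hk)) (fun k hk => ?_) (by omega)
    have := h2 x y k t
    simp (disch := omega) only [U3'] at this
    linear_combination this
  have B3 : ∀ x y z t, b₃ x y z t = 0 := fun x y z t => by
    by_cases hy : 0 ≤ y
    · exact T3 _ _ _ _ hy
    refine eq_zero_of_eventually_constant' (g := fun y => b₃ x y z t) (k₀ := -1)
      (fun k hk => n3.y_lt _ _ _ _ (Or.inr hk)) (fun k hk => ?_) (by omega)
    have := h1 x k z t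
    simp only [B2] at this
    linear_combination this
  refine ⟨?_, ?_, ?_, ?_, ?_, ?_⟩ <;> (funext x y z t; simp [*])

end Propagation

/-! ### The submodule of cycles and the Maxwell generators. -/

section Cycles

variable {K : Type*} [Field K] {A B C : ℤ}

theorem IsCycle.add {e₁ e₂ e₃ b₁ b₂ b₃ e₁' e₂' e₃' b₁' b₂' b₃' : ℤ → ℤ → ℤ → ℤ → K}
    (h : IsCycle A B C e₁ e₂ e₃ b₁ b₂ b₃) (h' : IsCycle A B C e₁' e₂' e₃' b₁' b₂' b₃') :
    IsCycle A B C (e₁ + e₁') (e₂ + e₂') (e₃ + e₃') (b₁ + b₁') (b₂ + b₂') (b₃ + b₃') where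
  div x y z t := by
    have h1 := h.div x y z t
    have h2 := h'.div x y z t
    simp only [Pi.add_apply, zsmul_eq_mul] at *
    linear_combination h1 + h2
  curl₁ x y z t := by
    have h1 := h.curl₁ x y z t
    have h2 := h'.curl₁ x y z t
    simp only [Pi.add_apply, zsmul_eq_mul] at *
    linear_combination h1 + h2
  curl₂ x y z t := by
    have h1 := h.curl₂ x y z t
    have h2 := h'.curl₂ x y z t
    simp only [Pi.add_apply, zsmul_eq_mul] at *
    linear_combination h1 + h2
  curl₃ x y z t := by
    have h1 := h.curl₃ x y z t
    have h2 := h'.curl₃ x y z t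
    simp only [Pi.add_apply, zsmul_eq_mul] at *
    linear_combination h1 + h2

/-- Integer coefficients let any additive `φ` pass through the equations, a derivation of the field
as well as an automorphism or a scalar multiplication. -/
theorem IsCycle.map {e₁ e₂ e₃ b₁ b₂ b₃ : ℤ → ℤ → ℤ → ℤ → K} (h : IsCycle A B C e₁ e₂ e₃ b₁ b₂ b₃)
    (φ : K →+ K) (a b c d : ℤ) :
    IsCycle A B C (fun x y z t => φ (e₁ (x - a) (y - b) (z - c) (t - d)))
      (fun x y z t => φ (e₂ (x - a) (y - b) (z - c) (t - d)))
      (fun x y z t => φ (e₃ (x - a) (y - b) (z - c) (t - d)))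
      (fun x y z t => φ (b₁ (x - a) (y - b) (z - c) (t - d)))
      (fun x y z t => φ (b₂ (x - a) (y - b) (z - c) (t - d)))
      (fun x y z t => φ (b₃ (x - a) (y - b) (z - c) (t - d))) := by
  have E : ∀ x a : ℤ, x - 1 - a = x - a - 1 := fun x a => by ring
  have E' : ∀ x a : ℤ, x + 1 - a = x - a + 1 := fun x a => by ring
  constructor <;> intro x y z t <;> simp only [E, E', ← map_zsmul, ← map_add, ← map_sub]
  · rw [h.div, map_zero]
  · rw [h.curl₁, map_zero]
  · rw [h.curl₂, map_zero]
  · rw [h.curl₃, map_zero]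

/-- The `j`-th component as a function of four integers. -/
def comp (f : FreeMod K 12 (Fin 4 → ℤ)) (j : Fin 12) (x y z t : ℤ) : K := f (j, ![x, y, z, t])

theorem IsCycle.zero : IsCycle A B C (0 : ℤ → ℤ → ℤ → ℤ → K) 0 0 0 0 0 := by
  constructor <;> simp

/-- The elements all of whose two blocks are cycles. -/
def cycles (K : Type*) [Field K] (A B C : ℤ) : Submodule K (FreeMod K 12 (Fin 4 → ℤ)) where
  carrier := {f | IsCycle A B C (comp f 0) (comp f 1) (comp f 2) (comp f 9) (comp f 10) (comp f 11) ∧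
    IsCycle A B C (comp f 3) (comp f 4) (comp f 5) (-comp f 6) (-comp f 7) (-comp f 8)}
  add_mem' {f g} hf hg := ⟨hf.1.add hg.1, by
    have := hf.2.add hg.2
    simp only [← neg_add] at this
    exact this⟩
  zero_mem' := ⟨IsCycle.zero, by
    have : IsCycle A B C (0 : ℤ → ℤ → ℤ → ℤ → K) 0 0 (-0) (-0) (-0) := by
      rw [neg_zero]; exact IsCycle.zero
    exact this⟩
  smul_mem' a f hf := by
    have h1 := hf.1.map (AddMonoidHom.mulLeft a) 0 0 0 0
    have h2 := hf.2.map (AddMonoidHom.mulLeft a) 0 0 0 0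
    simp only [sub_zero, Pi.neg_apply, map_neg] at h1 h2
    exact ⟨h1, h2⟩

theorem semiShift_apply {K T : Type*} [Field K] {q : ℕ} [AddCommGroup T] (φ : K →+ K) (s : T)
    (f : FreeMod K q T) (j : Fin q) (t : T) : semiShift φ s f (j, t) = φ (f (j, t - s)) := by
  induction f using Finsupp.induction_linear with
  | zero => simp
  | add x y hx hy => rw [map_add, Finsupp.add_apply, Finsupp.add_apply, map_add, hx, hy]
  | single v a =>
    obtain ⟨j', t'⟩ := v
    classical
    rw [semiShift_single, Finsupp.single_apply, Finsupp.single_apply]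
    have : (j', s + t') = (j, t) ↔ (j', t') = (j, t - s) := by
      simp [Prod.ext_iff, eq_sub_iff_add_eq, add_comm]
    simp only [this]
    split_ifs <;> simp

theorem semiShift_mem_cycles (φ : K →+ K) (s : Fin 4 → ℤ) {f : FreeMod K 12 (Fin 4 → ℤ)}
    (hf : f ∈ cycles K A B C) : semiShift φ s f ∈ cycles K A B C := by
  have key : ∀ j, comp (semiShift φ s f) j =
      fun x y z t => φ (comp f j (x - s 0) (y - s 1) (z - s 2) (t - s 3)) := by
    intro j
    funext x y z t
    rw [comp, semiShift_apply, comp]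
    congr 3
    funext i
    fin_cases i <;> rfl
  have h1 := hf.1.map φ (s 0) (s 1) (s 2) (s 3)
  have h2 := hf.2.map φ (s 0) (s 1) (s 2) (s 3)
  simp only [Pi.neg_apply, map_neg, ← key] at h1 h2
  refine ⟨h1, ?_⟩
  have hneg : ∀ j, (-comp (semiShift φ s f) j) =
      fun x y z t => -φ (comp f j (x - s 0) (y - s 1) (z - s 2) (t - s 3)) := fun j => by
    rw [key]; rfl
  rw [hneg, hneg, hneg]
  exact h2

/-- The indicator of the origin. -/
def delta (K : Type*) [Field K] (x y z t : ℤ) : K := if x = 0 ∧ y = 0 ∧ z = 0 ∧ t = 0 then 1 else 0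

theorem comp_single (j j' : Fin 12) (s : Fin 4 → ℤ) (x y z t : ℤ) :
    comp (Finsupp.single (j, s) (1 : K)) j' x y z t =
      if j = j' then delta K (x - s 0) (y - s 1) (z - s 2) (t - s 3) else 0 := by
  classical
  rw [comp, Finsupp.single_apply, delta]
  simp only [Prod.mk.injEq, sub_eq_zero]
  have : s = ![x, y, z, t] ↔ (x = s 0 ∧ y = s 1 ∧ z = s 2 ∧ t = s 3) := by
    constructor
    · rintro rfl; simp
    · rintro ⟨rfl, rfl, rfl, rfl⟩; funext i; fin_cases i <;> rfl
  simp only [this, ite_and]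

theorem mem_cycles_iff {f : FreeMod K 12 (Fin 4 → ℤ)} : f ∈ cycles K A B C ↔
    IsCycle A B C (comp f 0) (comp f 1) (comp f 2) (comp f 9) (comp f 10) (comp f 11) ∧
    IsCycle A B C (comp f 3) (comp f 4) (comp f 5) (-comp f 6) (-comp f 7) (-comp f 8) := Iff.rfl

-- These are the lattice forms of div curl = 0, curl grad = 0 and of the commutation of time and
-- space differences, verified on sums of translates of the indicator of the origin. The sign in the
-- equations for H and D is the reason for the minus signs in the second block of `cycles`.
set_option maxHeartbeats 4000000 in
theorem maxwell_subset_cycles {D : Fin 4 → AddMonoid.End (FreeMod K 12 (Fin 4 → ℤ))}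
    (hD : ∀ i j, D i (gen K _ j) = A • Finsupp.single (j, Pi.single i 1) 1 +
      B • Finsupp.single (j, 0) 1 + C • Finsupp.single (j, Pi.single i (-1)) 1) :
    maxwell D (gen K (Fin 4 → ℤ)) ⊆ cycles K A B C := by
  have ha : ∀ f g : FreeMod K 12 (Fin 4 → ℤ), ∀ j, comp (f + g) j = comp f j + comp g j :=
    fun _ _ _ => rfl
  have hs : ∀ f g : FreeMod K 12 (Fin 4 → ℤ), ∀ j, comp (f - g) j = comp f j - comp g j :=
    fun f g j => by funext x y z t; simp [comp]
  have hz : ∀ (n : ℤ) (f : FreeMod K 12 (Fin 4 → ℤ)), ∀ j x y z t, comp (n • f) j x y z t =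
      n * comp f j x y z t := fun n f _ _ _ _ _ => by simp [comp]
  have h0 : ∀ j j' x y z t, comp (D 0 (gen K _ j)) j' x y z t = if j = j' then
      A * delta K (x - 1) y z t + B * delta K x y z t + C * delta K (x + 1) y z t else 0 := by
    intro j j' x y z t
    simp only [hD, ha, Pi.add_apply, hz, comp_single]
    split_ifs <;> simp
  have h1 : ∀ j j' x y z t, comp (D 1 (gen K _ j)) j' x y z t = if j = j' then
      A * delta K x (y - 1) z t + B * delta K x y z t + C * delta K x (y + 1) z t else 0 := by
    intro j j' x y z t
    simp only [hD, ha, Pi.add_apply, hz, comp_single]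
    split_ifs <;> simp
  have h2 : ∀ j j' x y z t, comp (D 2 (gen K _ j)) j' x y z t = if j = j' then
      A * delta K x y (z - 1) t + B * delta K x y z t + C * delta K x y (z + 1) t else 0 := by
    intro j j' x y z t
    simp only [hD, ha, Pi.add_apply, hz, comp_single]
    split_ifs <;> simp
  have h3 : ∀ j j' x y z t, comp (D 3 (gen K _ j)) j' x y z t = if j = j' then
      A * delta K x y z (t - 1) + B * delta K x y z t + C * delta K x y z (t + 1) else 0 := by
    intro j j' x y z t
    simp only [hD, ha, Pi.add_apply, hz, comp_single]
    split_ifs <;> simp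
  refine forall_mem_maxwell.2 ⟨?_, ?_, ?_, ?_, ?_, ?_, ?_, ?_⟩ <;>
  refine mem_cycles_iff.2 ⟨⟨?_, ?_, ?_, ?_⟩, ⟨?_, ?_, ?_, ?_⟩⟩ <;> intro x y z t <;>
  simp only [ha, hs, Pi.add_apply, Pi.sub_apply, Pi.neg_apply, h0, h1, h2, h3, zsmul_eq_mul,
    Fin.reduceEq, if_true, if_false] <;> ring

theorem exists_vanishesOutside (f : FreeMod K 12 (Fin 4 → ℤ)) :
    ∃ M, ∀ j, VanishesOutside M (comp f j) := by
  obtain ⟨M, hM⟩ := (f.support.image fun v => ∑ i, |v.2 i|).exists_le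
  refine ⟨M, fun j x y z t h => ?_⟩
  by_contra hne
  have hsum := hM _ (Finset.mem_image_of_mem _ (Finsupp.mem_support_iff.2 hne))
  simp only [Fin.sum_univ_four] at hsum
  change |x| + |y| + |z| + |t| ≤ M at hsum
  have := abs_nonneg x
  have := abs_nonneg y
  have := abs_nonneg z
  have := abs_nonneg t
  omega

theorem VanishesOutside.neg {M : ℤ} {u : ℤ → ℤ → ℤ → ℤ → K} (h : VanishesOutside M u) :
    VanishesOutside M (-u) := fun x y z t hx => by
  rw [Pi.neg_apply, Pi.neg_apply, Pi.neg_apply, Pi.neg_apply, h x y z t hx, neg_zero]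

theorem eq_zero_of_comp {f : FreeMod K 12 (Fin 4 → ℤ)} (h : ∀ j, comp f j = 0) : f = 0 := by
  ext ⟨j, v⟩
  have h1 := congrFun (congrFun (congrFun (congrFun (h j) (v 0)) (v 1)) (v 2)) (v 3)
  have h2 : ![v 0, v 1, v 2, v 3] = v := by funext i; fin_cases i <;> rfl
  rwa [comp, h2] at h1

theorem comp_eq_zero {S : Fin 12 → (Fin 4 → Fin 4) → Bool} {f : FreeMod K 12 (Fin 4 → ℤ)}
    (hf : ∀ v, f v ≠ 0 → v ∈ cellSet S) (j : Fin 12) (x y z t : ℤ)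
    (h : S j ![cell x, cell y, cell z, cell t] = false) : comp f j x y z t = 0 := by
  by_contra hne
  have h1 : S j (fun i => cell ((![x, y, z, t] : Fin 4 → ℤ) i)) = true := hf _ hne
  have h2 : (fun i => cell ((![x, y, z, t] : Fin 4 → ℤ) i)) =
      ![cell x, cell y, cell z, cell t] := by
    funext i; fin_cases i <;> rfl
  rw [h2, h] at h1
  exact absurd h1 (by simp)

theorem eq_zero_of_blocks {f : FreeMod K 12 (Fin 4 → ℤ)}
    (h : comp f 0 = 0 ∧ comp f 1 = 0 ∧ comp f 2 = 0 ∧ comp f 9 = 0 ∧ comp f 10 = 0 ∧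
      comp f 11 = 0)
    (h' : comp f 3 = 0 ∧ comp f 4 = 0 ∧ comp f 5 = 0 ∧ -comp f 6 = 0 ∧ -comp f 7 = 0 ∧
      -comp f 8 = 0) : f = 0 := by
  obtain ⟨h0, h1, h2, h9, h10, h11⟩ := h
  obtain ⟨h3, h4, h5, h6, h7, h8⟩ := h'
  rw [neg_eq_zero] at h6 h7 h8
  refine eq_zero_of_comp fun j => ?_
  fin_cases j <;> assumption

theorem cell_beq_zero (k : ℤ) : (cell k == 0) = decide (k = 0) := by
  rw [Bool.eq_iff_iff, beq_iff_eq, decide_eq_true_iff, cell_eq_zero]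

theorem cell_beq_one (k : ℤ) : (cell k == 1) = decide (k = 1) := by
  rw [Bool.eq_iff_iff, beq_iff_eq, decide_eq_true_iff, cell_eq_one]

theorem cell_beq_two (k : ℤ) : (cell k == 2) = decide (2 ≤ k) := by
  rw [Bool.eq_iff_iff, beq_iff_eq, decide_eq_true_iff, cell_eq_two]

theorem cell_beq_three (k : ℤ) : (cell k == 3) = decide (k < 0) := by
  rw [Bool.eq_iff_iff, beq_iff_eq, decide_eq_true_iff, cell_eq_three]

theorem eq_zero_differential {f : FreeMod K 12 (Fin 4 → ℤ)} (hc : f ∈ cycles K 1 0 0)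
    (hf : ∀ v, f v ≠ 0 → v ∈ cellSet differentialStd) : f = 0 := by
  refine eq_zero_of_blocks (hc.1.eq_zero_differential ?_ ?_ ?_ ?_ ?_ ?_)
    (hc.2.eq_zero_differential ?_ ?_ ?_ ?_ ?_ ?_) <;> intro x y z t h <;>
    try simp only [Pi.neg_apply, neg_eq_zero]
  all_goals
    refine comp_eq_zero hf _ x y z t ?_
    rw [← Bool.not_eq_true]
    simp [differentialStd, cell_beq_zero, cell_eq_three]
    try omega

theorem eq_zero_symmetric {f : FreeMod K 12 (Fin 4 → ℤ)} (hc : f ∈ cycles K 1 0 (-1))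
    (hf : ∀ v, f v ≠ 0 → v ∈ cellSet symmetricStd) : f = 0 := by
  obtain ⟨M, hM⟩ := exists_vanishesOutside f
  have hN := fun j => (hM j).neg
  refine eq_zero_of_blocks (hc.1.eq_zero_symmetric (M := M) (by simp [hM]) ?_ ?_ ?_ ?_)
    (hc.2.eq_zero_symmetric (M := M) (by simp [hM, hN]) ?_ ?_ ?_ ?_) <;> intro x y z t h h' <;>
    try simp only [Pi.neg_apply, neg_eq_zero]
  all_goals
    refine comp_eq_zero hf _ x y z t ?_
    rw [← Bool.not_eq_true]
    simp [symmetricStd, cell_beq_zero, cell_beq_one]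
    try omega

theorem eq_zero_forward {f : FreeMod K 12 (Fin 4 → ℤ)} (hc : f ∈ cycles K 1 (-1) 0)
    (hf : ∀ v, f v ≠ 0 → v ∈ cellSet forwardStd) : f = 0 := by
  obtain ⟨M, hM⟩ := exists_vanishesOutside f
  have hN := fun j => (hM j).neg
  refine eq_zero_of_blocks (hc.1.eq_zero_forward (M := M) (by simp [hM]) ?_ ?_ ?_ ?_ ?_ ?_)
    (hc.2.eq_zero_forward (M := M) (by simp [hM, hN]) ?_ ?_ ?_ ?_ ?_ ?_) <;> intro x y z t h <;>
    try simp only [Pi.neg_apply, neg_eq_zero]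
  all_goals
    refine comp_eq_zero hf _ x y z t ?_
    rw [← Bool.not_eq_true]
    simp [forwardStd, cell_beq_one, cell_beq_two, cell_beq_three]
    try omega

end Cycles

/-! ### Term order, integer combinations of terms, and a Gröbner criterion. -/

section TermOrder

variable {q n : ℕ}

theorem termKey_lt_iff {v w : Fin q × (Fin n → ℕ)} : termKey w < termKey v ↔
    ∑ i, w.2 i < ∑ i, v.2 i ∨ ∑ i, w.2 i = ∑ i, v.2 i ∧
      (w.1 < v.1 ∨ w.1 = v.1 ∧ toLex w.2 < toLex v.2) := by
  rw [termKey, termKey, Prod.Lex.toLex_lt_toLex, Prod.Lex.toLex_lt_toLex]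

theorem termKey_injective : Function.Injective (termKey : Fin q × (Fin n → ℕ) → _) := by
  intro v w h
  have h1 := congrArg (fun x => (ofLex (ofLex x).2).1) h
  have h2 := congrArg (fun x => (ofLex (ofLex x).2).2) h
  exact Prod.ext h1 h2

theorem sum_le_of_termKey_le {v w : Fin q × (Fin n → ℕ)} (h : termKey w ≤ termKey v) :
    ∑ i, w.2 i ≤ ∑ i, v.2 i := by
  rcases h.lt_or_eq with h | h
  · rcases termKey_lt_iff.1 h with h | h
    · exact h.le
    · exact h.1.le
  · rw [termKey_injective h]

/-- Multiplication of a term by a power product. -/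
def shiftTerm {T : Type*} [Add T] (s : T) (v : Fin q × T) : Fin q × T := (v.1, s + v.2)

theorem termKey_shiftTerm_lt (μ : Fin n → ℕ) {v w : Fin q × (Fin n → ℕ)}
    (h : termKey w < termKey v) : termKey (shiftTerm μ w) < termKey (shiftTerm μ v) := by
  rw [termKey_lt_iff] at h ⊢
  simp only [shiftTerm, Pi.add_apply, Finset.sum_add_distrib, add_lt_add_iff_left, add_right_inj]
  refine h.imp_right fun h => ⟨h.1, h.2.imp_right fun h => ⟨h.1, ?_⟩⟩
  rw [toLex_add, toLex_add]
  exact add_lt_add_right h.2 _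

end TermOrder

section Lists

variable {q : ℕ} {T : Type*}

/-- The element of the free module with integer coefficients given by a list of terms. -/
noncomputable def ev (K : Type*) [Field K] (l : List (ℤ × (Fin q × T))) : FreeMod K q T :=
  (l.map fun c => Finsupp.single c.2 (c.1 : K)).sum

variable {K : Type*} [Field K]

@[simp] theorem ev_nil : ev K ([] : List (ℤ × (Fin q × T))) = 0 := rfl

@[simp] theorem ev_cons (c : ℤ × (Fin q × T)) (l : List (ℤ × (Fin q × T))) :
    ev K (c :: l) = Finsupp.single c.2 (c.1 : K) + ev K l := by
  rw [ev, List.map_cons, List.sum_cons, ev]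

/-- Multiplication of a list of terms by a power product. -/
def shiftList [Add T] (s : T) (l : List (ℤ × (Fin q × T))) : List (ℤ × (Fin q × T)) :=
  l.map fun c => (c.1, shiftTerm s c.2)

theorem shiftList_zero [AddMonoid T] (l : List (ℤ × (Fin q × T))) : shiftList 0 l = l := by
  simp [shiftList, shiftTerm]

theorem shiftList_shiftList [AddSemigroup T] (s t : T) (l : List (ℤ × (Fin q × T))) :
    shiftList s (shiftList t l) = shiftList (s + t) l := by
  simp [shiftList, shiftTerm, add_assoc]

theorem semiShift_ev [AddCommMonoid T] (f : K →+* K) (s : T) (l : List (ℤ × (Fin q × T))) :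
    semiShift (f : K →+ K) s (ev K l) = ev K (shiftList s l) := by
  induction l with
  | nil => simp [shiftList]
  | cons c l ih =>
    obtain ⟨c, j, t⟩ := c
    rw [ev_cons, map_add, ih, semiShift_single]
    simp [shiftList, shiftTerm]

theorem ev_mem_of_forall {M : Submodule K (FreeMod K q T)} {l : List (ℤ × (Fin q × T))}
    (h : ∀ c ∈ l, Finsupp.single c.2 (1 : K) ∈ M) : ev K l ∈ M := by
  induction l with
  | nil => simp
  | cons c l ih =>
    rw [ev_cons]
    refine M.add_mem ?_ (ih fun c hc => h c (List.mem_cons_of_mem _ hc))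
    rw [← mul_one (c.1 : K), ← smul_eq_mul, ← Finsupp.smul_single]
    exact M.smul_mem _ (h c List.mem_cons_self)

end Lists

section Groebner

variable {K : Type*} [Field K] {q n : ℕ} {D : Fin n → AddMonoid.End (FreeMod K q (Fin n → ℕ))}

theorem endOp_ev (τ : Fin n → K →+* K) (i : Fin n) (l : List (ℤ × (Fin q × (Fin n → ℕ)))) :
    endOp τ i (ev K l) = ev K (shiftList (Pi.single i 1) l) :=
  semiShift_ev _ _ _

theorem derOp_ev (d : Fin n → Derivation ℤ K K) (i : Fin n)
    (l : List (ℤ × (Fin q × (Fin n → ℕ)))) :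
    derOp d i (ev K l) = ev K (shiftList (Pi.single i 1) l) := by
  induction l with
  | nil => simp [shiftList]
  | cons c l ih =>
    obtain ⟨c, j, t⟩ := c
    rw [ev_cons, map_add, ih, derOp_single]
    simp [shiftList, shiftTerm]

/-- Integers are killed by derivations and fixed by endomorphisms, so on such elements a power
product merely shifts exponents. All explicit computations take place there. -/
theorem powProd_ev (hD : ∀ i l, D i (ev K l) = ev K (shiftList (Pi.single i 1) l)) (μ : Fin n → ℕ)
    (l : List (ℤ × (Fin q × (Fin n → ℕ)))) : powProd D μ (ev K l) = ev K (shiftList μ l) := by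
  have hpow : ∀ (i : Fin n) (k : ℕ) (l : List (ℤ × (Fin q × (Fin n → ℕ)))),
      (D i ^ k) (ev K l) = ev K (shiftList (Pi.single i k) l) := by
    intro i k l
    induction k generalizing l with
    | zero => simp [shiftList_zero]
    | succ k ih =>
      rw [pow_succ, AddMonoid.End.coe_mul, Function.comp_apply, hD, ih, shiftList_shiftList, ← Pi.single_add]
  have hprod : ∀ L : List (Fin n), (L.map fun i => D i ^ μ i).prod (ev K l) =
      ev K (shiftList (L.map fun i => (Pi.single i (μ i) : Fin n → ℕ)).sum l) := by
    intro L
    induction L with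
    | nil => simp [shiftList_zero]
    | cons i L ih =>
      rw [List.map_cons, List.prod_cons, AddMonoid.End.coe_mul, Function.comp_apply, ih, hpow, shiftList_shiftList,
        List.map_cons, List.sum_cons]
  rw [powProd, List.ofFn_eq_map, hprod, ← List.ofFn_eq_map, List.sum_ofFn,
    Finset.univ_sum_single]

theorem powProd_mem {N : Submodule K (FreeMod K q (Fin n → ℕ))} (hN : ∀ i, ∀ x ∈ N, D i x ∈ N)
    (μ : Fin n → ℕ) {x : FreeMod K q (Fin n → ℕ)} (hx : x ∈ N) : powProd D μ x ∈ N := by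
  have hpow : ∀ (i : Fin n) (k : ℕ), ∀ x ∈ N, (D i ^ k) x ∈ N := by
    intro i k
    induction k with
    | zero => exact fun x hx => hx
    | succ k ih =>
      intro x hx
      rw [pow_succ, AddMonoid.End.coe_mul, Function.comp_apply]
      exact ih _ (hN i x hx)
  have hprod : ∀ L : List (Fin n), (L.map fun i => D i ^ μ i).prod x ∈ N := by
    intro L
    induction L with
    | nil => exact hx
    | cons i L ih =>
      rw [List.map_cons, List.prod_cons, AddMonoid.End.coe_mul, Function.comp_apply]
      exact hpow _ _ _ ih
  rw [powProd, List.ofFn_eq_map]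
  exact hprod _

/-- A list of terms that starts with its leading term, which has coefficient `1` or `-1`. -/
structure IsMonicList (l : List (ℤ × (Fin q × (Fin n → ℕ)))) (v : Fin q × (Fin n → ℕ)) : Prop where
  exists_eq : ∃ c tl, l = (c, v) :: tl ∧ (c = 1 ∨ c = -1) ∧ ∀ w ∈ tl, termKey w.2 < termKey v

theorem IsMonicList.shift {l : List (ℤ × (Fin q × (Fin n → ℕ)))} {v : Fin q × (Fin n → ℕ)}
    (h : IsMonicList l v) (μ : Fin n → ℕ) : IsMonicList (shiftList μ l) (shiftTerm μ v) := by
  obtain ⟨c, tl, rfl, hc, htl⟩ := h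
  refine ⟨c, shiftList μ tl, rfl, hc, fun w hw => ?_⟩
  obtain ⟨u, hu, rfl⟩ := List.mem_map.1 hw
  exact termKey_shiftTerm_lt μ (htl u hu)

theorem ev_apply_eq_zero {l : List (ℤ × (Fin q × (Fin n → ℕ)))} {v : Fin q × (Fin n → ℕ)}
    (h : ∀ w ∈ l, w.2 ≠ v) : ev K l v = 0 := by
  induction l with
  | nil => rfl
  | cons c l ih =>
    rw [ev_cons, Finsupp.add_apply, ih fun w hw => h w (List.mem_cons_of_mem _ hw), add_zero,
      Finsupp.single_apply_eq_zero]
    exact fun hv => absurd hv.symm (h c List.mem_cons_self)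

theorem IsMonicList.apply_ne_zero {l : List (ℤ × (Fin q × (Fin n → ℕ)))}
    {v : Fin q × (Fin n → ℕ)} (h : IsMonicList l v) : ev K l v ≠ 0 := by
  obtain ⟨c, tl, rfl, hc, htl⟩ := h
  rw [ev_cons, Finsupp.add_apply, ev_apply_eq_zero fun w hw he => (htl w hw).ne (by rw [he]),
    add_zero, Finsupp.single_eq_same]
  rcases hc with rfl | rfl <;> simp

theorem IsMonicList.isLeadingTerm {l : List (ℤ × (Fin q × (Fin n → ℕ)))}
    {v : Fin q × (Fin n → ℕ)} (h : IsMonicList l v) : IsLeadingTerm (ev K l) v := by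
  refine ⟨Finsupp.mem_support_iff.2 h.apply_ne_zero, fun w hw => ?_⟩
  obtain ⟨c, tl, rfl, hc, htl⟩ := h
  by_contra hlt
  refine Finsupp.mem_support_iff.1 hw (ev_apply_eq_zero fun u hu he => hlt ?_)
  subst he
  rcases List.mem_cons.1 hu with rfl | hu
  · exact le_rfl
  · exact (htl u hu).le

theorem IsLeadingTerm.unique {f : FreeMod K q (Fin n → ℕ)} {v w : Fin q × (Fin n → ℕ)}
    (hv : IsLeadingTerm f v) (hw : IsLeadingTerm f w) : v = w :=
  termKey_injective (le_antisymm (hw.2 v hv.1) (hv.2 w hw.1))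

theorem exists_isLeadingTerm {f : FreeMod K q (Fin n → ℕ)} (hf : f ≠ 0) :
    ∃ v, IsLeadingTerm f v :=
  Finset.exists_max_image _ termKey (Finsupp.support_nonempty_iff.2 hf)

variable {I : Type*}

/-- The terms that are not divisible by any of the leading terms. -/
def irreducibleTerms (lead : I → Fin q × (Fin n → ℕ)) : Set (Fin q × (Fin n → ℕ)) :=
  {w | ∀ i, (lead i).1 = w.1 → ¬(lead i).2 ≤ w.2}

variable {rules : I → List (ℤ × (Fin q × (Fin n → ℕ)))} {lead : I → Fin q × (Fin n → ℕ)}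
  {N : Submodule K (FreeMod K q (Fin n → ℕ))}

theorem exists_shiftTerm_eq {w : Fin q × (Fin n → ℕ)} (hw : w ∉ irreducibleTerms lead) :
    ∃ i μ, shiftTerm μ (lead i) = w := by
  simp only [irreducibleTerms, Set.mem_ofPred_eq, not_forall, not_not] at hw
  obtain ⟨i, h1, h2⟩ := hw
  exact ⟨i, w.2 - (lead i).2, Prod.ext h1 (tsub_add_cancel_of_le h2)⟩

/-- A reducible term is the leading term, with coefficient ±1, of a shifted rule in `N`; up to sign
it is congruent to smaller terms, and the term order is well-founded. The bound on the keys later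
bounds the orders. -/
theorem single_mem_sup_irreducible (hD : ∀ i l, D i (ev K l) = ev K (shiftList (Pi.single i 1) l))
    (hrules : ∀ i, IsMonicList (rules i) (lead i)) (hN : ∀ i, ∀ x ∈ N, D i x ∈ N)
    (hmem : ∀ i, ev K (rules i) ∈ N) (w : Fin q × (Fin n → ℕ)) :
    Finsupp.single w 1 ∈
      N ⊔ Finsupp.supported K K {v | v ∈ irreducibleTerms lead ∧ termKey v ≤ termKey w} := by
  induction hk : termKey w using WellFoundedLT.induction generalizing w with
  | _ k ih =>
    subst hk
    by_cases hw : w ∈ irreducibleTerms lead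
    · exact Submodule.mem_sup_right (Finsupp.single_mem_supported K _ ⟨hw, le_rfl⟩)
    obtain ⟨i, μ, rfl⟩ := exists_shiftTerm_eq hw
    set w := shiftTerm μ (lead i)
    obtain ⟨c, tl, hl, hc, htl⟩ := ((hrules i).shift μ)
    have h1 : ev K (shiftList μ (rules i)) ∈ N := by
      rw [← powProd_ev hD]; exact powProd_mem hN μ (hmem i)
    rw [hl, ev_cons] at h1
    have h2 : ev K tl ∈
        N ⊔ Finsupp.supported K K {v | v ∈ irreducibleTerms lead ∧ termKey v ≤ termKey w} := by
      refine ev_mem_of_forall fun u hu => ?_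
      refine (sup_le_sup_left (Finsupp.supported_mono ?_) N) (ih _ (htl u hu) u.2 rfl)
      exact fun v hv => ⟨hv.1, hv.2.trans (htl u hu).le⟩
    have h3 := Submodule.sub_mem _ (Submodule.mem_sup_left h1) h2
    rw [add_sub_cancel_right] at h3
    rcases hc with rfl | rfl
    · simpa using h3
    · simpa using Submodule.neg_mem _ h3

/-- An element of `N` whose leading term is irreducible yields a nonzero element of `N` all of whose
terms are irreducible. -/
theorem exists_lead_dvd (hD : ∀ i l, D i (ev K l) = ev K (shiftList (Pi.single i 1) l))
    (hrules : ∀ i, IsMonicList (rules i) (lead i)) (hN : ∀ i, ∀ x ∈ N, D i x ∈ N)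
    (hmem : ∀ i, ev K (rules i) ∈ N)
    (hind : ∀ f ∈ N, (∀ v, f v ≠ 0 → v ∈ irreducibleTerms lead) → f = 0)
    {f : FreeMod K q (Fin n → ℕ)} (hf : f ∈ N) {v : Fin q × (Fin n → ℕ)}
    (hv : IsLeadingTerm f v) : v ∉ irreducibleTerms lead := by
  intro hvS
  -- The other terms of `f` reduce to irreducible terms strictly below `v`, so the coefficient at
  -- `v` cannot be cancelled.
  have htail : f.erase v ∈
      N ⊔ Finsupp.supported K K {u | u ∈ irreducibleTerms lead ∧ termKey u < termKey v} := by
    rw [← Finsupp.sum_single (f.erase v)]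
    refine Submodule.sum_mem _ fun u hu => ?_
    rw [Finsupp.support_erase, Finset.mem_erase] at hu
    have hlt : termKey u < termKey v :=
      lt_of_le_of_ne (hv.2 u hu.2) fun h => hu.1 (termKey_injective h)
    have h1 := (sup_le_sup_left (Finsupp.supported_mono
      (t := {u | u ∈ irreducibleTerms lead ∧ termKey u < termKey v})
      fun v hv => ⟨hv.1, hv.2.trans_lt hlt⟩) N) (single_mem_sup_irreducible hD hrules hN hmem u)
    have h2 := Submodule.smul_mem _ ((f.erase v) u) h1
    rwa [Finsupp.smul_single, smul_eq_mul, mul_one] at h2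
  obtain ⟨m, hm, g, hg, hmg⟩ := Submodule.mem_sup.1 htail
  have hgv : g v = 0 := by
    by_contra hne
    exact lt_irrefl _ ((Finsupp.mem_supported K g).1 hg (Finsupp.mem_support_iff.2 hne)).2
  have hdecomp : Finsupp.single v (f v) + g = f - m := by
    rw [eq_sub_iff_add_eq, add_assoc, add_comm g, hmg, Finsupp.single_add_erase]
  have hzero := hind (Finsupp.single v (f v) + g) (hdecomp ▸ N.sub_mem hf hm) fun u hu => by
    by_cases huv : u = v
    · rwa [huv]
    · rw [Finsupp.add_apply, Finsupp.single_eq_of_ne huv, zero_add] at hu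
      exact ((Finsupp.mem_supported K g).1 hg (Finsupp.mem_support_iff.2 hu)).1
  have := DFunLike.congr_fun hzero v
  rw [Finsupp.add_apply, Finsupp.single_eq_same, hgv, add_zero] at this
  exact Finsupp.mem_support_iff.1 hv.1 this

/-- This takes the place of Buchberger's criterion. By `exists_lead_dvd`, every nonzero element of
`N` admits a reduction step; the result stays in `N` and is zero or has a smaller leading term. -/
theorem isGroebnerBasis_range [Finite I]
    (hD : ∀ i l, D i (ev K l) = ev K (shiftList (Pi.single i 1) l))
    (hrules : ∀ i, IsMonicList (rules i) (lead i)) (hN : ∀ i, ∀ x ∈ N, D i x ∈ N)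
    (hmem : ∀ i, ev K (rules i) ∈ N)
    (hind : ∀ f ∈ N, (∀ v, f v ≠ 0 → v ∈ irreducibleTerms lead) → f = 0) :
    IsGroebnerBasis D (Set.range fun i => ev K (rules i)) N := by
  refine ⟨Set.finite_range _, ?_, fun f hf hf0 => ?_⟩
  · rintro _ ⟨i, rfl⟩
    exact ⟨hmem i, fun h => (hrules i).apply_ne_zero (DFunLike.congr_fun h _)⟩
  obtain ⟨v, hv⟩ := exists_isLeadingTerm hf0
  induction hk : termKey v using WellFoundedLT.induction generalizing v f with
  | _ k ih =>
    subst hk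
    obtain ⟨i, μ, rfl⟩ := exists_shiftTerm_eq (exists_lead_dvd hD hrules hN hmem hind hf hv)
    set v := shiftTerm μ (lead i)
    have hg : IsLeadingTerm (powProd D μ (ev K (rules i))) v := by
      rw [powProd_ev hD]; exact ((hrules i).shift μ).isLeadingTerm
    set g := powProd D μ (ev K (rules i)) with hgdef
    set h := f - (f v / g v) • g with hh
    have hstep : ∃ g' ∈ Set.range fun i => ev K (rules i), ReducesOnce D g' f h :=
      ⟨_, ⟨i, rfl⟩, μ, v, hv, hg, rfl⟩
    refine Relation.ReflTransGen.head hstep ?_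
    by_cases h0 : h = 0
    · rw [h0]
    have hhN : h ∈ N := N.sub_mem hf (N.smul_mem _ (powProd_mem hN μ (hmem i)))
    obtain ⟨u, hu⟩ := exists_isLeadingTerm h0
    refine ih (termKey u) ?_ h hhN h0 u hu rfl
    have hhv : h v = 0 := by
      rw [hh, Finsupp.sub_apply, Finsupp.smul_apply, smul_eq_mul,
        div_mul_cancel₀ _ (Finsupp.mem_support_iff.1 hg.1), sub_self]
    have hne : u ≠ v := fun e => Finsupp.mem_support_iff.1 hu.1 (e ▸ hhv)
    refine lt_of_le_of_ne ?_ fun e => hne (termKey_injective e)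
    by_cases hfu : f u = 0
    · refine hg.2 u (Finsupp.mem_support_iff.2 fun hgu => Finsupp.mem_support_iff.1 hu.1 ?_)
      rw [hh, Finsupp.sub_apply, Finsupp.smul_apply, hfu, hgu, smul_zero, sub_zero]
    · exact hv.2 u (Finsupp.mem_support_iff.2 hfu)

end Groebner

/-! ### Tables of operator words with decidable leading terms. -/

section OperatorLists

variable {n : ℕ}

/-- A power product, given by the list of its factors. -/
def opExp (ops : List (Fin n)) : Fin n → ℕ := (ops.map fun i => Pi.single i 1).sum

theorem opExp_apply (ops : List (Fin n)) (i : Fin n) : opExp ops i = ops.count i := by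
  induction ops with
  | nil => rfl
  | cons a ops ih =>
    have : opExp (a :: ops) = Pi.single a 1 + opExp ops := rfl
    rw [this, Pi.add_apply, List.count_cons, ← ih, Pi.single_apply, add_comm]
    rcases eq_or_ne i a with rfl | h
    · simp
    · simp [h, h.symm]

theorem opExp_le {ops : List (Fin n)} (h : ops.Nodup) {w : Fin n → ℕ} (hw : ∀ i ∈ ops, 1 ≤ w i) :
    opExp ops ≤ w := fun i => by
  rw [opExp_apply]
  by_cases hi : i ∈ ops
  · exact (List.nodup_iff_count_le_one.1 h i).trans (hw i hi)
  · rw [List.count_eq_zero_of_not_mem hi]; exact Nat.zero_le _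

theorem sum_opExp (ops : List (Fin n)) : ∑ i, opExp ops i = ops.length := by
  induction ops with
  | nil => simp [opExp]
  | cons a ops ih =>
    have : opExp (a :: ops) = Pi.single a 1 + opExp ops := rfl
    rw [this]
    simp [Finset.sum_add_distrib, ih, add_comm]

/-- A term `(c, j, ops)` stands for `c` times the product of the operators in `ops`, applied to the
`j`-th generator. -/
abbrev OpTerm (n : ℕ) := ℤ × Fin 12 × List (Fin n)

/-- The list of terms described by a list of operator words. -/
def terms (l : List (OpTerm n)) : List (ℤ × (Fin 12 × (Fin n → ℕ))) :=
  l.map fun c => (c.1, (c.2.1, opExp c.2.2))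

/-- The first term of the list. -/
def leadTerm (l : List (OpTerm n)) : Fin 12 × (Fin n → ℕ) := (l.headI.2.1, opExp l.headI.2.2)

/-- The first term has coefficient `1` or `-1` and is the largest one, which is seen from the orders
and the indices of the generators. -/
def isMonic : List (OpTerm n) → Bool
  | [] => false
  | c :: tl => (c.1 = 1 ∨ c.1 = -1) ∧ ∀ w ∈ tl, w.2.2.length < c.2.2.length ∨
      w.2.2.length = c.2.2.length ∧ w.2.1 < c.2.1

theorem isMonicList_terms {l : List (OpTerm n)} (h : isMonic l) :
    IsMonicList (terms l) (leadTerm l) := by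
  cases l with
  | nil => simp [isMonic] at h
  | cons c tl =>
    simp only [isMonic, decide_eq_true_eq] at h
    refine ⟨c.1, terms tl, rfl, h.1, fun w hw => ?_⟩
    obtain ⟨u, hu, rfl⟩ := List.mem_map.1 hw
    rw [termKey_lt_iff]
    change ∑ i, opExp u.2.2 i < ∑ i, opExp c.2.2 i ∨ ∑ i, opExp u.2.2 i = ∑ i, opExp c.2.2 i ∧ _
    rw [sum_opExp, sum_opExp]
    exact (h.2 u hu).imp_right fun h => ⟨h.1, Or.inl h.2⟩

variable {K : Type*} [Field K] {D : Fin n → AddMonoid.End (FreeMod K 12 (Fin n → ℕ))}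
  {N : Submodule K (FreeMod K 12 (Fin n → ℕ))}

/-- The elements described by a table of operator words. -/
noncomputable def tableSet (K : Type*) [Field K] (L : List (List (OpTerm n))) :
    Set (FreeMod K 12 (Fin n → ℕ)) :=
  {x | ∃ l ∈ L, x = ev K (terms l)}

theorem tableSet_cons (l : List (OpTerm n)) (L : List (List (OpTerm n))) :
    tableSet K (l :: L) = insert (ev K (terms l)) (tableSet K L) := by
  ext x; simp [tableSet]

theorem tableSet_nil : tableSet K ([] : List (List (OpTerm n))) = ∅ := by
  ext x; simp [tableSet]

theorem tableSet_append (L L' : List (List (OpTerm n))) :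
    tableSet K (L ++ L') = tableSet K L ∪ tableSet K L' := by
  ext x; simp [tableSet, or_and_right, exists_or]

theorem range_eq_tableSet (L : List (List (OpTerm n))) :
    (Set.range fun l : {l // l ∈ L} => ev K (terms l.1)) = tableSet K L := by
  ext x; simp [tableSet, eq_comm]

theorem finite_mem_list {α : Type*} (L : List α) : Finite {l // l ∈ L} := L.finite_toSet

theorem isGroebnerBasis_tableSet {L : List (List (OpTerm n))}
    (hD : ∀ i l, D i (ev K l) = ev K (shiftList (Pi.single i 1) l)) (hL : ∀ l ∈ L, isMonic l)
    (hN : ∀ i, ∀ x ∈ N, D i x ∈ N) (hmem : tableSet K L ⊆ N)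
    (hind : ∀ f ∈ N, (∀ v, f v ≠ 0 →
      v ∈ irreducibleTerms fun l : {l // l ∈ L} => leadTerm l.1) → f = 0) :
    IsGroebnerBasis D (tableSet K L) N := by
  have := finite_mem_list L
  rw [← range_eq_tableSet]
  exact isGroebnerBasis_range (lead := fun l => leadTerm l.1) hD
    (fun l => isMonicList_terms (hL _ l.2)) hN (fun l => hmem ⟨_, l.2, rfl⟩) hind

/-- Elements with different leading terms are different, and since the leading coefficients are ±1
the leading terms are the same over every field. -/
theorem ncard_tableSet {L : List (List (OpTerm n))} (hL : ∀ l ∈ L, isMonic l)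
    (hnd : (L.map leadTerm).Nodup) : (tableSet K L).ncard = L.length := by
  have hinj : Function.Injective fun l : {l // l ∈ L} => ev K (terms l.1) := by
    intro l l' h
    have h1 := (isMonicList_terms (hL _ l.2)).isLeadingTerm (K := K)
    have h2 := (isMonicList_terms (hL _ l'.2)).isLeadingTerm (K := K)
    simp only at h
    rw [h] at h1
    exact Subtype.ext (List.inj_on_of_nodup_map hnd l.2 l'.2 (h1.unique h2))
  rw [← range_eq_tableSet, ← Nat.card_coe_set_eq, Nat.card_range_of_injective hinj]
  have h := Set.ncard_coe_finset (⟨L, hnd.of_map _⟩ : Finset (List (OpTerm n)))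
  rwa [← Nat.card_coe_set_eq] at h

/-- A squarefree word divides a term as soon as all its letters occur in the term. Irreducibility
thus becomes a list of disjunctions about vanishing exponents, which is what the case checks use. -/
theorem not_le_of_mem_irreducible {L : List (List (OpTerm n))} {v : Fin 12 × (Fin n → ℕ)}
    (hv : v ∈ irreducibleTerms fun l : {l // l ∈ L} => leadTerm l.1) :
    ∀ l ∈ L, l.headI.2.1 = v.1 → l.headI.2.2.Nodup → ∃ i ∈ l.headI.2.2, v.2 i = 0 := by
  intro l hl hj hnd
  by_contra! h
  exact hv ⟨l, hl⟩ hj (opExp_le hnd fun i hi => Nat.one_le_iff_ne_zero.2 (h i hi))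

end OperatorLists

/-! ### Explicit tables for the forward scheme. -/

theorem maxwell_eq {F : Type*} [AddCommGroup F] (D : Fin 4 → AddMonoid.End F) (p : Fin 12 → F) :
    maxwell D p = {D 0 (p 6) + D 1 (p 7) + D 2 (p 8), D 0 (p 9) + D 1 (p 10) + D 2 (p 11),
      D 1 (p 2) - D 2 (p 1) + D 3 (p 9), D 2 (p 0) - D 0 (p 2) + D 3 (p 10),
      D 0 (p 1) - D 1 (p 0) + D 3 (p 11), D 1 (p 5) - D 2 (p 4) - D 3 (p 6),
      D 2 (p 3) - D 0 (p 5) - D 3 (p 7), D 0 (p 4) - D 1 (p 3) - D 3 (p 8)} := by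
  refine Set.Subset.antisymm ?_ ?_
  · rw [Set.subset_def, forall_mem_maxwell]
    simp
  · have := forall_mem_maxwell (D := D) (p := p) (Q := fun x => x ∈ maxwell D p)
    have := this.1 fun x hx => hx
    simp only [Set.insert_subset_iff, Set.singleton_subset_iff]
    exact this

/-- The left-hand sides of the forward difference scheme. -/
def forwardGens : List (List (OpTerm (4 + 4))) :=
  [
   [(1, 8, [2]), (1, 7, [1]), (1, 6, [0]), (-1, 8, []), (-1, 7, []), (-1, 6, [])],
   [(1, 11, [2]), (1, 10, [1]), (1, 9, [0]), (-1, 11, []), (-1, 10, []), (-1, 9, [])],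
   [(1, 9, [3]), (1, 2, [1]), (-1, 1, [2]), (-1, 9, []), (-1, 2, []), (1, 1, [])],
   [(1, 10, [3]), (-1, 2, [0]), (1, 0, [2]), (-1, 10, []), (1, 2, []), (-1, 0, [])],
   [(1, 11, [3]), (1, 1, [0]), (-1, 0, [1]), (-1, 11, []), (-1, 1, []), (1, 0, [])],
   [(-1, 6, [3]), (1, 5, [1]), (-1, 4, [2]), (1, 6, []), (-1, 5, []), (1, 4, [])],
   [(-1, 7, [3]), (-1, 5, [0]), (1, 3, [2]), (1, 7, []), (1, 5, []), (-1, 3, [])],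
   [(-1, 8, [3]), (1, 4, [0]), (-1, 3, [1]), (1, 8, []), (-1, 4, []), (1, 3, [])]]

/-- The Gröbner basis of the forward difference scheme without the relations `αᵢ βᵢ pⱼ - pⱼ`. Every
element is preceded by a sign, an index and a product of operators: up to these relations it is the
corresponding multiple of a left-hand side. -/
def forwardTable : List ((ℤ × Fin 8 × List (Fin (4 + 4))) × List (OpTerm (4 + 4))) :=
  [
   ((-1, 1, [4, 5, 6]), [(1, 11, [4, 5, 6]), (1, 10, [4, 5, 6]), (1, 9, [4, 5, 6]), (-1, 11, [4,
    5]), (-1, 10, [4, 6]), (-1, 9, [5, 6])]),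
   ((-1, 1, [5, 6]), [(-1, 9, [0, 5, 6]), (1, 11, [5, 6]), (1, 10, [5, 6]), (1, 9, [5, 6]), (-1,
    11, [5]), (-1, 10, [6])]),
   ((-1, 0, [4, 5, 6]), [(1, 8, [4, 5, 6]), (1, 7, [4, 5, 6]), (1, 6, [4, 5, 6]), (-1, 8, [4,
    5]), (-1, 7, [4, 6]), (-1, 6, [5, 6])]),
   ((-1, 0, [5, 6]), [(-1, 6, [0, 5, 6]), (1, 8, [5, 6]), (1, 7, [5, 6]), (1, 6, [5, 6]), (-1, 8,
    [5]), (-1, 7, [6])]),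
   ((1, 5, [5, 6, 7]), [(1, 6, [5, 6, 7]), (-1, 5, [5, 6, 7]), (1, 4, [5, 6, 7]), (-1, 6, [5,
    6]), (1, 5, [6, 7]), (-1, 4, [5, 7])]),
   ((-1, 5, [5, 7]), [(1, 4, [2, 5, 7]), (-1, 6, [5, 7]), (1, 5, [5, 7]), (-1, 4, [5, 7]), (1, 6,
    [5]), (-1, 5, [7])]),
   ((-1, 6, [4, 6, 7]), [(-1, 7, [4, 6, 7]), (-1, 5, [4, 6, 7]), (1, 3, [4, 6, 7]), (1, 7, [4,
    6]), (1, 5, [6, 7]), (-1, 3, [4, 7])]),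
   ((1, 6, [4, 7]), [(1, 3, [2, 4, 7]), (1, 7, [4, 7]), (1, 5, [4, 7]), (-1, 3, [4, 7]), (-1, 7,
    [4]), (-1, 5, [7])]),
   ((1, 7, [4, 5, 7]), [(1, 8, [4, 5, 7]), (-1, 4, [4, 5, 7]), (1, 3, [4, 5, 7]), (-1, 8, [4,
    5]), (1, 4, [5, 7]), (-1, 3, [4, 7])]),
   ((1, 7, [4, 7]), [(-1, 3, [1, 4, 7]), (1, 8, [4, 7]), (-1, 4, [4, 7]), (1, 3, [4, 7]), (-1, 8,
    [4]), (1, 4, [7])]),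
   ((1, 2, [5, 6, 7]), [(-1, 9, [5, 6, 7]), (-1, 2, [5, 6, 7]), (1, 1, [5, 6, 7]), (1, 9, [5,
    6]), (1, 2, [6, 7]), (-1, 1, [5, 7])]),
   ((-1, 2, [5, 7]), [(1, 1, [2, 5, 7]), (1, 9, [5, 7]), (1, 2, [5, 7]), (-1, 1, [5, 7]), (-1, 9,
    [5]), (-1, 2, [7])]),
   ((-1, 3, [4, 6, 7]), [(1, 10, [4, 6, 7]), (-1, 2, [4, 6, 7]), (1, 0, [4, 6, 7]), (-1, 10, [4,
    6]), (1, 2, [6, 7]), (-1, 0, [4, 7])]),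
   ((1, 3, [4, 7]), [(1, 0, [2, 4, 7]), (-1, 10, [4, 7]), (1, 2, [4, 7]), (-1, 0, [4, 7]), (1,
    10, [4]), (-1, 2, [7])]),
   ((1, 4, [4, 5, 7]), [(-1, 11, [4, 5, 7]), (-1, 1, [4, 5, 7]), (1, 0, [4, 5, 7]), (1, 11, [4,
    5]), (1, 1, [5, 7]), (-1, 0, [4, 7])]),
   ((1, 4, [4, 7]), [(-1, 0, [1, 4, 7]), (-1, 11, [4, 7]), (-1, 1, [4, 7]), (1, 0, [4, 7]), (1,
    11, [4]), (1, 1, [7])]),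
   ((-1, 7, [7]), [(-1, 4, [0, 7]), (1, 3, [1, 7]), (-1, 8, [7]), (1, 4, [7]), (-1, 3, [7]), (1,
    8, [])]),
   ((-1, 6, [7]), [(1, 5, [0, 7]), (-1, 3, [2, 7]), (-1, 7, [7]), (-1, 5, [7]), (1, 3, [7]), (1,
    7, [])]),
   ((-1, 5, [7]), [(-1, 5, [1, 7]), (1, 4, [2, 7]), (-1, 6, [7]), (1, 5, [7]), (-1, 4, [7]), (1,
    6, [])]),
   ((1, 4, [7]), [(1, 1, [0, 7]), (-1, 0, [1, 7]), (-1, 11, [7]), (-1, 1, [7]), (1, 0, [7]), (1,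
    11, [])]),
   ((1, 3, [7]), [(-1, 2, [0, 7]), (1, 0, [2, 7]), (-1, 10, [7]), (1, 2, [7]), (-1, 0, [7]), (1,
    10, [])]),
   ((1, 2, [7]), [(1, 2, [1, 7]), (-1, 1, [2, 7]), (-1, 9, [7]), (-1, 2, [7]), (1, 1, [7]), (1,
    9, [])]),
   ((1, 1, [6]), [(1, 10, [1, 6]), (1, 9, [0, 6]), (-1, 11, [6]), (-1, 10, [6]), (-1, 9, [6]),
    (1, 11, [])]),
   ((1, 0, [6]), [(1, 7, [1, 6]), (1, 6, [0, 6]), (-1, 8, [6]), (-1, 7, [6]), (-1, 6, [6]), (1,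
    8, [])]),
   ((1, 7, []), [(-1, 8, [3]), (1, 4, [0]), (-1, 3, [1]), (1, 8, []), (-1, 4, []), (1, 3, [])]),
   ((1, 6, []), [(-1, 7, [3]), (-1, 5, [0]), (1, 3, [2]), (1, 7, []), (1, 5, []), (-1, 3, [])]),
   ((1, 5, []), [(-1, 6, [3]), (1, 5, [1]), (-1, 4, [2]), (1, 6, []), (-1, 5, []), (1, 4, [])]),
   ((1, 4, []), [(1, 11, [3]), (1, 1, [0]), (-1, 0, [1]), (-1, 11, []), (-1, 1, []), (1, 0, [])]),
   ((1, 3, []), [(1, 10, [3]), (-1, 2, [0]), (1, 0, [2]), (-1, 10, []), (1, 2, []), (-1, 0, [])]),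
   ((1, 2, []), [(1, 9, [3]), (1, 2, [1]), (-1, 1, [2]), (-1, 9, []), (-1, 2, []), (1, 1, [])]),
   ((1, 1, []), [(1, 11, [2]), (1, 10, [1]), (1, 9, [0]), (-1, 11, []), (-1, 10, []), (-1, 9,
    [])]),
   ((1, 0, []), [(1, 8, [2]), (1, 7, [1]), (1, 6, [0]), (-1, 8, []), (-1, 7, []), (-1, 6, [])])]

/-- The relations `αᵢ βᵢ pⱼ - pⱼ`. -/
def inverseTable : List (List (OpTerm (4 + 4))) :=
  (List.finRange 4).flatMap fun i => (List.finRange 12).map fun j =>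
    [(1, j, [Fin.castAdd 4 i, Fin.natAdd 4 i]), (-1, j, [])]

def basisTable : List (List (OpTerm (4 + 4))) := forwardTable.map Prod.snd ++ inverseTable

theorem isMonic_basisTable : ∀ l ∈ basisTable, isMonic l := by decide +kernel

theorem nodup_basisTable : (basisTable.map leadTerm).Nodup := by decide +kernel

theorem length_basisTable : basisTable.length = 80 := by decide +kernel

section Forward

variable {K : Type*} [Field K] (σ : Fin 4 → K ≃+* K)

theorem alphaOp_single (i : Fin 4) (j : Fin 12) (s : Fin (4 + 4) → ℕ) :
    alphaOp σ i (Finsupp.single (j, s) 1) =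
      Finsupp.single (j, Pi.single (Fin.castAdd 4 i) 1 + s) 1 := by
  rw [alphaOp, endOp, semiShift_single]; simp

theorem betaOp_single (i : Fin 4) (j : Fin 12) (s : Fin (4 + 4) → ℕ) :
    betaOp σ i (Finsupp.single (j, s) 1) =
      Finsupp.single (j, Pi.single (Fin.natAdd 4 i) 1 + s) 1 := by
  rw [betaOp, endOp, semiShift_single]; simp

theorem inverseRelations_eq : inverseRelations (alphaOp σ) (betaOp σ) (gen K (Fin (4 + 4) → ℕ)) =
    tableSet K inverseTable := by
  ext x
  simp only [inverseRelations, Set.mem_ofPred_eq, tableSet, inverseTable, List.mem_flatMap,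
    List.mem_finRange, true_and, List.mem_map]
  constructor
  · rintro ⟨i, j, rfl⟩
    refine ⟨_, ⟨i, j, rfl⟩, ?_⟩
    simp [gen, alphaOp_single, betaOp_single, terms, opExp, sub_eq_add_neg]
  · rintro ⟨_, ⟨i, j, rfl⟩, rfl⟩
    refine ⟨i, j, ?_⟩
    simp [gen, alphaOp_single, betaOp_single, terms, opExp, sub_eq_add_neg]

set_option maxHeartbeats 4000000 in
theorem forwardBasis_eq : forwardBasis (alphaOp σ) (betaOp σ) (gen K (Fin (4 + 4) → ℕ)) =
    tableSet K basisTable := by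
  have c0 : Fin.castAdd 4 (0 : Fin 4) = (0 : Fin (4 + 4)) := rfl
  have c1 : Fin.castAdd 4 (1 : Fin 4) = (1 : Fin (4 + 4)) := rfl
  have c2 : Fin.castAdd 4 (2 : Fin 4) = (2 : Fin (4 + 4)) := rfl
  have c3 : Fin.castAdd 4 (3 : Fin 4) = (3 : Fin (4 + 4)) := rfl
  have n0 : Fin.natAdd 4 (0 : Fin 4) = (4 : Fin (4 + 4)) := rfl
  have n1 : Fin.natAdd 4 (1 : Fin 4) = (5 : Fin (4 + 4)) := rfl
  have n2 : Fin.natAdd 4 (2 : Fin 4) = (6 : Fin (4 + 4)) := rfl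
  have n3 : Fin.natAdd 4 (3 : Fin 4) = (7 : Fin (4 + 4)) := rfl
  rw [basisTable, tableSet_append, ← inverseRelations_eq σ, forwardBasis]
  refine congrArg₂ (· ∪ ·) ?_ rfl
  simp only [forwardTable, List.map_cons, List.map_nil, tableSet_cons, tableSet_nil,
    insert_empty_eq]
  -- The 32 explicit elements are 31 insertions into a singleton.
  iterate 31
    refine congrArg₂ insert ?_ ?_
    · simp only [gen, alphaOp_single, betaOp_single, terms, opExp, List.map_cons, List.map_nil,
        List.sum_cons, List.sum_nil, ev_cons, ev_nil, c0, c1, c2, c3, n0, n1, n2, n3, Int.cast_one,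
        Int.cast_neg, Finsupp.single_neg]
      abel
  refine congrArg singleton ?_
  simp only [gen, alphaOp_single, terms, opExp, List.map_cons, List.map_nil, List.sum_cons,
    List.sum_nil, ev_cons, ev_nil, c0, c1, c2, Int.cast_one, Int.cast_neg, Finsupp.single_neg]
  abel

end Forward

/-! ### Comparison with Laurent terms. -/

theorem castAdd_ne_natAdd (i k : Fin 4) : Fin.castAdd 4 i ≠ Fin.natAdd 4 k :=
  Fin.ne_of_val_ne (by simp only [Fin.val_castAdd, Fin.val_natAdd]; omega)

/-- The term in automorphisms that is represented by a term in the `αᵢ` and `βᵢ`. -/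
def toLaurent (v : Fin 12 × (Fin (4 + 4) → ℕ)) : Fin 12 × (Fin 4 → ℤ) :=
  (v.1, fun i => (v.2 (Fin.castAdd 4 i) : ℤ) - v.2 (Fin.natAdd 4 i))

/-- The shortest term in the `αᵢ` and `βᵢ` that represents a term in automorphisms. -/
def ofLaurent (w : Fin 12 × (Fin 4 → ℤ)) : Fin 12 × (Fin (4 + 4) → ℕ) :=
  (w.1, Fin.append (fun i => (w.2 i).toNat) fun i => (-w.2 i).toNat)

theorem toLaurent_ofLaurent (w : Fin 12 × (Fin 4 → ℤ)) : toLaurent (ofLaurent w) = w := by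
  refine Prod.ext rfl (funext fun i => ?_)
  simp only [toLaurent, ofLaurent, Fin.append_left, Fin.append_right]
  omega

theorem ofLaurent_toLaurent {v : Fin 12 × (Fin (4 + 4) → ℕ)}
    (h : ∀ i : Fin 4, v.2 (Fin.castAdd 4 i) = 0 ∨ v.2 (Fin.natAdd 4 i) = 0) :
    ofLaurent (toLaurent v) = v := by
  refine Prod.ext rfl (funext fun i => ?_)
  induction i using Fin.addCases with
  | left i => simp only [toLaurent, ofLaurent, Fin.append_left]; have := h i; omega
  | right i => simp only [toLaurent, ofLaurent, Fin.append_right]; have := h i; omega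

theorem sum_ofLaurent (w : Fin 12 × (Fin 4 → ℤ)) : ∑ i, (ofLaurent w).2 i = ordInt w.2 := by
  rw [Fin.sum_univ_add, ← Finset.sum_add_distrib, ordInt]
  refine Finset.sum_congr rfl fun i _ => ?_
  simp only [ofLaurent, Fin.append_left, Fin.append_right]
  omega

theorem ordInt_toLaurent_le (v : Fin 12 × (Fin (4 + 4) → ℕ)) :
    ordInt (toLaurent v).2 ≤ ∑ i, v.2 i := by
  rw [Fin.sum_univ_add, ← Finset.sum_add_distrib, ordInt]
  refine Finset.sum_le_sum fun i _ => ?_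
  simp only [toLaurent]
  omega

section Laurent

variable {K : Type*} [Field K]

/-- Passage from the operators `αᵢ`, `βᵢ` to the automorphisms and their inverses. -/
noncomputable def laurent (K : Type*) [Field K] :
    FreeMod K 12 (Fin (4 + 4) → ℕ) →ₗ[K] FreeMod K 12 (Fin 4 → ℤ) :=
  Finsupp.lmapDomain K K toLaurent

theorem laurent_single (v : Fin 12 × (Fin (4 + 4) → ℕ)) (a : K) :
    laurent K (Finsupp.single v a) = Finsupp.single (toLaurent v) a :=
  Finsupp.mapDomain_single

theorem toLaurent_castAdd (i : Fin 4) (j : Fin 12) (t : Fin (4 + 4) → ℕ) :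
    toLaurent (j, Pi.single (Fin.castAdd 4 i) 1 + t) = (j, Pi.single i 1 + (toLaurent (j, t)).2) := by
  refine Prod.ext rfl (funext fun k => ?_)
  have h : Fin.natAdd 4 k ≠ Fin.castAdd 4 i := (castAdd_ne_natAdd i k).symm
  simp only [toLaurent, Pi.add_apply, Pi.single_eq_of_ne h]
  by_cases hk : k = i
  · subst hk; simp; ring
  · rw [Pi.single_eq_of_ne fun h => hk (Fin.castAdd_injective _ _ h)]
    simp [hk]

theorem toLaurent_natAdd (i : Fin 4) (j : Fin 12) (t : Fin (4 + 4) → ℕ) :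
    toLaurent (j, Pi.single (Fin.natAdd 4 i) 1 + t) =
      (j, Pi.single i (-1) + (toLaurent (j, t)).2) := by
  refine Prod.ext rfl (funext fun k => ?_)
  have h : Fin.castAdd 4 k ≠ Fin.natAdd 4 i := castAdd_ne_natAdd k i
  simp only [toLaurent, Pi.add_apply, Pi.single_eq_of_ne h]
  by_cases hk : k = i
  · subst hk; simp; ring
  · rw [Pi.single_eq_of_ne fun h => hk (Fin.natAdd_injective _ _ h)]
    simp [hk]

theorem laurent_alphaOp (σ : Fin 4 → K ≃+* K) (i : Fin 4) (x : FreeMod K 12 (Fin (4 + 4) → ℕ)) :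
    laurent K (alphaOp σ i x) = autOp σ i (laurent K x) := by
  induction x using Finsupp.induction_linear with
  | zero => simp
  | add x y hx hy => simp only [map_add, hx, hy]
  | single v a =>
    obtain ⟨j, t⟩ := v
    rw [alphaOp, endOp, semiShift_single, laurent_single, toLaurent_castAdd, laurent_single]
    show _ = semiShift _ _ (Finsupp.single (j, (toLaurent (j, t)).2) a)
    rw [semiShift_single, alphaBeta, Fin.append_left]

theorem laurent_betaOp (σ : Fin 4 → K ≃+* K) (i : Fin 4) (x : FreeMod K 12 (Fin (4 + 4) → ℕ)) :
    laurent K (betaOp σ i x) = autInvOp σ i (laurent K x) := by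
  induction x using Finsupp.induction_linear with
  | zero => simp
  | add x y hx hy => simp only [map_add, hx, hy]
  | single v a =>
    obtain ⟨j, t⟩ := v
    rw [betaOp, endOp, semiShift_single, laurent_single, toLaurent_natAdd, laurent_single]
    show _ = semiShift _ _ (Finsupp.single (j, (toLaurent (j, t)).2) a)
    rw [semiShift_single, alphaBeta, Fin.append_right]

theorem laurent_gen (j : Fin 12) :
    laurent K (gen K (Fin (4 + 4) → ℕ) j) = gen K (Fin 4 → ℤ) j := by
  rw [gen, laurent_single, gen]
  congr 1

variable (σ : Fin 4 → K ≃+* K)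

/-- The submodule generated by the forward difference scheme and the relations `αᵢ βᵢ pⱼ - pⱼ`. -/
noncomputable abbrev forwardModule : Submodule K (FreeMod K 12 (Fin (4 + 4) → ℕ)) :=
  stableSpan K (endOp (alphaBeta σ))
    (maxwell (forward (alphaOp σ)) (gen K (Fin (4 + 4) → ℕ)) ∪
      inverseRelations (alphaOp σ) (betaOp σ) (gen K (Fin (4 + 4) → ℕ)))

/-- The submodule generated by the forward difference scheme over the ring of inversive difference
operators. -/
noncomputable abbrev inversiveForwardModule : Submodule K (FreeMod K 12 (Fin 4 → ℤ)) :=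
  stableSpan K (Sum.elim (autOp σ) (autInvOp σ)) (maxwell (forward (autOp σ)) (gen K (Fin 4 → ℤ)))

theorem laurent_mem_inversiveForwardModule {x : FreeMod K 12 (Fin (4 + 4) → ℕ)}
    (hx : x ∈ forwardModule σ) : laurent K x ∈ inversiveForwardModule σ := by
  have : forwardModule σ ≤ (inversiveForwardModule σ).comap (laurent K) := by
    refine stableSpan_le ?_ fun i x hx => ?_
    · rintro g (hg | ⟨i, j, rfl⟩)
      · refine subset_stableSpan ?_
        rw [← image_maxwell (laurent K).toAddMonoidHom (D := forward (alphaOp σ))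
          (p := gen K (Fin (4 + 4) → ℕ))]
        · exact ⟨g, hg, rfl⟩
        · intro i j
          show laurent K (alphaOp σ i (gen K _ j) - gen K _ j) =
            autOp σ i (gen K _ j) - gen K _ j
          rw [map_sub, laurent_alphaOp, laurent_gen]
      · rw [SetLike.mem_coe, Submodule.mem_comap, map_sub, laurent_alphaOp, laurent_betaOp,
          autOp_autInvOp, sub_self]
        exact Submodule.zero_mem _
    · induction i using Fin.addCases with
      | left i =>
        show laurent K (alphaOp σ i x) ∈ inversiveForwardModule σ
        rw [laurent_alphaOp]
        exact stableSpan_stable (Sum.inl i) hx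
      | right i =>
        show laurent K (betaOp σ i x) ∈ inversiveForwardModule σ
        rw [laurent_betaOp]
        exact stableSpan_stable (Sum.inr i) hx
  exact this hx

theorem inversiveForwardModule_le_cycles : inversiveForwardModule σ ≤ cycles K 1 (-1) 0 := by
  refine stableSpan_le (maxwell_subset_cycles fun i j => ?_) ?_
  · show autOp σ i (gen K _ j) - gen K _ j = _
    rw [gen, autOp, semiShift_single]
    simp [sub_eq_add_neg]
  · rintro (i | i) x hx
    · exact semiShift_mem_cycles _ _ hx
    · exact semiShift_mem_cycles _ _ hx

/-- If `αᵢ` and `βᵢ` both occur in a term, a shift of `αᵢ βᵢ pⱼ - pⱼ` removes one of each.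
Repetition ends at the shortest term with the same Laurent exponents. -/
theorem single_sub_mem_forwardModule (v : Fin 12 × (Fin (4 + 4) → ℕ)) :
    Finsupp.single v 1 - Finsupp.single (ofLaurent (toLaurent v)) (1 : K) ∈ forwardModule σ := by
  induction hk : ∑ i, v.2 i using Nat.strong_induction_on generalizing v with
  | _ k ih =>
    by_cases h : ∀ i : Fin 4, v.2 (Fin.castAdd 4 i) = 0 ∨ v.2 (Fin.natAdd 4 i) = 0
    · rw [ofLaurent_toLaurent h, sub_self]
      exact Submodule.zero_mem _
    push Not at h
    obtain ⟨i, ha, hb⟩ := h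
    obtain ⟨j, t⟩ := v
    obtain ⟨s, rfl⟩ : ∃ s : Fin (4 + 4) → ℕ, t = (Pi.single (Fin.castAdd 4 i) 1 : Fin (4 + 4) → ℕ) +
        ((Pi.single (Fin.natAdd 4 i) 1 : Fin (4 + 4) → ℕ) + s) := by
      refine ⟨fun k => t k - (Pi.single (Fin.natAdd 4 i) 1 : Fin (4 + 4) → ℕ) k -
        (Pi.single (Fin.castAdd 4 i) 1 : Fin (4 + 4) → ℕ) k, ?_⟩
      funext k
      have hne : Fin.castAdd 4 i ≠ Fin.natAdd 4 i := castAdd_ne_natAdd i i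
      show t k = (Pi.single (Fin.castAdd 4 i) 1 : Fin (4 + 4) → ℕ) k +
        ((Pi.single (Fin.natAdd 4 i) 1 : Fin (4 + 4) → ℕ) k +
          (t k - (Pi.single (Fin.natAdd 4 i) 1 : Fin (4 + 4) → ℕ) k -
            (Pi.single (Fin.castAdd 4 i) 1 : Fin (4 + 4) → ℕ) k))
      rcases eq_or_ne k (Fin.castAdd 4 i) with rfl | h1
      · rw [Pi.single_eq_same, Pi.single_eq_of_ne hne]; simp only at ha; omega
      · rcases eq_or_ne k (Fin.natAdd 4 i) with rfl | h2
        · rw [Pi.single_eq_same, Pi.single_eq_of_ne hne.symm]; simp only at hb; omega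
        · rw [Pi.single_eq_of_ne h1, Pi.single_eq_of_ne h2]; omega
    have h1 := ih (∑ k, s k) (by
      rw [← hk]
      simp only [Pi.add_apply, Finset.sum_add_distrib, Finset.sum_pi_single', Finset.mem_univ,
        if_true]
      omega) (j, s) rfl
    have h2 : toLaurent (j, Pi.single (Fin.castAdd 4 i) 1 + (Pi.single (Fin.natAdd 4 i) 1 + s)) =
        toLaurent (j, s) := by
      rw [toLaurent_castAdd, toLaurent_natAdd]
      refine Prod.ext rfl ?_
      show Pi.single i 1 + (Pi.single i (-1) + (toLaurent (j, s)).2) = _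
      rw [← add_assoc, ← Pi.single_add]
      simp
    have h3 : ev K [(1, (j, Pi.single (Fin.castAdd 4 i) 1 + Pi.single (Fin.natAdd 4 i) 1)),
        (-1, (j, 0))] ∈ forwardModule σ := by
      refine subset_stableSpan (Or.inr ⟨i, j, ?_⟩)
      simp [gen, alphaOp_single, betaOp_single, sub_eq_add_neg]
    have h4 := powProd_mem (fun i x hx => stableSpan_stable i hx) s h3
    rw [powProd_ev (endOp_ev _)] at h4
    rw [h2]
    have h5 := Submodule.add_mem _ h4 h1
    simp only [shiftList, shiftTerm, List.map_cons, List.map_nil, ev_cons, ev_nil, add_zero,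
      Int.cast_one, Int.cast_neg, Finsupp.single_neg, add_comm s, zero_add, add_assoc] at h5
    simpa [add_assoc, sub_eq_add_neg] using h5

/-- Modulo the inverse relations every element equals the lift of its Laurent image. Membership in
`forwardModule` can therefore be checked on Laurent terms. -/
theorem mem_forwardModule_of_laurent_eq_zero {x : FreeMod K 12 (Fin (4 + 4) → ℕ)}
    (hx : laurent K x = 0) : x ∈ forwardModule σ := by
  have h : ∀ x : FreeMod K 12 (Fin (4 + 4) → ℕ),
      x - Finsupp.lmapDomain K K ofLaurent (laurent K x) ∈ forwardModule σ := by
    intro x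
    induction x using Finsupp.induction_linear with
    | zero => simp
    | add x y hx hy =>
      rw [map_add, map_add, add_sub_add_comm]
      exact Submodule.add_mem _ hx hy
    | single v a =>
      have := Submodule.smul_mem _ a (single_sub_mem_forwardModule σ v)
      rw [laurent_single, Finsupp.lmapDomain_apply, Finsupp.mapDomain_single]
      simpa [smul_sub] using this
  simpa [hx] using h x

end Laurent

/-! ### The Gröbner basis and the standard terms of the forward scheme. -/

section Forward

variable {K : Type*} [Field K]

theorem ev_perm {q : ℕ} {T : Type*} {l l' : List (ℤ × (Fin q × T))} (h : l.Perm l') :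
    ev K l = ev K l' := (h.map _).sum_eq

theorem laurent_ev (l : List (ℤ × (Fin 12 × (Fin (4 + 4) → ℕ)))) :
    laurent K (ev K l) = ev K (l.map fun c => (c.1, toLaurent c.2)) := by
  induction l with
  | nil => simp
  | cons c l ih => rw [ev_cons, map_add, ih, laurent_single, List.map_cons, ev_cons]

theorem smul_ev {q : ℕ} {T : Type*} (a : ℤ) (l : List (ℤ × (Fin q × T))) :
    (a : K) • ev K l = ev K (l.map fun c => (a * c.1, c.2)) := by
  induction l with
  | nil => simp
  | cons c l ih =>
    rw [ev_cons, smul_add, ih, List.map_cons, ev_cons, Finsupp.smul_single]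
    simp

/-- The membership certificate: in Laurent exponents each tabulated element has the same terms, in
another order, as the recorded signed shift of a left-hand side. -/
theorem forwardTable_perm : ∀ e ∈ forwardTable,
    ((terms e.2).map fun c => (c.1, toLaurent c.2)).Perm
      (((shiftList (opExp e.1.2.2) (terms (forwardGens.getD e.1.2.1 []))).map
        fun c => (e.1.1 * c.1, c.2)).map fun c => (c.1, toLaurent c.2)) := by
  decide +kernel

variable (σ : Fin 4 → K ≃+* K)

theorem maxwell_forward_eq : maxwell (forward (alphaOp σ)) (gen K (Fin (4 + 4) → ℕ)) =
    tableSet K forwardGens := by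
  have hf : ∀ (i : Fin 4) (j : Fin 12), forward (alphaOp σ) i (Finsupp.single (j, 0) 1) =
      alphaOp σ i (Finsupp.single (j, 0) 1) - (Finsupp.single (j, 0) 1 : FreeMod K 12 _) :=
    fun _ _ => rfl
  have c0 : Fin.castAdd 4 (0 : Fin 4) = (0 : Fin (4 + 4)) := rfl
  have c1 : Fin.castAdd 4 (1 : Fin 4) = (1 : Fin (4 + 4)) := rfl
  have c2 : Fin.castAdd 4 (2 : Fin 4) = (2 : Fin (4 + 4)) := rfl
  have c3 : Fin.castAdd 4 (3 : Fin 4) = (3 : Fin (4 + 4)) := rfl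
  rw [maxwell_eq]
  simp only [forwardGens, tableSet_cons, tableSet_nil, insert_empty_eq]
  iterate 7
    refine congrArg₂ insert ?_ ?_
    · simp only [hf, gen, alphaOp_single, terms, opExp, List.map_cons, List.map_nil,
        List.sum_cons, List.sum_nil, ev_cons, ev_nil, c0, c1, c2, c3, Int.cast_one,
        Int.cast_neg, Finsupp.single_neg]
      abel
  refine congrArg singleton ?_
  simp only [hf, gen, alphaOp_single, terms, opExp, List.map_cons, List.map_nil,
    List.sum_cons, List.sum_nil, ev_cons, ev_nil, c0, c1, c3, Int.cast_one,
    Int.cast_neg, Finsupp.single_neg]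
  abel

theorem basisTable_subset : tableSet K basisTable ⊆ forwardModule σ := by
  rw [basisTable, tableSet_append, ← inverseRelations_eq σ]
  refine Set.union_subset ?_ fun x hx => subset_stableSpan (Or.inr hx)
  rintro _ ⟨l, hl, rfl⟩
  obtain ⟨e, he, rfl⟩ := List.mem_map.1 hl
  have hgen : ev K (terms (forwardGens.getD e.1.2.1 [])) ∈ forwardModule σ := by
    by_cases h : (e.1.2.1 : ℕ) < forwardGens.length
    · refine subset_stableSpan (Or.inl ?_)
      rw [maxwell_forward_eq]
      exact ⟨_, by rw [List.getD_eq_getElem _ _ h]; exact List.getElem_mem h, rfl⟩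
    -- An index beyond the table would select the empty list, which stands for zero.
    · rw [List.getD_eq_default _ _ (not_lt.1 h)]
      exact Submodule.zero_mem _
  have h1 := powProd_mem (fun i x hx => stableSpan_stable i hx) (opExp e.1.2.2) hgen
  rw [powProd_ev (endOp_ev _)] at h1
  have h2 := Submodule.smul_mem _ ((e.1.1 : ℤ) : K) h1
  rw [smul_ev] at h2
  have h3 := mem_forwardModule_of_laurent_eq_zero σ
    (x := ev K (terms e.2) - ev K ((shiftList (opExp e.1.2.2)
      (terms (forwardGens.getD e.1.2.1 []))).map fun c => (e.1.1 * c.1, c.2))) (by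
    rw [map_sub, laurent_ev, laurent_ev, ev_perm (forwardTable_perm e he), sub_self])
  have h4 := Submodule.add_mem _ h3 h2
  rwa [sub_add_cancel] at h4

/-- The terms that are irreducible with respect to the Gröbner basis. -/
abbrev forwardIrreducible : Set (Fin 12 × (Fin (4 + 4) → ℕ)) :=
  irreducibleTerms fun l : {l // l ∈ basisTable} => leadTerm l.1

theorem eq_zero_or_of_mem_forwardIrreducible {v : Fin 12 × (Fin (4 + 4) → ℕ)}
    (hv : v ∈ forwardIrreducible) (i : Fin 4) :
    v.2 (Fin.castAdd 4 i) = 0 ∨ v.2 (Fin.natAdd 4 i) = 0 := by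
  have hmem : [((1 : ℤ), v.1, [Fin.castAdd 4 i, Fin.natAdd 4 i]), (-1, v.1, [])] ∈ basisTable := by
    refine List.mem_append_right _ (List.mem_flatMap.2 ⟨i, List.mem_finRange i, ?_⟩)
    exact List.mem_map.2 ⟨v.1, List.mem_finRange _, rfl⟩
  have h := not_le_of_mem_irreducible hv _ hmem rfl
    (List.nodup_cons.2 ⟨by rw [List.mem_singleton]; exact castAdd_ne_natAdd i i,
      List.nodup_singleton _⟩)
  obtain ⟨k, hk, h0⟩ := h
  rcases List.mem_cons.1 hk with rfl | hk
  · exact Or.inl h0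
  · rw [List.mem_singleton] at hk
    exact Or.inr (hk ▸ h0)

-- One inclusion suffices. Irreducible terms span and terms of `cellSet forwardStd` are independent;
-- through the inclusion each set acquires the property proved for the other.
set_option maxHeartbeats 1600000 in
theorem toLaurent_mem_cellSet {v : Fin 12 × (Fin (4 + 4) → ℕ)} (hv : v ∈ forwardIrreducible) :
    toLaurent v ∈ cellSet forwardStd := by
  have h : ∀ e ∈ forwardTable, e.2.headI.2.1 = v.1 → e.2.headI.2.2.Nodup →
      ∃ i ∈ e.2.headI.2.2, v.2 i = 0 := fun e he =>
    not_le_of_mem_irreducible hv _ (List.mem_append_left _ (List.mem_map_of_mem he))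
  have h0 := eq_zero_or_of_mem_forwardIrreducible hv 0
  have h1 := eq_zero_or_of_mem_forwardIrreducible hv 1
  have h2 := eq_zero_or_of_mem_forwardIrreducible hv 2
  have h3 := eq_zero_or_of_mem_forwardIrreducible hv 3
  obtain ⟨j, t⟩ := v
  change t 0 = 0 ∨ t 4 = 0 at h0
  change t 1 = 0 ∨ t 5 = 0 at h1
  change t 2 = 0 ∨ t 6 = 0 at h2
  change t 3 = 0 ∨ t 7 = 0 at h3
  have hc : (fun i => cell ((toLaurent (j, t)).2 i)) = ![cell ((t 0 : ℤ) - t 4),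
      cell ((t 1 : ℤ) - t 5), cell ((t 2 : ℤ) - t 6), cell ((t 3 : ℤ) - t 7)] := by
    funext i
    fin_cases i <;> rfl
  show forwardStd j (fun i => cell ((toLaurent (j, t)).2 i)) = true
  rw [hc]
  clear hc
  fin_cases j <;>
  · simp [forwardTable] at h
    simp [forwardStd, cell_beq_one, cell_beq_two, cell_beq_three]
    omega

/-- No irreducible term contains both `αᵢ` and `βᵢ`, so distinct irreducible terms have distinct
Laurent exponents. Nothing cancels under `laurent`, and independence is inherited from the Laurent
side. -/
theorem eq_zero_of_mem_forwardModule {f : FreeMod K 12 (Fin (4 + 4) → ℕ)}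
    (hf : f ∈ forwardModule σ) (hs : ∀ v, f v ≠ 0 → v ∈ forwardIrreducible) : f = 0 := by
  have hinj : Set.InjOn toLaurent (forwardIrreducible : Set (Fin 12 × (Fin (4 + 4) → ℕ))) :=
    fun v hv w hw h => by
      rw [← ofLaurent_toLaurent (eq_zero_or_of_mem_forwardIrreducible hv), h,
        ofLaurent_toLaurent (eq_zero_or_of_mem_forwardIrreducible hw)]
  have hsup : (f.support : Set (Fin 12 × (Fin (4 + 4) → ℕ))) ⊆ forwardIrreducible :=
    fun v hv => hs v (Finsupp.mem_support_iff.1 hv)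
  have h0 : laurent K f = 0 := by
    refine eq_zero_forward
      (inversiveForwardModule_le_cycles σ (laurent_mem_inversiveForwardModule σ hf)) fun w hw => ?_
    classical
    have h1 := Finsupp.mapDomain_support (Finsupp.mem_support_iff.2 hw)
    obtain ⟨v, hv, rfl⟩ := Finset.mem_image.1 h1
    exact toLaurent_mem_cellSet (hsup hv)
  refine Finsupp.mapDomain_injOn _ hinj hsup (by simp) ?_
  rw [Finsupp.mapDomain_zero]
  exact h0

theorem isGroebnerBasis_forward :
    IsGroebnerBasis (endOp (alphaBeta σ))
      (forwardBasis (alphaOp σ) (betaOp σ) (gen K (Fin (4 + 4) → ℕ))) (forwardModule σ) := by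
  rw [forwardBasis_eq]
  exact isGroebnerBasis_tableSet (endOp_ev _) isMonic_basisTable
    (fun i x hx => stableSpan_stable i hx) (basisTable_subset σ)
    fun f hf hs => eq_zero_of_mem_forwardModule σ hf hs

theorem ncard_forwardBasis :
    (forwardBasis (alphaOp σ) (betaOp σ) (gen K (Fin (4 + 4) → ℕ))).ncard = 80 := by
  rw [forwardBasis_eq, ncard_tableSet isMonic_basisTable nodup_basisTable, length_basisTable]

/-- To reduce a Laurent term, it is lifted to its shortest representative, reduced modulo the
Gröbner basis and mapped back. The order does not rise: the lift has total degree `ordInt w.2`,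
reduction does not increase the total degree, and cancelling `αᵢ` against `βᵢ` can only decrease it.
-/
theorem isStandard_forward :
    IsStandard (inversiveForwardModule σ) (cellSet forwardStd) fun v => ordInt v.2 where
  indep f hf hs := eq_zero_forward (inversiveForwardModule_le_cycles σ hf) hs
  span w := by
    have h1 := single_mem_sup_irreducible (K := K) (N := forwardModule σ)
      (rules := fun l : {l // l ∈ basisTable} => terms l.1) (lead := fun l => leadTerm l.1)
      (endOp_ev _) (fun l => isMonicList_terms (isMonic_basisTable _ l.2))
      (fun i x hx => stableSpan_stable i hx) (fun l => basisTable_subset σ ⟨_, l.2, rfl⟩)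
      (ofLaurent w)
    have h2 := Submodule.mem_map_of_mem (f := laurent K) h1
    rw [laurent_single, toLaurent_ofLaurent, Submodule.map_sup] at h2
    refine (sup_le_sup ?_ ?_ : _ ⊔ _ ≤ inversiveForwardModule σ ⊔ _) h2
    · rintro _ ⟨x, hx, rfl⟩
      exact laurent_mem_inversiveForwardModule σ hx
    · refine (Finsupp.lmapDomain_supported K K _ _).le.trans (Finsupp.supported_mono ?_)
      rintro _ ⟨v, hv, rfl⟩
      refine ⟨toLaurent_mem_cellSet hv.1, (ordInt_toLaurent_le v).trans ?_⟩
      exact (sum_le_of_termKey_le hv.2).trans (sum_ofLaurent w).le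

end Forward

/-! ### The systems as linear forms, and the forward dimension polynomial. -/

section Systems

theorem forward_apply {F : Type*} [AddCommGroup F] (A : Fin 4 → AddMonoid.End F) (i : Fin 4) (x : F) :
    forward A i x = A i x - x := rfl

theorem symmetric_apply {K F : Type*} [Field K] [AddCommGroup F] [Module K F]
    (A A' : Fin 4 → AddMonoid.End F) (i : Fin 4) (x : F) :
    symmetric K A A' i x = (1 / 2 : K) • (A i x - A' i x) := rfl

variable {K : Type*} [Field K]

theorem linForm_gen {q : ℕ} {T : Type*} [AddCommMonoid T] (j : Fin q) :
    linForm K _ (gen K T j) = indet K T j := by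
  rw [gen, linForm_single, map_one, one_mul, indet]

theorem autPoly_indet (σ : Fin 4 → K ≃+* K) (i : Fin 4) (j : Fin 12) :
    autPoly σ i (indet K (Fin 4 → ℤ) j) = linForm K _ (autOp σ i (gen K _ j)) := by
  rw [← linForm_gen]
  exact semiShiftPoly_linForm _ _ _

theorem autInvPoly_indet (σ : Fin 4 → K ≃+* K) (i : Fin 4) (j : Fin 12) :
    autInvPoly σ i (indet K (Fin 4 → ℤ) j) = linForm K _ (autInvOp σ i (gen K _ j)) := by
  rw [← linForm_gen]
  exact semiShiftPoly_linForm _ _ _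

theorem maxwell_derPoly (d : Fin 4 → Derivation ℤ K K) :
    maxwell (derPoly d) (indet K (Fin 4 → ℕ)) =
      linForm K _ '' maxwell (derOp d) (gen K (Fin 4 → ℕ)) :=
  (image_maxwell (linForm K (Fin 12 × (Fin 4 → ℕ))).toAddMonoidHom fun i j => by
    rw [← linForm_gen, derPoly_linForm]; rfl).symm

theorem maxwell_forward_autPoly (σ : Fin 4 → K ≃+* K) :
    maxwell (forward (autPoly σ)) (indet K (Fin 4 → ℤ)) =
      linForm K _ '' maxwell (forward (autOp σ)) (gen K (Fin 4 → ℤ)) :=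
  (image_maxwell (linForm K (Fin 12 × (Fin 4 → ℤ))).toAddMonoidHom fun i j => by
    rw [LinearMap.toAddMonoidHom_coe, forward_apply, forward_apply, map_sub, autPoly_indet, linForm_gen]).symm

theorem maxwell_symmetric_autPoly (σ : Fin 4 → K ≃+* K) :
    maxwell (symmetric K (autPoly σ) (autInvPoly σ)) (indet K (Fin 4 → ℤ)) =
      linForm K _ '' maxwell (symmetric K (autOp σ) (autInvOp σ)) (gen K (Fin 4 → ℤ)) :=
  (image_maxwell (linForm K (Fin 12 × (Fin 4 → ℤ))).toAddMonoidHom fun i j => by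
    rw [LinearMap.toAddMonoidHom_coe, symmetric_apply, symmetric_apply, map_smul, map_sub, autPoly_indet, autInvPoly_indet]).symm

end Systems

section ForwardDimension

variable {K : Type*} [Field K] (σ : Fin 4 → K ≃+* K)

theorem isModuleDimPoly_forward : IsModuleDimPoly ordInt (inversiveForwardModule σ) forwardPoly :=
  isModuleDimPoly_of_isStandard (isStandard_forward σ) ncard_forwardStd

theorem isSystemDimPoly_forward : IsSystemDimPoly ordInt
    (stableSpan _ (Sum.elim (autPoly σ) (autInvPoly σ))
      (maxwell (forward (autPoly σ)) (indet K (Fin 4 → ℤ)))) forwardPoly := by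
  rw [maxwell_forward_autPoly, stableSpan_autPoly]
  exact isSystemDimPoly_of_isStandard (isStandard_forward σ) ncard_forwardStd

end ForwardDimension

/-! ### The differential equations. -/

section Differential

variable {K : Type*} [Field K] (d : Fin 4 → Derivation ℤ K K)

/-- The left-hand sides of the differential equations. -/
def differentialGens : List (List (OpTerm 4)) :=
  [[(1, 8, [2]), (1, 7, [1]), (1, 6, [0])], [(1, 11, [2]), (1, 10, [1]), (1, 9, [0])],
   [(1, 9, [3]), (1, 2, [1]), (-1, 1, [2])], [(1, 10, [3]), (-1, 2, [0]), (1, 0, [2])],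
   [(1, 11, [3]), (1, 1, [0]), (-1, 0, [1])], [(-1, 6, [3]), (1, 5, [1]), (-1, 4, [2])],
   [(-1, 7, [3]), (-1, 5, [0]), (1, 3, [2])], [(-1, 8, [3]), (1, 4, [0]), (-1, 3, [1])]]

theorem isMonic_differentialGens : ∀ l ∈ differentialGens, isMonic l := by decide +kernel

theorem maxwell_differential_eq :
    maxwell (derOp d) (gen K (Fin 4 → ℕ)) = tableSet K differentialGens := by
  have hf : ∀ (i : Fin 4) (j : Fin 12), derOp d i (Finsupp.single (j, 0) 1) =
      (Finsupp.single (j, Pi.single i 1) 1 : FreeMod K 12 _) := fun i j => by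
    rw [derOp_single, Derivation.map_one_eq_zero, Finsupp.single_zero, zero_add, add_zero]
  rw [maxwell_eq]
  simp only [differentialGens, tableSet_cons, tableSet_nil, insert_empty_eq]
  iterate 7
    refine congrArg₂ insert ?_ ?_
    · simp only [hf, gen, terms, opExp, List.map_cons, List.map_nil, List.sum_cons, List.sum_nil,
        ev_cons, ev_nil, Int.cast_one, Int.cast_neg, Finsupp.single_neg, add_zero]
      abel
  refine congrArg singleton ?_
  simp only [hf, gen, terms, opExp, List.map_cons, List.map_nil, List.sum_cons, List.sum_nil,
    ev_cons, ev_nil, Int.cast_one, Int.cast_neg, Finsupp.single_neg, add_zero]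
  abel

/-- Terms with exponents in `ℕ` as terms with exponents in `ℤ`. -/
def toInt (v : Fin 12 × (Fin 4 → ℕ)) : Fin 12 × (Fin 4 → ℤ) := (v.1, fun i => v.2 i)

theorem toInt_injective : Function.Injective toInt := fun _ _ h =>
  Prod.ext (congrArg (fun u => u.1) h :) (funext fun i => Int.ofNat_injective
    (congrFun (congrArg (fun u => u.2) h :) i))

theorem ordInt_toInt (v : Fin 12 × (Fin 4 → ℕ)) : ordInt (toInt v).2 = ordNat v.2 := rfl

/-- The derivations of the free module, extended to terms with exponents in `ℤ`. -/
noncomputable def derOpInt (i : Fin 4) : AddMonoid.End (FreeMod K 12 (Fin 4 → ℤ)) :=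
  semiShift (d i : K →+ K) 0 + semiShift (AddMonoidHom.id K) (Pi.single i 1)

theorem derOpInt_single (i : Fin 4) (j : Fin 12) (t : Fin 4 → ℤ) (a : K) :
    derOpInt d i (Finsupp.single (j, t) a) =
      Finsupp.single (j, t) (d i a) + Finsupp.single (j, Pi.single i 1 + t) a := by
  show semiShift (d i : K →+ K) 0 (Finsupp.single (j, t) a) +
    semiShift (AddMonoidHom.id K) (Pi.single i 1) (Finsupp.single (j, t) a) = _
  rw [semiShift_single, semiShift_single, zero_add]
  rfl

theorem mapDomain_derOp (i : Fin 4) (x : FreeMod K 12 (Fin 4 → ℕ)) :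
    Finsupp.mapDomain toInt (derOp d i x) = derOpInt d i (Finsupp.mapDomain toInt x) := by
  induction x using Finsupp.induction_linear with
  | zero => simp
  | add x y hx hy => rw [map_add, Finsupp.mapDomain_add, hx, hy, Finsupp.mapDomain_add, map_add]
  | single v a =>
    obtain ⟨j, t⟩ := v
    have h : toInt (j, Pi.single i 1 + t) = (j, Pi.single i 1 + (toInt (j, t)).2) := by
      refine Prod.ext rfl (funext fun k => ?_)
      simp only [toInt, Pi.add_apply, Pi.single_apply]
      split <;> simp
    rw [derOp_single, Finsupp.mapDomain_add, Finsupp.mapDomain_single, Finsupp.mapDomain_single,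
      Finsupp.mapDomain_single, h]
    exact (derOpInt_single d i j _ a).symm

/-- The submodule generated by the differential equations. -/
noncomputable abbrev differentialModule : Submodule K (FreeMod K 12 (Fin 4 → ℕ)) :=
  stableSpan K (derOp d) (maxwell (derOp d) (gen K (Fin 4 → ℕ)))

/-- Natural exponents are embedded in the integers, so that the cycle equations make sense at all
lattice points. The two summands of `derOpInt`, differentiation of coefficients and shift of
exponents, preserve cycles separately. -/
theorem mapDomain_mem_cycles {x : FreeMod K 12 (Fin 4 → ℕ)} (hx : x ∈ differentialModule d) :
    Finsupp.mapDomain toInt x ∈ cycles K 1 0 0 := by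
  have : differentialModule d ≤ (cycles K 1 0 0).comap (Finsupp.lmapDomain K K toInt) := by
    refine stableSpan_le (fun g hg => ?_) fun i x hx => ?_
    · have h1 := image_maxwell (Finsupp.lmapDomain K K toInt).toAddMonoidHom (D := derOp d)
        (D' := derOpInt d) (p := gen K (Fin 4 → ℕ)) (p' := gen K _) fun i j => by
          refine (mapDomain_derOp d i _).trans ?_
          rw [gen, Finsupp.mapDomain_single]
          rfl
      refine maxwell_subset_cycles (D := derOpInt d) (fun i j => ?_) (h1 ▸ ⟨g, hg, rfl⟩)
      rw [gen, derOpInt_single, Derivation.map_one_eq_zero]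
      simp
    · show Finsupp.mapDomain toInt (derOp d i x) ∈ cycles K 1 0 0
      rw [mapDomain_derOp]
      exact Submodule.add_mem _ (semiShift_mem_cycles _ _ hx) (semiShift_mem_cycles _ _ hx)
  exact this hx

abbrev differentialIrreducible : Set (Fin 12 × (Fin 4 → ℕ)) :=
  irreducibleTerms fun l : {l // l ∈ differentialGens} => leadTerm l.1

theorem toInt_mem_cellSet {v : Fin 12 × (Fin 4 → ℕ)} (hv : v ∈ differentialIrreducible) :
    toInt v ∈ cellSet differentialStd := by
  have h := not_le_of_mem_irreducible hv
  obtain ⟨j, t⟩ := v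
  show differentialStd j (fun i => cell (t i : ℤ)) = true
  fin_cases j <;>
  · simp [differentialGens] at h
    simp [differentialStd, cell_beq_zero, cell_eq_three, h]

theorem eq_zero_of_mem_differentialModule {f : FreeMod K 12 (Fin 4 → ℕ)}
    (hf : f ∈ differentialModule d) (hs : ∀ v, f v ≠ 0 → toInt v ∈ cellSet differentialStd) :
    f = 0 := by
  refine Finsupp.mapDomain_injective toInt_injective ?_
  rw [Finsupp.mapDomain_zero]
  refine eq_zero_differential (mapDomain_mem_cycles d hf) fun w hw => ?_
  classical
  obtain ⟨v, hv, rfl⟩ := Finset.mem_image.1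
    (Finsupp.mapDomain_support (Finsupp.mem_support_iff.2 hw))
  exact hs v (Finsupp.mem_support_iff.1 hv)

theorem isGroebnerBasis_differential :
    IsGroebnerBasis (derOp d) (maxwell (derOp d) (gen K (Fin 4 → ℕ))) (differentialModule d) := by
  have h : maxwell (derOp d) (gen K (Fin 4 → ℕ)) ⊆ differentialModule d := subset_stableSpan
  refine (maxwell_differential_eq d).symm ▸ isGroebnerBasis_tableSet (derOp_ev d)
    isMonic_differentialGens (fun i x hx => stableSpan_stable i hx) (maxwell_differential_eq d ▸ h)
    fun f hf hs => ?_
  exact eq_zero_of_mem_differentialModule d hf fun v hv => toInt_mem_cellSet (hs v hv)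

theorem isStandard_differential :
    IsStandard (differentialModule d) (toInt ⁻¹' cellSet differentialStd) fun v => ordNat v.2 where
  indep f hf hs := eq_zero_of_mem_differentialModule d hf hs
  span w := by
    have h1 := single_mem_sup_irreducible (K := K) (N := differentialModule d)
      (rules := fun l : {l // l ∈ differentialGens} => terms l.1) (lead := fun l => leadTerm l.1)
      (derOp_ev d) (fun l => isMonicList_terms (isMonic_differentialGens _ l.2))
      (fun i x hx => stableSpan_stable i hx)
      (fun l => subset_stableSpan (maxwell_differential_eq d ▸ ⟨_, l.2, rfl⟩)) w
    refine (sup_le_sup_left (Finsupp.supported_mono ?_) _ : _ ≤ differentialModule d ⊔ _) h1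
    exact fun v hv => ⟨toInt_mem_cellSet hv.1, sum_le_of_termKey_le hv.2⟩

/-- The pattern `differentialStd` excludes negative exponents, so `toInt` maps the set to be counted
bijectively onto the one already counted, with the same orders. -/
theorem ncard_preimage_differentialStd :
    ∀ᶠ r : ℕ in Filter.atTop,
      {v | v ∈ toInt ⁻¹' cellSet differentialStd ∧ ordNat v.2 ≤ r}.Finite ∧
      ({v | v ∈ toInt ⁻¹' cellSet differentialStd ∧ ordNat v.2 ≤ r}.ncard : ℚ) =
        differentialPoly.eval (r : ℚ) := by
  filter_upwards [ncard_differentialStd] with r hr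
  have h : toInt '' {v | v ∈ toInt ⁻¹' cellSet differentialStd ∧ ordNat v.2 ≤ r} =
      {v | v ∈ cellSet differentialStd ∧ ordInt v.2 ≤ r} := by
    refine Set.Subset.antisymm ?_ fun w hw => ?_
    · rintro _ ⟨v, hv, rfl⟩
      exact hv
    · obtain ⟨j, t⟩ := w
      have h0 : ∀ i, 0 ≤ t i := by
        have := hw.1
        change differentialStd j (fun i => cell (t i)) = true at this
        simp only [differentialStd, Bool.and_eq_true, bne_iff_ne, ne_eq, cell_eq_three] at this
        simp only [Fin.forall_fin_succ, IsEmpty.forall_iff, and_true]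
        simpa [and_assoc] using this.1.1
      have h1 : toInt (j, fun i => (t i).toNat) = (j, t) :=
        Prod.ext rfl (funext fun i => Int.toNat_of_nonneg (h0 i))
      refine ⟨(j, fun i => (t i).toNat), ⟨?_, ?_⟩, h1⟩
      · rw [Set.mem_preimage, h1]; exact hw.1
      · rw [← ordInt_toInt, h1]; exact hw.2
  rw [← h, Set.finite_image_iff toInt_injective.injOn,
    Set.ncard_image_of_injective _ toInt_injective] at hr
  exact hr

theorem isModuleDimPoly_differential :
    IsModuleDimPoly ordNat (differentialModule d) differentialPoly :=
  isModuleDimPoly_of_isStandard (isStandard_differential d) ncard_preimage_differentialStd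

theorem isSystemDimPoly_differential : IsSystemDimPoly ordNat
    (stableSpan _ (derPoly d) (maxwell (derPoly d) (indet K (Fin 4 → ℕ)))) differentialPoly := by
  rw [maxwell_derPoly, stableSpan_derPoly]
  exact isSystemDimPoly_of_isStandard (isStandard_differential d) ncard_preimage_differentialStd

end Differential

/-! ### The symmetric scheme. -/

section Symmetric

theorem ordInt_single_add {n : ℕ} (k : Fin n) (c : ℤ) (s : Fin n → ℤ) :
    ordInt (Pi.single k c + s) + (s k).natAbs = (c + s k).natAbs + ordInt s := by
  have h : ∑ i ∈ Finset.univ.erase k, ((Pi.single k c + s : Fin n → ℤ) i).natAbs =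
      ∑ i ∈ Finset.univ.erase k, (s i).natAbs := Finset.sum_congr rfl fun i hi => by
    rw [Pi.add_apply, Pi.single_eq_of_ne (Finset.ne_of_mem_erase hi), zero_add]
  rw [ordInt, ordInt, ← Finset.add_sum_erase _ _ (Finset.mem_univ k), h,
    ← Finset.add_sum_erase _ (fun i => (s i).natAbs) (Finset.mem_univ k), Pi.add_apply,
    Pi.single_eq_same]
  omega

theorem forall_of_forall_single_add {n : ℕ} {C : (Fin n → ℤ) → Prop} (h0 : C 0)
    (h1 : ∀ i s, C s → C (Pi.single i 1 + s)) (h2 : ∀ i s, C s → C (Pi.single i (-1) + s))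
    (s : Fin n → ℤ) : C s := by
  have key : ∀ i (c : ℤ) s, C s → C (Pi.single i c + s) := by
    intro i c
    induction c using Int.induction_on with
    | zero => intro s hs; simpa using hs
    | succ c ih =>
      intro s hs
      rw [add_comm (c : ℤ), Pi.single_add, add_assoc]
      exact h1 i _ (ih s hs)
    | pred c ih =>
      intro s hs
      rw [sub_eq_add_neg, add_comm (-(c : ℤ)), Pi.single_add, add_assoc]
      exact h2 i _ (ih s hs)
  have h := Finset.sum_induction (s := Finset.univ) (fun i => Pi.single i (s i))
    (fun a => ∀ s, C s → C (a + s)) (fun a b ha hb s hs => by rw [add_assoc]; exact ha _ (hb _ hs))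
    (fun s hs => by rwa [zero_add]) (fun i _ => key i (s i)) 0 h0
  rwa [Finset.univ_sum_single, add_zero] at h

variable {K : Type*} [Field K]

/-- Twice the symmetric difference operator, without action on the coefficients. -/
noncomputable def centralDiff (K : Type*) [Field K] (i : Fin 4) :
    AddMonoid.End (FreeMod K 12 (Fin 4 → ℤ)) :=
  semiShift (AddMonoidHom.id K) (Pi.single i 1) - semiShift (AddMonoidHom.id K) (Pi.single i (-1))

theorem centralDiff_single (i : Fin 4) (j : Fin 12) (s : Fin 4 → ℤ) :
    centralDiff K i (Finsupp.single (j, s) 1) =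
      Finsupp.single (j, Pi.single i 1 + s) 1 - Finsupp.single (j, Pi.single i (-1) + s) 1 := by
  show semiShift (AddMonoidHom.id K) (Pi.single i 1) (Finsupp.single (j, s) 1) -
    semiShift (AddMonoidHom.id K) (Pi.single i (-1)) (Finsupp.single (j, s) 1) = _
  rw [semiShift_single, semiShift_single]
  rfl

theorem semiShift_sub {q : ℕ} {T : Type*} [AddCommMonoid T] (f : K →+ K) (s : T)
    (x y : FreeMod K q T) : semiShift f s (x - y) = semiShift f s x - semiShift f s y :=
  eq_sub_of_add_eq (by rw [← map_add, sub_add_cancel])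

theorem semiShift_centralDiff_single (f : K →+* K) (s : Fin 4 → ℤ) (i : Fin 4) (j : Fin 12)
    (t : Fin 4 → ℤ) :
    semiShift (f : K →+ K) s (centralDiff K i (Finsupp.single (j, t) 1)) =
      centralDiff K i (Finsupp.single (j, s + t) 1) := by
  rw [centralDiff_single, centralDiff_single, semiShift_sub, semiShift_single, semiShift_single,
    add_left_comm, add_left_comm s]
  simp only [AddMonoidHom.coe_coe, map_one]

theorem image_semiShift_maxwell_centralDiff (f : K →+* K) (s t : Fin 4 → ℤ) :
    (semiShift (f : K →+ K) s : FreeMod K 12 (Fin 4 → ℤ) →+ FreeMod K 12 (Fin 4 → ℤ)) ''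
        maxwell (centralDiff K) (fun j => Finsupp.single (j, t) 1) =
      maxwell (centralDiff K) fun j => Finsupp.single (j, s + t) 1 :=
  image_maxwell _ fun i j => semiShift_centralDiff_single f s i j t

section Reduction

variable {M : Submodule K (FreeMod K 12 (Fin 4 → ℤ))} {r : ℕ}

theorem centralDiff_mem {j : Fin 12} (hM : ∀ s, ordInt s ≤ r → Finsupp.single (j, s) 1 ∈ M) (i : Fin 4)
    {s : Fin 4 → ℤ} (hs : ordInt s + 1 ≤ r) :
    centralDiff K i (Finsupp.single (j, s) 1) ∈ M := by
  rw [centralDiff_single]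
  have h1 := ordInt_single_add i 1 s
  have h2 := ordInt_single_add i (-1) s
  exact M.sub_mem (hM _ (by omega)) (hM _ (by omega))

/-- An equation for the central difference in direction `k` reduces the `k`-th exponent to `0` or
`1`. -/
theorem single_mem_of_centralDiff_mem {Q : (Fin 4 → ℤ) → Prop} (k : Fin 4) {j : Fin 12}
    (hQ : ∀ s c, Q s → Q (Pi.single k c + s))
    (h : ∀ s, ordInt s + 1 ≤ r → centralDiff K k (Finsupp.single (j, s) 1) ∈ M)
    (hbase : ∀ s, Q s → ordInt s ≤ r → s k = 0 ∨ s k = 1 → Finsupp.single (j, s) 1 ∈ M)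
    (s : Fin 4 → ℤ) (hs : Q s) (hr : ordInt s ≤ r) : Finsupp.single (j, s) 1 ∈ M := by
  -- The measure is twice the distance from `s k` to 1/2, the midpoint of the targets 0 and 1. A
  -- step of two towards them lowers it.
  induction hm : (2 * s k - 1).natAbs using Nat.strong_induction_on generalizing s with
  | _ m ih =>
    by_cases h01 : s k = 0 ∨ s k = 1
    · exact hbase s hs hr h01
    have key : ∀ c, ordInt (Pi.single k c + s) + 1 ≤ r →
        Finsupp.single (j, Pi.single k (1 + c) + s) 1 -
          Finsupp.single (j, Pi.single k (-1 + c) + s) 1 ∈ M := fun c hc => by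
      have := h _ hc
      rwa [centralDiff_single, ← add_assoc, ← Pi.single_add, ← add_assoc, ← Pi.single_add] at this
    have hv : ∀ c : ℤ, (Pi.single k c + s : Fin 4 → ℤ) k = c + s k := fun c => by
      rw [Pi.add_apply, Pi.single_eq_same]
    have red : ∀ c : ℤ, (2 * (c + s k) - 1).natAbs < m → (c + s k).natAbs ≤ (s k).natAbs →
        Finsupp.single (j, Pi.single k c + s) 1 ∈ M := fun c h1 h2 => by
      have h3 := ordInt_single_add k c s
      exact ih _ h1 _ (hQ _ _ hs) (by omega) (by rw [hv])
    -- The equation is centred one place nearer to 0 than `s k`, so its centre has order one less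
    -- than that of `s`, and all its terms have order at most `r`.
    rcases lt_or_ge (s k) 0 with hneg | hpos
    · have h1 := ordInt_single_add k 1 s
      have h2 := key 1 (by omega)
      rw [neg_add_cancel, Pi.single_zero, zero_add] at h2
      exact (M.sub_mem_iff_right (red (1 + 1) (by omega) (by omega))).1 h2
    · have h1 := ordInt_single_add k (-1) s
      have h2 := key (-1) (by omega)
      rw [add_neg_cancel, Pi.single_zero, zero_add] at h2
      exact (M.sub_mem_iff_left (red (-1 + -1) (by omega) (by omega))).1 h2

/-- All terms in the components of E and H are standard, so the curl equations put the time
differences of D and B into `M`, and the time exponent can be brought to 0 or 1. This settles the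
first two components of D and of B. The divergence equations then give the z-differences of the
third components, whose z-exponent is reduced with the time exponent kept at 0 or 1. -/
theorem single_mem_of_maxwell_subset
    (hmax : ∀ s, maxwell (centralDiff K) (fun j => Finsupp.single (j, s) 1) ⊆ M)
    (hstd : ∀ v ∈ cellSet symmetricStd, ordInt v.2 ≤ r → Finsupp.single v 1 ∈ M)
    (w : Fin 12 × (Fin 4 → ℤ)) (hw : ordInt w.2 ≤ r) : Finsupp.single w 1 ∈ M := by
  have hmem : ∀ j (s : Fin 4 → ℤ), (j < 6 ∨ s 3 = 0 ∨ s 3 = 1) →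
      (j ≠ 8 ∧ j ≠ 11 ∨ s 2 = 0 ∨ s 2 = 1) → ordInt s ≤ r → Finsupp.single (j, s) 1 ∈ M := by
    intro j s h1 h2 hs
    refine hstd _ ?_ hs
    show symmetricStd j (fun i => cell (s i)) = true
    simpa [symmetricStd, cell_beq_zero, cell_beq_one, or_assoc] using And.intro h1 h2
  have low : ∀ j : Fin 12, j < 6 → ∀ s, ordInt s ≤ r → Finsupp.single (j, s) 1 ∈ M := by
    intro j hj s hs
    refine hmem j s (Or.inl hj) (Or.inl ?_) hs
    constructor <;> rintro rfl <;> exact absurd hj (by decide)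
  have hgen := fun s => forall_mem_maxwell.1 (hmax s)
  have htime : ∀ j : Fin 12, 6 ≤ j → ∀ s, ordInt s + 1 ≤ r →
      centralDiff K 3 (Finsupp.single (j, s) 1) ∈ M := by
    intro j hj s hs
    have hl := fun (j : Fin 12) (hj : j < 6) (i : Fin 4) => centralDiff_mem (low j hj) i hs
    obtain ⟨-, -, g9, g10, g11, g6, g7, g8⟩ := hgen s
    have hadd : ∀ {a b c : FreeMod K 12 (Fin 4 → ℤ)}, a - b + c ∈ M → a ∈ M → b ∈ M → c ∈ M :=
      fun h ha hb => (M.add_mem_iff_right (M.sub_mem ha hb)).1 h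
    have hsub : ∀ {a b c : FreeMod K 12 (Fin 4 → ℤ)}, a - b - c ∈ M → a ∈ M → b ∈ M → c ∈ M :=
      fun h ha hb => (M.sub_mem_iff_right (M.sub_mem ha hb)).1 h
    have : j = 6 ∨ j = 7 ∨ j = 8 ∨ j = 9 ∨ j = 10 ∨ j = 11 := by omega
    rcases this with rfl | rfl | rfl | rfl | rfl | rfl
    · exact hsub g6 (hl 5 (by decide) 1) (hl 4 (by decide) 2)
    · exact hsub g7 (hl 3 (by decide) 2) (hl 5 (by decide) 0)
    · exact hsub g8 (hl 4 (by decide) 0) (hl 3 (by decide) 1)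
    · exact hadd g9 (hl 2 (by decide) 1) (hl 1 (by decide) 2)
    · exact hadd g10 (hl 0 (by decide) 2) (hl 2 (by decide) 0)
    · exact hadd g11 (hl 1 (by decide) 0) (hl 0 (by decide) 1)
  have hxy : ∀ j : Fin 12, 6 ≤ j → j ≠ 8 ∧ j ≠ 11 → ∀ s, ordInt s ≤ r →
      Finsupp.single (j, s) 1 ∈ M := fun j hj hj' s hs =>
    single_mem_of_centralDiff_mem (Q := fun _ => True) 3 (fun _ _ h => h) (htime j hj)
      (fun s _ hs h => hmem j s (Or.inr h) (Or.inl hj') hs) s trivial hs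
  have hspace : ∀ j : Fin 12, j = 8 ∨ j = 11 → ∀ s, ordInt s + 1 ≤ r →
      centralDiff K 2 (Finsupp.single (j, s) 1) ∈ M := by
    rintro j (rfl | rfl) s hs
    · exact (M.add_mem_iff_right (M.add_mem (centralDiff_mem (hxy 6 (by decide) (by decide)) 0 hs)
        (centralDiff_mem (hxy 7 (by decide) (by decide)) 1 hs))).1 (hgen s).1
    · exact (M.add_mem_iff_right (M.add_mem (centralDiff_mem (hxy 9 (by decide) (by decide)) 0 hs)
        (centralDiff_mem (hxy 10 (by decide) (by decide)) 1 hs))).1 (hgen s).2.1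
  have hz : ∀ j : Fin 12, 6 ≤ j → j = 8 ∨ j = 11 → ∀ s, ordInt s ≤ r →
      Finsupp.single (j, s) 1 ∈ M := fun j hj hj' s hs =>
    single_mem_of_centralDiff_mem (Q := fun _ => True) 3 (fun _ _ h => h) (htime j hj)
      (fun s _ hs h => single_mem_of_centralDiff_mem (Q := fun s => s 3 = 0 ∨ s 3 = 1) 2
        (fun s c h => by simpa using h) (hspace j hj')
        (fun s h hs h' => hmem j s (Or.inr h) (Or.inr h') hs) s h hs) s trivial hs
  obtain ⟨j, s⟩ := w
  rcases lt_or_ge j 6 with hj | hj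
  · exact low j hj s hw
  · by_cases hj' : j = 8 ∨ j = 11
    · exact hz j hj hj' s hw
    · exact hxy j hj (not_or.1 hj') s hw

end Reduction

variable [CharZero K] (σ : Fin 4 → K ≃+* K)

/-- The submodule generated by the symmetric difference scheme. -/
noncomputable abbrev symmetricModule : Submodule K (FreeMod K 12 (Fin 4 → ℤ)) :=
  stableSpan K (Sum.elim (autOp σ) (autInvOp σ))
    (maxwell (symmetric K (autOp σ) (autInvOp σ)) (gen K (Fin 4 → ℤ)))

theorem two_smul_symmetric (i : Fin 4) (j : Fin 12) :
    (2 : K) • symmetric K (autOp σ) (autInvOp σ) i (gen K (Fin 4 → ℤ) j) =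
      centralDiff K i (Finsupp.single (j, 0) 1) := by
  rw [symmetric_apply, smul_smul, mul_one_div_cancel two_ne_zero, one_smul, gen, autOp, autInvOp,
    semiShift_single, semiShift_single, centralDiff_single]
  simp

theorem image_two_smul_maxwell_symmetric :
    (DistribSMul.toAddMonoidHom (FreeMod K 12 (Fin 4 → ℤ)) (2 : K)) ''
        maxwell (symmetric K (autOp σ) (autInvOp σ)) (gen K (Fin 4 → ℤ)) =
      maxwell (centralDiff K) fun j => Finsupp.single (j, 0) 1 :=
  image_maxwell _ (two_smul_symmetric σ)

/-- Doubling removes the factor 1/2 and leaves integer coefficients, so each automorphism only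
translates the equations. Unit steps in both directions reach every translate. -/
theorem maxwell_centralDiff_subset (s : Fin 4 → ℤ) :
    maxwell (centralDiff K) (fun j => Finsupp.single (j, s) 1) ⊆ symmetricModule σ := by
  refine forall_of_forall_single_add (C := fun s => maxwell (centralDiff K)
    (fun j => Finsupp.single (j, s) 1) ⊆ symmetricModule σ) ?_ ?_ ?_ s
  · rw [← image_two_smul_maxwell_symmetric σ]
    rintro _ ⟨x, hx, rfl⟩
    exact Submodule.smul_mem _ _ (subset_stableSpan hx)
  · intro i s hs
    rw [← image_semiShift_maxwell_centralDiff (σ i : K →+* K)]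
    rintro _ ⟨x, hx, rfl⟩
    exact stableSpan_stable (D := Sum.elim (autOp σ) (autInvOp σ)) (Sum.inl i) (hs hx)
  · intro i s hs
    rw [← image_semiShift_maxwell_centralDiff ((σ i).symm : K →+* K)]
    rintro _ ⟨x, hx, rfl⟩
    exact stableSpan_stable (D := Sum.elim (autOp σ) (autInvOp σ)) (Sum.inr i) (hs hx)

theorem symmetricModule_le_cycles : symmetricModule σ ≤ cycles K 1 0 (-1) := by
  refine stableSpan_le (fun x hx => ?_) ?_
  · have h : maxwell (centralDiff K) (gen K (Fin 4 → ℤ)) ⊆ cycles K 1 0 (-1) :=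
      maxwell_subset_cycles fun i j => by
        rw [gen, centralDiff_single]
        simp [sub_eq_add_neg]
    have h1 : (2 : K) • x ∈ cycles K 1 0 (-1) := by
      refine h ?_
      show _ ∈ maxwell (centralDiff K) fun j => Finsupp.single (j, 0) 1
      rw [← image_two_smul_maxwell_symmetric σ]
      exact Set.mem_image_of_mem _ hx
    exact (Submodule.smul_mem_iff _ two_ne_zero).1 h1
  · rintro (i | i) x hx
    · exact semiShift_mem_cycles _ _ hx
    · exact semiShift_mem_cycles _ _ hx

theorem isStandard_symmetric :
    IsStandard (symmetricModule σ) (cellSet symmetricStd) fun v => ordInt v.2 where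
  indep f hf hs := eq_zero_symmetric (symmetricModule_le_cycles σ hf) hs
  span w := by
    refine single_mem_of_maxwell_subset (r := ordInt w.2) (fun s => ?_) (fun v hv hr => ?_) w le_rfl
    · exact (maxwell_centralDiff_subset σ s).trans (SetLike.coe_subset_coe.2 le_sup_left)
    · exact Submodule.mem_sup_right (Finsupp.single_mem_supported K 1 ⟨hv, hr⟩)

theorem isModuleDimPoly_symmetric : IsModuleDimPoly ordInt (symmetricModule σ) symmetricPoly :=
  isModuleDimPoly_of_isStandard (isStandard_symmetric σ) ncard_symmetricStd

theorem isSystemDimPoly_symmetric : IsSystemDimPoly ordInt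
    (stableSpan _ (Sum.elim (autPoly σ) (autInvPoly σ))
      (maxwell (symmetric K (autPoly σ) (autInvPoly σ)) (indet K (Fin 4 → ℤ)))) symmetricPoly := by
  rw [maxwell_symmetric_autPoly, stableSpan_autPoly]
  exact isSystemDimPoly_of_isStandard (isStandard_symmetric σ) ncard_symmetricStd

end Symmetric

/-! ### Comparison of the two difference schemes. -/

theorem eventually_forwardPoly_lt_symmetricPoly :
    ∀ᶠ r : ℕ in Filter.atTop, forwardPoly.eval (r : ℚ) < symmetricPoly.eval (r : ℚ) := by
  filter_upwards [Filter.eventually_ge_atTop 4] with r hr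
  have h : (4 : ℚ) ≤ r := by exact_mod_cast hr
  simp only [forwardPoly, symmetricPoly, Polynomial.eval_add, Polynomial.eval_mul,
    Polynomial.eval_pow, Polynomial.eval_X, Polynomial.eval_C, Polynomial.eval_ofNat]
  -- The quartic terms agree; the difference is (2/3)r³ + r² - (29/3)r + 10, which is positive for
  -- `r ≥ 4`.
  nlinarith [mul_nonneg (mul_self_nonneg (r : ℚ)) (sub_nonneg.2 h), mul_self_nonneg ((r : ℚ) - 4)]

end EinsteinStrength

open EinsteinStrength in
theorem mainTheorem2 {K L : Type*} [Field K] [Field L] [CharZero L]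
    (d : Fin 4 → Derivation ℤ K K) (hd : ∀ i j a, d i (d j a) = d j (d i a))
    (σ : Fin 4 → L ≃+* L) (hσ : ∀ i j a, σ i (σ j a) = σ j (σ i a)) :
    -- differential equations
    (IsGroebnerBasis (derOp d) (maxwell (derOp d) (gen K (Fin 4 → ℕ)))
        (stableSpan K (derOp d) (maxwell (derOp d) (gen K (Fin 4 → ℕ)))) ∧
      IsSystemDimPoly ordNat
        (stableSpan _ (derPoly d) (maxwell (derPoly d) (indet K (Fin 4 → ℕ))))
        differentialPoly ∧
      IsModuleDimPoly ordNat
        (stableSpan K (derOp d) (maxwell (derOp d) (gen K (Fin 4 → ℕ))))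
        differentialPoly) ∧
    -- forward difference scheme
    ((forwardBasis (alphaOp σ) (betaOp σ) (gen L (Fin (4 + 4) → ℕ))).ncard = 80 ∧
      IsGroebnerBasis (endOp (alphaBeta σ))
        (forwardBasis (alphaOp σ) (betaOp σ) (gen L (Fin (4 + 4) → ℕ)))
        (stableSpan L (endOp (alphaBeta σ))
          (maxwell (forward (alphaOp σ)) (gen L (Fin (4 + 4) → ℕ)) ∪
            inverseRelations (alphaOp σ) (betaOp σ) (gen L (Fin (4 + 4) → ℕ)))) ∧
      IsSystemDimPoly ordInt
        (stableSpan _ (Sum.elim (autPoly σ) (autInvPoly σ))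
          (maxwell (forward (autPoly σ)) (indet L (Fin 4 → ℤ))))
        forwardPoly ∧
      IsModuleDimPoly ordInt
        (stableSpan L (Sum.elim (autOp σ) (autInvOp σ))
          (maxwell (forward (autOp σ)) (gen L (Fin 4 → ℤ))))
        forwardPoly) ∧
    -- symmetric difference scheme
    (IsSystemDimPoly ordInt
        (stableSpan _ (Sum.elim (autPoly σ) (autInvPoly σ))
          (maxwell (symmetric L (autPoly σ) (autInvPoly σ)) (indet L (Fin 4 → ℤ))))
        symmetricPoly ∧
      IsModuleDimPoly ordInt
        (stableSpan L (Sum.elim (autOp σ) (autInvOp σ))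
          (maxwell (symmetric L (autOp σ) (autInvOp σ)) (gen L (Fin 4 → ℤ))))
        symmetricPoly) ∧
    -- comparison: the forward scheme has the smaller dimension polynomial
    (∀ᶠ r : ℕ in Filter.atTop, forwardPoly.eval (r : ℚ) < symmetricPoly.eval (r : ℚ)) := by
  exact ⟨⟨isGroebnerBasis_differential d, isSystemDimPoly_differential d,
      isModuleDimPoly_differential d⟩,
    ⟨ncard_forwardBasis σ, isGroebnerBasis_forward σ, isSystemDimPoly_forward σ,
      isModuleDimPoly_forward σ⟩,
    ⟨isSystemDimPoly_symmetric σ, isModuleDimPoly_symmetric σ⟩,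
    eventually_forwardPoly_lt_symmetricPoly⟩
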